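/- Let $W$ be a random variable with values in $(0,\infty)$ whose law $\nu$ is not a point mass (for instance, any $W$ with a density). For a positive definite matrix $\Sigma\in\mathbb R^{d\times d}$ let $N_\Sigma(\nu)$ be the scale mixture of Normals with mixing distribution $\nu$, i.e. the law of $X=(X_1,\dots,X_d)=Z/\sqrt W$, where $Z$ is independent of $W$ and normally distributed with mean $0$ and covariance matrix $\Sigma$. A correlation matrix is a positive definite matrix with unit diagonal. A regular vine on $d$ variables is a sequence of trees $T_1,\dots,T_{d-1}$ such that the nodes of $T_1$ are $1,\dots,d$, the nodes of $T_{k+1}$ are the edges of $T_k$, and two edges of $T_k$ that are joined by an edge in $T_{k+1}$ share a node of $T_k$. For a node $a$ let $U(a)\subseteq\{1,\dots,d\}$ be the set of variables from which it is built. Each edge $\{a,b\}$ of a tree of the vine stands for the conditional copula of $(X_i,X_j)$ given $(X_k)_{k\in D}$, where $\{i\}=U(a)\setminus U(b)$, $\{j\}=U(b)\setminus U(a)$ and $D=U(a)\cap U(b)$. The law of $X$ is simplified along the vine if for each of these edges there is one bivariate copula $C$ such that, for almost every value $z$ of $(X_k)_{k\in D}$, $$F_{ij|D}(x,y\mid z)=C\big(F_{i|D}(x\mid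 z),F_{j|D}(y\mid z)\big)\qquad\text{for all } x,y\in\mathbb R .$$ The law of $X$ is a simplified pair copula construction (PCC) if it is simplified along some regular vine. Then the following hold. (a) If $d\ge 4$ and $\Sigma$ is any positive definite matrix, then $N_\Sigma(\nu)$ is a simplified PCC if and only if $\nu$ is a Gamma distribution. (b) If $d\ge 3$, then $N_\Sigma(\nu)$ is a simplified PCC for all correlation matrices $\Sigma$ if and only if $\nu$ is a Gamma distribution. (c) In every dimension $d$, if $\nu$ is the Gamma distribution with shape $p>0$ and rate $b>0$, then for every positive definite $\Sigma$ the law $N_\Sigma(\nu)$ is the centred $d$-variate Student-$t$ distribution with $2p$ degrees of freedom and scale matrix $\frac bp\Sigma$, and it is simplified along every regular vine on $d$ variables. Here the Student-$t$ distribution with $n$ degrees of freedom and scale matrix $S$ is the one with density $$\frac{\Gamma\left(\frac{n+d}{2}\right)}{\Gamma\left(\frac n2\right)(n\pi)^{d/2}\sqrt{\det S}}\Big(1+\frac{x^{\top}S^{-1}x}{n}\Big)^{-(n+d)/2}.$$ -/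

import Mathlib

open MeasureTheory ProbabilityTheory Set

noncomputable section

/-! ### Regular vines -/

/-- The possible nodes of the `k`-th tree (counted from `0`) of a regular vine on `d` variables:
the nodes of the first tree are the variables, and a node of each later tree is an unordered
pair of nodes (an edge) of the tree before it. -/
abbrev VineNode (d : ℕ) : ℕ → Type
  | 0 => Fin d
  | k + 1 => Sym2 (VineNode d k)

/-- The complete union of a node: the set of all the variables that it is built from. -/
def VineNode.vars {d : ℕ} : (k : ℕ) → VineNode d k → Finset (Fin d)
  | 0 => fun i => {(show Fin d from i)}
  | k + 1 => Sym2.lift ⟨fun a b => VineNode.vars k a ∪ VineNode.vars k b,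
      fun a b => Finset.union_comm (VineNode.vars k a) (VineNode.vars k b)⟩

/-- The node set of the `k`-th tree: all variables for the first tree, and then the edges of the
tree before it. -/
def vineNodeSet {d : ℕ} (T : (k : ℕ) → SimpleGraph (VineNode d k)) :
    (k : ℕ) → Set (VineNode d k)
  | 0 => Set.univ
  | k + 1 => (T k).edgeSet

/-- A regular vine on `d` variables: a sequence of trees `tree 0, …, tree (d - 2)` such that the
nodes of `tree 0` are the `d` variables, the nodes of `tree (k + 1)` are the edges of `tree k`, and
two edges of `tree k` that are joined in `tree (k + 1)` share a node (proximity condition).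
The graphs `tree k` with `k + 1 ≥ d` carry no information and are not used. -/
structure RegularVine (d : ℕ) where
  /-- the sequence of trees -/
  tree : (k : ℕ) → SimpleGraph (VineNode d k)
  support_subset : ∀ k, k + 1 < d → (tree k).support ⊆ vineNodeSet tree k
  isTree : ∀ k, k + 1 < d → ((tree k).induce (vineNodeSet tree k)).IsTree
  proximity : ∀ k, k + 2 < d → ∀ e f : Sym2 (VineNode d k),
    (tree (k + 1)).Adj e f → ∃ v, v ∈ e ∧ v ∈ f

/-! ### Conditional copulas and simplified pair copula constructions -/

/-- A bivariate copula: the distribution function of a probability measure on `ℝ × ℝ` both of whose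
margins are uniform on the unit interval. -/
def IsBivariateCopula (C : ℝ → ℝ → ℝ) : Prop :=
  ∃ P : Measure (ℝ × ℝ), IsProbabilityMeasure P ∧
    P.map Prod.fst = volume.restrict (Icc 0 1) ∧ P.map Prod.snd = volume.restrict (Icc 0 1) ∧
    ∀ u v, C u v = P.real (Iic u ×ˢ Iic v)

/-- For a random vector `X` with law `μ`, one and the same bivariate copula `C` is a copula of the
conditional distribution of `(X i, X j)` given `X k = z k` (`k ∈ D`) for almost all values `z`:
`F_{ij|D}(a, b | z) = C (F_{i|D}(a | z), F_{j|D}(b | z))`. -/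
def HasConstantConditionalCopula {d : ℕ} (μ : Measure (EuclideanSpace ℝ (Fin d)))
    [IsFiniteMeasure μ] (i j : Fin d) (D : Finset (Fin d)) : Prop :=
  ∃ C : ℝ → ℝ → ℝ, IsBivariateCopula C ∧
    ∀ᵐ z ∂(μ.map fun (x : EuclideanSpace ℝ (Fin d)) (k : D) => x k),
      ∀ a b : ℝ,
        (condDistrib (fun x => (x i, x j)) (fun x (k : D) => x k) μ z).real (Iic a ×ˢ Iic b) =
          C ((condDistrib (fun x => x i) (fun x (k : D) => x k) μ z).real (Iic a))
            ((condDistrib (fun x => x j) (fun x (k : D) => x k) μ z).real (Iic b))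

/-- The pair copula construction of `μ` along the regular vine `V` is of the simplified type. An
edge `{a, b}` of one of the trees stands for the conditional copula of `X i` and `X j` given the
`X k` with `k ∈ D`, where `D = vars a ∩ vars b` is the conditioning set, and
`i ∈ vars a \ vars b`, `j ∈ vars b \ vars a` are the two conditioned variables. This copula must
not depend on the value of the variables in `D`. -/
def IsSimplifiedAlong {d : ℕ} (μ : Measure (EuclideanSpace ℝ (Fin d))) [IsFiniteMeasure μ]
    (V : RegularVine d) : Prop :=
  ∀ k, k + 1 < d → ∀ a b : VineNode d k, (V.tree k).Adj a b →
    ∀ i ∈ VineNode.vars k a \ VineNode.vars k b, ∀ j ∈ VineNode.vars k b \ VineNode.vars k a,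
      HasConstantConditionalCopula μ i j (VineNode.vars k a ∩ VineNode.vars k b)

/-- `μ` is a simplified pair copula construction (PCC): it has a decomposition into pair copulas
along some regular vine in which no conditional copula depends on the conditioning values. -/
def IsSimplifiedPCC {d : ℕ} (μ : Measure (EuclideanSpace ℝ (Fin d))) [IsFiniteMeasure μ] : Prop :=
  ∃ V : RegularVine d, IsSimplifiedAlong μ V

/-! ### Scale mixtures of Normals and the multivariate Student-t distribution -/

/-- The scale mixture of Normals with scale matrix `S` and mixing distribution `ν`: the law of
`Z / √W` for independent `W` with law `ν` and `Z` normal with mean zero and covariance `S`. -/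
def normalScaleMixture {d : ℕ} (S : Matrix (Fin d) (Fin d) ℝ) (ν : Measure ℝ) :
    Measure (EuclideanSpace ℝ (Fin d)) :=
  (ν.prod (multivariateGaussian 0 S)).map fun p => (√p.1)⁻¹ • p.2

instance isFiniteMeasure_normalScaleMixture {d : ℕ} (S : Matrix (Fin d) (Fin d) ℝ) (ν : Measure ℝ) [IsFiniteMeasure ν] :
    IsFiniteMeasure (normalScaleMixture S ν) := by
  unfold normalScaleMixture
  infer_instance

/-- A correlation matrix: positive definite with unit diagonal. -/
def IsCorrelationMatrix {d : ℕ} (S : Matrix (Fin d) (Fin d) ℝ) : Prop :=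
  S.PosDef ∧ ∀ i, S i i = 1

/-- The centred `d`-variate Student-t distribution with `n` degrees of freedom and scale matrix `S`,
by its density. -/
def multivariateStudentT {d : ℕ} (n : ℝ) (S : Matrix (Fin d) (Fin d) ℝ) :
    Measure (EuclideanSpace ℝ (Fin d)) :=
  volume.withDensity fun x => ENNReal.ofReal
    (Real.Gamma ((n + d) / 2) / (Real.Gamma (n / 2) * (n * Real.pi) ^ ((d : ℝ) / 2) * √S.det) *
      (1 + (x.ofLp ⬝ᵥ S⁻¹.mulVec x.ofLp) / n) ^ (-((n + d) / 2)))

end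

open Filter Topology
open scoped ENNReal

/-! ### Weighted Laplace transforms -/

/-! Fix an edge with conditioning set D, put α = |D|/2, and let q(z) be half the quadratic form at z
of the inverse of the submatrix of Σ indexed by D. Regressing the Gaussian vector Z on Z_D leaves
residuals independent of Z_D. Hence, given X_D = z, the pair (X_i, X_j) is a shift of e/√W, where e
is a fixed bivariate normal vector independent of W and W has the posterior law proportional to w^α
exp(-q(z) w) ν(dw) (`condDistrib_pair_normalScaleMixture`). Copulas ignore shifts, so the edge is
simplified exactly when, for almost all z, these laws of e/√W have one common copula
(`hasConstantConditionalCopula_normalScaleMixture_iff`).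

Sufficiency: Gamma laws are conjugate. The posterior is Gamma(p + α, b + q(z)); only the rate
depends on z, and a change of rate rescales e/√W, which copulas ignore as well. This works for every
pair and every D, hence along every vine. Integrating w out of the Gaussian density yields the
Student-t density.

Necessity: write L_s(θ) = ∫ w^s exp(-θw) ν(dw). Both coordinates of e/√W have median 0, and after
standardising e the two margins coincide. The mass of the square (0,r]², and its excess over the
mass of (0,r]×(-r,0], are then functions of the marginal mass of (0,r], and these functions depend
on the copula only. As r → 0, the marginal mass behaves like L_{α+1/2}/L_α times r, the mass of the
square like L_{α+1}/L_α times r², and the excess, if the residuals are correlated, like L_{α+2}/L_α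
times r⁴, up to constants free of θ. So L_{α+1} L_α / L_{α+1/2}² does not depend on θ, and in the
correlated case neither does L_{α+2} L_α³ / L_{α+1/2}⁴
(`relations_of_hasConstantConditionalCopula`).

Put a = L_{1/2}, so that a' = -L_{3/2} and a'' = L_{5/2}. If d ≥ 4, the second and third trees of
any regular vine provide edges with |D| = 1 and |D| = 2; differentiating the first relation at α =
1/2 and inserting the one at α = 1 gives a a'' = κ (a')². If d = 3, only |D| = 1 is available; with
all correlations equal to 1/2 the residuals are correlated, and eliminating L_1 from the two
relations at α = 1/2 gives an equation of the same form. As ν is not a point mass, strict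
Cauchy-Schwarz gives κ > 1. Then a/a' is affine and a = C (θ + b)^(-r). By uniqueness of Laplace
transforms w^(1/2) ν(dw) has a density proportional to w^(r-1) exp(-bw), and finiteness of ν forces
r > 1/2 and b > 0 (`eq_gammaMeasure_of_laplaceMoment_relation`). -/

/-- The Laplace transform at `θ` of the measure `w ^ α ν(dw)`. -/
noncomputable def laplaceMoment (ν : Measure ℝ) (α θ : ℝ) : ℝ :=
  ∫ w, w ^ α * Real.exp (-(θ * w)) ∂ν

/-- The inequality `x ≤ exp x` at `x = θ w / α`, raised to the power `α`; the constant is not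
optimal. It makes all weighted Laplace transforms finite for `θ > 0` without any moment assumption
on `ν`. -/
lemma rpow_mul_exp_neg_le {α θ w : ℝ} (hα : 0 ≤ α) (hθ : 0 < θ) (hw : 0 < w) :
    w ^ α * Real.exp (-(θ * w)) ≤ (α / θ) ^ α := by
  rcases hα.eq_or_lt with rfl | hα
  · simp; positivity
  have h1 : (θ * w / α) ^ α ≤ Real.exp (θ * w) := by
    have h2 : θ * w / α ≤ Real.exp (θ * w / α) := by
      linarith [Real.add_one_le_exp (θ * w / α)]
    calc (θ * w / α) ^ α ≤ (Real.exp (θ * w / α)) ^ α :=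
          Real.rpow_le_rpow (by positivity) h2 hα.le
      _ = Real.exp (θ * w) := by
          rw [← Real.exp_mul]; congr 1; field_simp
  have h3 : w ^ α = (α / θ) ^ α * (θ * w / α) ^ α := by
    rw [← Real.mul_rpow (by positivity) (by positivity)]; congr 1; field_simp
  rw [h3, mul_assoc]
  have h4 : (θ * w / α) ^ α * Real.exp (-(θ * w)) ≤ 1 := by
    rw [Real.exp_neg, ← div_eq_mul_inv]
    exact (div_le_one (Real.exp_pos _)).2 h1
  exact mul_le_of_le_one_right (by positivity) h4

lemma integrable_rpow_mul_exp_neg {ν : Measure ℝ} [IsFiniteMeasure ν] (hpos : ∀ᵐ w ∂ν, 0 < w)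
    {α θ : ℝ} (hα : 0 ≤ α) (hθ : 0 < θ) :
    Integrable (fun w => w ^ α * Real.exp (-(θ * w))) ν := by
  refine Integrable.of_bound (by fun_prop) ((α / θ) ^ α) ?_
  filter_upwards [hpos] with w hw
  rw [Real.norm_of_nonneg (by positivity)]
  exact rpow_mul_exp_neg_le hα hθ hw

lemma laplaceMoment_pos {ν : Measure ℝ} [IsProbabilityMeasure ν] (hpos : ∀ᵐ w ∂ν, 0 < w)
    {α θ : ℝ} (hα : 0 ≤ α) (hθ : 0 < θ) : 0 < laplaceMoment ν α θ := by
  have h : ∀ᵐ w ∂ν, 0 < w ^ α * Real.exp (-(θ * w)) := by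
    filter_upwards [hpos] with w hw using by positivity
  refine lt_of_le_of_ne (integral_nonneg_of_ae (h.mono fun w hw => hw.le)) fun h0 => ?_
  have := (integral_eq_zero_iff_of_nonneg_ae (h.mono fun w hw => hw.le)
    (integrable_rpow_mul_exp_neg hpos hα hθ)).1 h0.symm
  have : ∀ᵐ w ∂ν, False := by
    filter_upwards [this, h] with w h1 h2
    simp only [Pi.zero_apply] at h1
    linarith
  simp only [eventually_false_iff_eq_bot, ae_eq_bot] at this
  exact IsProbabilityMeasure.ne_zero ν this

/-- For `x > θ / 2` the differentiated integrand is dominated by its value at `θ / 2`. Each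
derivative raises the exponent by one, which turns relations between moments into differential
equations. -/
lemma hasDerivAt_laplaceMoment {ν : Measure ℝ} [IsFiniteMeasure ν] (hpos : ∀ᵐ w ∂ν, 0 < w)
    {α θ : ℝ} (hα : 0 ≤ α) (hθ : 0 < θ) :
    HasDerivAt (laplaceMoment ν α) (-laplaceMoment ν (α + 1) θ) θ := by
  have key := hasDerivAt_integral_of_dominated_loc_of_deriv_le (μ := ν) (𝕜 := ℝ)
    (F := fun θ w => w ^ α * Real.exp (-(θ * w)))
    (F' := fun θ w => -(w ^ (α + 1) * Real.exp (-(θ * w)))) (x₀ := θ) (s := Ioi (θ / 2))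
    (bound := fun w => w ^ (α + 1) * Real.exp (-(θ / 2 * w)))
    (Ioi_mem_nhds (by linarith)) (Eventually.of_forall fun x => by fun_prop)
    (integrable_rpow_mul_exp_neg hpos hα hθ) (by fun_prop) ?_
    (integrable_rpow_mul_exp_neg hpos (by linarith) (by linarith)) ?_
  · have := key.2
    rw [integral_neg] at this
    exact this
  · filter_upwards [hpos] with w hw x hx
    rw [norm_neg, Real.norm_of_nonneg (by positivity)]
    have hx : θ / 2 < x := hx
    gcongr
  · filter_upwards [hpos] with w hw x hx
    have h1 : HasDerivAt (fun x => w ^ α * Real.exp (-(x * w)))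
        (w ^ α * (Real.exp (-(x * w)) * -(1 * w))) x :=
      ((((hasDerivAt_id x).mul_const w).neg).exp).const_mul _
    rw [show -(w ^ (α + 1) * Real.exp (-(x * w))) =
      w ^ α * (Real.exp (-(x * w)) * -(1 * w)) by rw [Real.rpow_add_one hw.ne']; ring]
    exact h1

lemma continuousAt_laplaceMoment {ν : Measure ℝ} [IsFiniteMeasure ν] (hpos : ∀ᵐ w ∂ν, 0 < w)
    {α θ : ℝ} (hα : 0 ≤ α) (hθ : 0 < θ) : ContinuousAt (laplaceMoment ν α) θ :=
  (hasDerivAt_laplaceMoment hpos hα hθ).continuousAt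

/-- Strictness of the Cauchy-Schwarz inequality for a mixing distribution that is not a point
mass. -/
lemma laplaceMoment_ratio_gt_one {ν : Measure ℝ} [IsProbabilityMeasure ν]
    (hpos : ∀ᵐ w ∂ν, 0 < w) (hnd : ∀ c : ℝ, ν ≠ Measure.dirac c) {κ : ℝ}
    (h : laplaceMoment ν (1 / 2) 1 * laplaceMoment ν (5 / 2) 1 =
      κ * laplaceMoment ν (3 / 2) 1 ^ 2) : 1 < κ := by
  by_contra! hκ
  set a := laplaceMoment ν (1 / 2) 1
  set b := laplaceMoment ν (3 / 2) 1
  have ha : 0 < a := laplaceMoment_pos hpos (by norm_num) one_pos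
  have hb : 0 < b := laplaceMoment_pos hpos (by norm_num) one_pos
  -- The mean of `w` under the normalised weight `w ^ (1/2) exp (-w) ν(dw)`. If `κ ≤ 1`, the
  -- variance about this mean is at most zero, and `ν` sits at `c`.
  set c := b / a
  have i1 := integrable_rpow_mul_exp_neg hpos (α := 1 / 2) (by norm_num) one_pos
  have i2 := integrable_rpow_mul_exp_neg hpos (α := 3 / 2) (by norm_num) one_pos
  have i3 := integrable_rpow_mul_exp_neg hpos (α := 5 / 2) (by norm_num) one_pos
  have heq : (fun w => (w - c) ^ 2 * (w ^ (1 / 2 : ℝ) * Real.exp (-(1 * w)))) =ᵐ[ν]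
      fun w => w ^ (5 / 2 : ℝ) * Real.exp (-(1 * w)) -
        2 * c * (w ^ (3 / 2 : ℝ) * Real.exp (-(1 * w))) +
        c ^ 2 * (w ^ (1 / 2 : ℝ) * Real.exp (-(1 * w))) := by
    filter_upwards [hpos] with w hw
    have e1 : w ^ (3 / 2 : ℝ) = w ^ (1 / 2 : ℝ) * w := by
      rw [← Real.rpow_add_one hw.ne']; norm_num
    have e2 : w ^ (5 / 2 : ℝ) = w ^ (1 / 2 : ℝ) * w * w := by
      rw [← e1, ← Real.rpow_add_one hw.ne']; norm_num
    rw [e1, e2]; ring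
  have hint : ∫ w, (w - c) ^ 2 * (w ^ (1 / 2 : ℝ) * Real.exp (-(1 * w))) ∂ν =
      laplaceMoment ν (5 / 2) 1 - 2 * c * b + c ^ 2 * a := by
    have i4 : Integrable (fun w => w ^ (5 / 2 : ℝ) * Real.exp (-(1 * w)) -
        2 * c * (w ^ (3 / 2 : ℝ) * Real.exp (-(1 * w)))) ν := i3.sub (i2.const_mul _)
    rw [integral_congr_ae heq, integral_add i4 (i1.const_mul _),
      integral_sub i3 (i2.const_mul _), integral_const_mul, integral_const_mul]
    rfl
  have hle : ∫ w, (w - c) ^ 2 * (w ^ (1 / 2 : ℝ) * Real.exp (-(1 * w))) ∂ν ≤ 0 := by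
    rw [hint]
    have e : laplaceMoment ν (5 / 2) 1 - 2 * c * b + c ^ 2 * a = (κ - 1) * b ^ 2 / a := by
      simp only [c]; field_simp; linarith
    rw [e]
    exact div_nonpos_of_nonpos_of_nonneg
      (mul_nonpos_of_nonpos_of_nonneg (by linarith) (sq_nonneg b)) ha.le
  have hnn : 0 ≤ᵐ[ν] fun w => (w - c) ^ 2 * (w ^ (1 / 2 : ℝ) * Real.exp (-(1 * w))) := by
    filter_upwards [hpos] with w hw
    simp only [Pi.zero_apply]; positivity
  have h0 := (integral_eq_zero_iff_of_nonneg_ae hnn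
    (((i3.sub (i2.const_mul _)).add (i1.const_mul _)).congr heq.symm)).1
    (le_antisymm hle (integral_nonneg_of_ae hnn))
  have hc : ∀ᵐ w ∂ν, w = c := by
    filter_upwards [h0, hpos] with w h1 hw
    simp only [Pi.zero_apply, mul_eq_zero] at h1
    rcases h1 with h1 | h1 | h1
    · nlinarith
    · exact absurd h1 (by positivity)
    · exact absurd h1 (Real.exp_pos _).ne'
  refine hnd c ?_
  have : ν.map id = ν.map (fun _ => c) := Measure.map_congr hc
  rw [Measure.map_id, Measure.map_const] at this
  simpa using this

lemma exists_const_of_hasDerivAt_zero_Ioi {f : ℝ → ℝ}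
    (hf : ∀ x, 0 < x → HasDerivAt f 0 x) : ∃ c, ∀ x, 0 < x → f x = c := by
  obtain ⟨c, hc⟩ := isOpen_Ioi.exists_is_const_of_deriv_eq_zero (s := Ioi (0 : ℝ)) (f := f)
    isPreconnected_Ioi (fun x hx => (hf x hx).differentiableAt.differentiableWithinAt)
    (fun x hx => (hf x hx).deriv)
  exact ⟨c, hc⟩

/-- The solutions of the differential equation `a a'' = κ (a')²` that are Laplace transforms. -/
lemma exists_laplaceMoment_half_eq_rpow {ν : Measure ℝ} [IsProbabilityMeasure ν]
    (hpos : ∀ᵐ w ∂ν, 0 < w) {κ : ℝ} (hκ : 1 < κ)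
    (h : ∀ θ, 0 < θ → laplaceMoment ν (1 / 2) θ * laplaceMoment ν (5 / 2) θ =
      κ * laplaceMoment ν (3 / 2) θ ^ 2) :
    ∃ C b r : ℝ, 0 < C ∧ 0 ≤ b ∧ 0 < r ∧
      ∀ θ, 0 < θ → laplaceMoment ν (1 / 2) θ = C * (1 / (θ + b)) ^ r := by
  set a := laplaceMoment ν (1 / 2) with ha_def
  set A := laplaceMoment ν (3 / 2) with hA_def
  have ha : ∀ θ, 0 < θ → 0 < a θ := fun θ hθ => laplaceMoment_pos hpos (by norm_num) hθ
  have hA : ∀ θ, 0 < θ → 0 < A θ := fun θ hθ => laplaceMoment_pos hpos (by norm_num) hθ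
  have da : ∀ θ, 0 < θ → HasDerivAt a (-A θ) θ := fun θ hθ => by
    have := hasDerivAt_laplaceMoment hpos (α := 1 / 2) (by norm_num) hθ
    norm_num at this
    convert this using 1
  have dA : ∀ θ, 0 < θ → HasDerivAt A (-laplaceMoment ν (5 / 2) θ) θ := fun θ hθ => by
    have := hasDerivAt_laplaceMoment hpos (α := 3 / 2) (by norm_num) hθ
    norm_num at this
    convert this using 1
  -- The equation says that `a / A` has derivative `κ - 1`, so it is affine with intercept `β`.
  obtain ⟨β, hβ⟩ := exists_const_of_hasDerivAt_zero_Ioi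
    (f := fun θ => a θ / A θ - (κ - 1) * θ) (fun θ hθ => by
      have h1 := ((da θ hθ).div (dA θ hθ) (hA θ hθ).ne').sub
        ((hasDerivAt_id θ).const_mul (κ - 1))
      have h2 := h θ hθ
      have h3 := (hA θ hθ).ne'
      have e : (-A θ * A θ - a θ * -laplaceMoment ν (5 / 2) θ) / A θ ^ 2 - (κ - 1) * 1 = 0 := by
        field_simp
        linarith
      rw [e] at h1
      exact h1)
  set r := 1 / (κ - 1)
  have hr : 0 < r := by have : 0 < κ - 1 := by linarith
                        positivity
  -- This is `a' / a = -r / (θ + r β)`, cleared of denominators.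
  have hu : ∀ θ, 0 < θ → a θ * r = A θ * (θ + r * β) := fun θ hθ => by
    have h1 := hβ θ hθ
    have h3 := (hA θ hθ).ne'
    have h4 : κ - 1 ≠ 0 := by linarith
    simp only [r] at *
    field_simp at h1 ⊢
    linarith
  have hb' : ∀ θ, 0 < θ → 0 < θ + r * β := fun θ hθ => by
    have h1 : 0 < A θ * (θ + r * β) := by
      rw [← hu θ hθ]; exact mul_pos (ha θ hθ) hr
    exact (pos_iff_pos_of_mul_pos h1).1 (hA θ hθ)
  -- Otherwise `θ = -(r β)` would be a positive point at which `θ + r β` vanishes.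
  have hb : 0 ≤ r * β := by
    by_contra! hneg
    have := hb' (-(r * β)) (by linarith)
    linarith
  obtain ⟨C, hC⟩ := exists_const_of_hasDerivAt_zero_Ioi
    (f := fun θ => a θ * (θ + r * β) ^ r) (fun θ hθ => by
      have h1 := (da θ hθ).mul
        (((hasDerivAt_id θ).add_const (r * β)).rpow_const (p := r) (Or.inl (hb' θ hθ).ne'))
      have e : -A θ * (id θ + r * β) ^ r + a θ * (1 * r * (id θ + r * β) ^ (r - 1)) = 0 := by
        have h2 := hb' θ hθ
        have h3 := hu θ hθ
        rw [Real.rpow_sub_one (by simpa using h2.ne')]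
        simp only [id]
        field_simp
        linear_combination (θ + r * β) ^ r * h3
      rw [e] at h1
      exact h1)
  refine ⟨C, r * β, r, ?_, hb, hr, fun θ hθ => ?_⟩
  · rw [← hC 1 one_pos]
    exact mul_pos (ha 1 one_pos) (Real.rpow_pos_of_pos (hb' 1 one_pos) _)
  · rw [← hC θ hθ, Real.div_rpow zero_le_one (hb' θ hθ).le, Real.one_rpow]
    have := (Real.rpow_pos_of_pos (hb' θ hθ) r).ne'
    field_simp

/-- Two finite measures whose moment generating functions exist and agree on a half-line around
the origin are equal. -/
lemma measure_ext_of_mgf_eqOn_Iio {μ₁ μ₂ : Measure ℝ} [IsFiniteMeasure μ₁] [IsFiniteMeasure μ₂]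
    {δ : ℝ} (hδ : 0 < δ)
    (h₁ : ∀ t < δ, Integrable (fun x => Real.exp (t * x)) μ₁)
    (h₂ : ∀ t < δ, Integrable (fun x => Real.exp (t * x)) μ₂)
    (h : ∀ t < δ, ∫ x, Real.exp (t * x) ∂μ₁ = ∫ x, Real.exp (t * x) ∂μ₂) : μ₁ = μ₂ := by
  have hs : IsOpen {z : ℂ | z.re < δ} := isOpen_lt Complex.continuous_re continuous_const
  have an : ∀ (μ : Measure ℝ), (∀ t < δ, Integrable (fun x => Real.exp (t * x)) μ) →
      AnalyticOnNhd ℂ (complexMGF id μ) {z : ℂ | z.re < δ} := fun μ hμ => by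
    refine analyticOnNhd_complexMGF.mono fun z hz => ?_
    have hz : z.re < δ := hz
    refine mem_interior.2 ⟨Iio δ, fun t ht => ?_, isOpen_Iio, hz⟩
    exact hμ t ht
  -- Real points accumulating at 0 suffice for the identity theorem, and the half-plane contains the
  -- imaginary axis, where the transforms are the characteristic functions.
  have heq : EqOn (complexMGF id μ₁) (complexMGF id μ₂) {z : ℂ | z.re < δ} := by
    refine AnalyticOnNhd.eqOn_of_preconnected_of_frequently_eq (an μ₁ h₁) (an μ₂ h₂)
      ((convex_halfSpace_re_lt δ).isPreconnected) (z₀ := ((0 : ℝ) : ℂ)) (by simpa using hδ) ?_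
    have h_real : ∃ᶠ (x : ℝ) in 𝓝[≠] 0, complexMGF id μ₁ x = complexMGF id μ₂ x := by
      have : ∀ᶠ (x : ℝ) in 𝓝[≠] 0, complexMGF id μ₁ x = complexMGF id μ₂ x := by
        filter_upwards [nhdsWithin_le_nhds (Iio_mem_nhds hδ)] with t ht
        rw [complexMGF_ofReal, complexMGF_ofReal]
        exact congrArg _ (h t ht)
      exact this.frequently
    rw [frequently_iff_seq_forall] at h_real ⊢
    obtain ⟨xs, hx_tendsto, hx_eq⟩ := h_real
    refine ⟨fun n ↦ xs n, ?_, fun n ↦ by simp [hx_eq]⟩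
    rw [tendsto_nhdsWithin_iff] at hx_tendsto ⊢
    constructor
    · exact (Complex.continuous_ofReal.tendsto 0).comp hx_tendsto.1
    · simpa using hx_tendsto.2
  refine Measure.ext_of_charFun ?_
  ext t
  rw [← complexMGF_id_mul_I, ← complexMGF_id_mul_I]
  exact heq (by simpa using hδ)

/-! ### Gamma distributions -/

lemma lintegral_Ioi_rpow_mul_exp_neg {s b : ℝ} (hs : 0 < s) (hb : 0 < b) :
    ∫⁻ w in Ioi 0, ENNReal.ofReal (w ^ (s - 1) * Real.exp (-(b * w))) =
      ENNReal.ofReal ((1 / b) ^ s * Real.Gamma s) := by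
  have h := Real.integral_rpow_mul_exp_neg_mul_Ioi hs hb
  rw [← h, ofReal_integral_eq_lintegral_ofReal]
  · refine Integrable.of_integral_ne_zero ?_
    rw [h]
    have := Real.Gamma_pos_of_pos hs
    positivity
  · refine (ae_restrict_iff' measurableSet_Ioi).2 (ae_of_all _ fun w hw => ?_)
    have hw : 0 < w := hw
    simp only [Pi.zero_apply]; positivity

lemma gammaMeasure_eq_withDensity_Ioi (a r : ℝ) :
    gammaMeasure a r = (volume.restrict (Ioi 0)).withDensity fun w =>
      ENNReal.ofReal (r ^ a / Real.Gamma a * (w ^ (a - 1) * Real.exp (-(r * w)))) := by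
  have h : gammaPDF a r =ᵐ[volume] (Ioi 0).indicator fun w =>
      ENNReal.ofReal (r ^ a / Real.Gamma a * (w ^ (a - 1) * Real.exp (-(r * w)))) := by
    have h0 : ∀ᵐ w : ℝ, w ≠ 0 := by simp [ae_iff]
    filter_upwards [h0] with w hw
    rcases lt_or_gt_of_ne hw with hw | hw
    · rw [gammaPDF_of_neg hw, indicator_of_notMem (by simpa using hw.le)]
    · rw [gammaPDF_of_nonneg hw.le, indicator_of_mem (show w ∈ Ioi 0 from hw), mul_assoc]
  rw [gammaMeasure, withDensity_congr_ae h, withDensity_indicator measurableSet_Ioi]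

/-- The parameters of an integrable unnormalised gamma density are positive. -/
lemma gamma_parameters_pos {p b : ℝ} (hb : 0 ≤ b)
    (h : ∫⁻ w in Ioi 0, ENNReal.ofReal (w ^ (p - 1) * Real.exp (-(b * w))) ≠ ⊤) :
    0 < p ∧ 0 < b := by
  have hi : IntegrableOn (fun w : ℝ => w ^ (p - 1) * Real.exp (-(b * w))) (Ioi 0) := by
    refine ⟨by fun_prop, ?_⟩
    rw [hasFiniteIntegral_iff_ofReal]
    · exact lt_top_iff_ne_top.2 h
    · refine (ae_restrict_iff' measurableSet_Ioi).2 (ae_of_all _ fun w hw => ?_)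
      have hw : 0 < w := hw
      simp only [Pi.zero_apply]; positivity
  -- On `(0, 1)` the exponential factor is at least `exp (-b)`, so integrability near zero is that
  -- of the power alone.
  have hp : 0 < p := by
    have h1 : IntegrableOn (fun w : ℝ => w ^ (p - 1)) (Ioo 0 1) := by
      refine Integrable.mono' (g := fun w : ℝ => Real.exp b * (w ^ (p - 1) * Real.exp (-(b * w))))
        ((hi.mono_set Ioo_subset_Ioi_self).const_mul _) (by fun_prop) ?_
      refine (ae_restrict_iff' measurableSet_Ioo).2 (ae_of_all _ fun w hw => ?_)
      have hw0 : 0 < w := hw.1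
      rw [Real.norm_of_nonneg (by positivity)]
      have : 1 ≤ Real.exp b * Real.exp (-(b * w)) := by
        rw [← Real.exp_add]
        refine Real.one_le_exp ?_
        nlinarith [hw.2]
      have h2 : 0 < w ^ (p - 1) := by positivity
      nlinarith
    have := (intervalIntegral.integrableOn_Ioo_rpow_iff one_pos).1 h1
    linarith
  refine ⟨hp, lt_of_le_of_ne hb fun h0 => ?_⟩
  -- With `b = 0` the pure power would be integrable at infinity, which requires `p < 0`.
  subst h0
  have h1 : IntegrableOn (fun w : ℝ => w ^ (p - 1)) (Ioi 1) := by
    refine (hi.mono_set (Ioi_subset_Ioi zero_le_one)).congr_fun (fun w _ => ?_) measurableSet_Ioi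
    simp
  have := (integrableOn_Ioi_rpow_iff one_pos).1 h1
  linarith

/-- A mixing distribution whose weighted Laplace transform is a power function is a gamma
distribution. -/
lemma eq_gammaMeasure_of_laplaceMoment_half {ν : Measure ℝ} [IsProbabilityMeasure ν]
    (hpos : ∀ᵐ w ∂ν, 0 < w) {C b r : ℝ} (hC : 0 < C) (hb : 0 ≤ b) (hr : 0 < r)
    (h : ∀ θ, 0 < θ → laplaceMoment ν (1 / 2) θ = C * (1 / (θ + b)) ^ r) :
    ∃ p b : ℝ, 0 < p ∧ 0 < b ∧ ν = gammaMeasure p b := by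
  have hΓ := Real.Gamma_pos_of_pos hr
  -- With this constant both `μ₁` and `μ₂` below have the moment generating function `Γ(r) (1 + b -
  -- t) ^ (-r)`. The factor `exp (-w)` in both densities moves `θ > 0` to `t < 1`, a half-line with
  -- 0 in its interior.
  set c := Real.Gamma r / C with hc_def
  have hc : 0 < c := div_pos hΓ hC
  set f₁ : ℝ → ℝ := fun w => c * (w ^ (1 / 2 : ℝ) * Real.exp (-(1 * w)))
  set f₂ : ℝ → ℝ := fun w => w ^ (r - 1) * Real.exp (-((1 + b) * w))
  have hf₁ : ∀ᵐ w ∂ν, 0 ≤ f₁ w := by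
    filter_upwards [hpos] with w hw
    simp only [f₁]; positivity
  have hf₂ : ∀ᵐ w ∂(volume.restrict (Ioi (0 : ℝ))), 0 ≤ f₂ w := by
    refine (ae_restrict_iff' measurableSet_Ioi).2 (ae_of_all _ fun w hw => ?_)
    have hw : 0 < w := hw
    simp only [f₂]; positivity
  have i₁ : Integrable f₁ ν := (integrable_rpow_mul_exp_neg hpos (by norm_num) one_pos).const_mul c
  have g₂ : ∀ s : ℝ, 0 < s → IntegrableOn (fun w => w ^ (r - 1) * Real.exp (-(s * w))) (Ioi 0) :=
    fun s hs => by
      refine Integrable.of_integral_ne_zero ?_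
      rw [Real.integral_rpow_mul_exp_neg_mul_Ioi hr hs]
      positivity
  have i₂ : IntegrableOn f₂ (Ioi 0) := g₂ (1 + b) (by linarith)
  have m₁ : Measurable f₁ := by fun_prop
  have m₂ : Measurable f₂ := by fun_prop
  set μ₁ := ν.withDensity fun w => ENNReal.ofReal (f₁ w)
  set μ₂ := (volume.restrict (Ioi 0)).withDensity fun w => ENNReal.ofReal (f₂ w)
  have : IsFiniteMeasure μ₁ := isFiniteMeasure_withDensity_ofReal i₁.2
  have : IsFiniteMeasure μ₂ := isFiniteMeasure_withDensity_ofReal i₂.2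
  have e₁ : ∀ t w : ℝ, f₁ w * Real.exp (t * w) =
      c * (w ^ (1 / 2 : ℝ) * Real.exp (-((1 - t) * w))) := fun t w => by
    simp only [f₁]
    rw [mul_assoc, mul_assoc, ← Real.exp_add]; ring_nf
  have e₂ : ∀ t w : ℝ, f₂ w * Real.exp (t * w) =
      w ^ (r - 1) * Real.exp (-((1 + b - t) * w)) := fun t w => by
    simp only [f₂]
    rw [mul_assoc, ← Real.exp_add]; ring_nf
  have hμ : μ₁ = μ₂ := by
    refine measure_ext_of_mgf_eqOn_Iio one_pos (fun t ht => ?_) (fun t ht => ?_) fun t ht => ?_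
    · rw [integrable_withDensity_iff_integrable_smul₀' (by fun_prop) (by simp)]
      refine ((integrable_rpow_mul_exp_neg hpos (α := 1 / 2) (θ := 1 - t) (by norm_num)
        (by linarith)).const_mul c).congr ?_
      filter_upwards [hf₁] with w hw
      rw [ENNReal.toReal_ofReal hw, smul_eq_mul, e₁]
    · rw [integrable_withDensity_iff_integrable_smul₀' (by fun_prop) (by simp)]
      refine (g₂ (1 + b - t) (by linarith)).congr ?_
      filter_upwards [hf₂] with w hw
      rw [ENNReal.toReal_ofReal hw, smul_eq_mul, e₂]
    · rw [integral_withDensity_eq_integral_toReal_smul₀ (by fun_prop) (by simp),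
        integral_withDensity_eq_integral_toReal_smul₀ (by fun_prop) (by simp)]
      have l : ∫ w, (ENNReal.ofReal (f₁ w)).toReal • Real.exp (t * w) ∂ν =
          c * laplaceMoment ν (1 / 2) (1 - t) := by
        rw [laplaceMoment, ← integral_const_mul]
        refine integral_congr_ae ?_
        filter_upwards [hf₁] with w hw
        rw [ENNReal.toReal_ofReal hw, smul_eq_mul, e₁]
      have l' : ∫ w in Ioi 0, (ENNReal.ofReal (f₂ w)).toReal • Real.exp (t * w) =
          (1 / (1 + b - t)) ^ r * Real.Gamma r := by
        rw [← Real.integral_rpow_mul_exp_neg_mul_Ioi hr (show 0 < 1 + b - t by linarith)]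
        refine integral_congr_ae ?_
        filter_upwards [hf₂] with w hw
        rw [ENNReal.toReal_ofReal hw, smul_eq_mul, e₂]
      rw [l, l', h _ (by linarith), hc_def, show 1 - t + b = 1 + b - t by ring]
      field_simp
  -- Dividing `μ₁ = μ₂` by the density `f₁` takes 1/2 off the exponent and cancels `exp (-w)`, which
  -- leaves the rate `b`.
  have hν : ν = (volume.restrict (Ioi 0)).withDensity fun w =>
      ENNReal.ofReal (c⁻¹ * (w ^ ((r - 1 / 2) - 1) * Real.exp (-(b * w)))) := by
    have h1 : μ₁.withDensity (fun w => ENNReal.ofReal (f₁ w)⁻¹) = ν := by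
      rw [← withDensity_mul _ (by fun_prop) (by fun_prop)]
      conv_rhs => rw [← withDensity_one (μ := ν)]
      refine withDensity_congr_ae ?_
      filter_upwards [hpos] with w hw
      have : 0 < f₁ w := by simp only [f₁]; positivity
      rw [Pi.mul_apply, ← ENNReal.ofReal_mul this.le, mul_inv_cancel₀ this.ne', ENNReal.ofReal_one,
        Pi.one_apply]
    rw [← h1, hμ, ← withDensity_mul _ (by fun_prop) (by fun_prop)]
    refine withDensity_congr_ae ((ae_restrict_iff' measurableSet_Ioi).2 (ae_of_all _ fun w hw => ?_))
    have hw : 0 < w := hw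
    have h2 : 0 ≤ f₂ w := by simp only [f₂]; positivity
    simp only [Pi.mul_apply]
    rw [← ENNReal.ofReal_mul h2]
    congr 1
    simp only [f₁, f₂]
    rw [show r - 1 / 2 - 1 = (r - 1) - 1 / 2 by ring, Real.rpow_sub hw (r - 1) (1 / 2),
      show -(b * w) = -((1 + b) * w) - (-(1 * w)) by ring, Real.exp_sub]
    field_simp
  -- Total mass one is used twice: finiteness forces both parameters to be positive, and the value
  -- identifies `c⁻¹` as the normalising constant of the gamma density.
  have hone : ENNReal.ofReal c⁻¹ * ∫⁻ w in Ioi 0,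
      ENNReal.ofReal (w ^ ((r - 1 / 2) - 1) * Real.exp (-(b * w))) = 1 := by
    rw [← lintegral_const_mul _ (by fun_prop), ← measure_univ (μ := ν)]
    conv_rhs => rw [hν]
    rw [withDensity_apply _ MeasurableSet.univ, Measure.restrict_univ]
    simp_rw [ENNReal.ofReal_mul (inv_nonneg.2 hc.le)]
  have hc' : ENNReal.ofReal c⁻¹ ≠ 0 := by simpa using hc
  obtain ⟨hp, hb'⟩ := gamma_parameters_pos (p := r - 1 / 2) hb (fun htop => by
    rw [htop, ENNReal.mul_top hc'] at hone
    simp at hone)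
  refine ⟨r - 1 / 2, b, hp, hb', ?_⟩
  have hΓ' := Real.Gamma_pos_of_pos hp
  rw [lintegral_Ioi_rpow_mul_exp_neg hp hb', ← ENNReal.ofReal_mul (inv_nonneg.2 hc.le),
    ENNReal.ofReal_eq_one, Real.div_rpow zero_le_one hb, Real.one_rpow] at hone
  rw [gammaMeasure_eq_withDensity_Ioi]
  have hcc : c⁻¹ = b ^ (r - 1 / 2) / Real.Gamma (r - 1 / 2) := by
    have : 0 < b ^ (r - 1 / 2) := by positivity
    generalize r - 1 / 2 = p at *
    field_simp at hone ⊢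
    linarith
  rw [← hcc]
  exact hν

/-- Characterisation of the gamma distributions by a differential equation for the Laplace
transform. -/
theorem eq_gammaMeasure_of_laplaceMoment_relation {ν : Measure ℝ} [IsProbabilityMeasure ν]
    (hpos : ∀ᵐ w ∂ν, 0 < w) (hnd : ∀ c : ℝ, ν ≠ Measure.dirac c) {κ : ℝ}
    (h : ∀ θ, 0 < θ → laplaceMoment ν (1 / 2) θ * laplaceMoment ν (5 / 2) θ =
      κ * laplaceMoment ν (3 / 2) θ ^ 2) :
    ∃ p b : ℝ, 0 < p ∧ 0 < b ∧ ν = gammaMeasure p b := by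
  obtain ⟨C, b, r, hC, hb, hr, hL⟩ := exists_laplaceMoment_half_eq_rpow hpos
    (laplaceMoment_ratio_gt_one hpos hnd (h 1 one_pos)) h
  exact eq_gammaMeasure_of_laplaceMoment_half hpos hC hb hr hL

/-- The relation between the Laplace transforms that expresses that the copula density at the
median is constant. -/
def CentralRelation (ν : Measure ℝ) (α : ℝ) : Prop :=
  ∃ K : ℝ, ∀ θ, 0 < θ →
    laplaceMoment ν (α + 1) θ * laplaceMoment ν α θ = K * laplaceMoment ν (α + 1 / 2) θ ^ 2

/-- The relation between the Laplace transforms that expresses that the mixed second derivative of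
the copula density at the median is constant. -/
def MixedRelation (ν : Measure ℝ) (α : ℝ) : Prop :=
  ∃ K : ℝ, ∀ θ, 0 < θ →
    laplaceMoment ν (α + 2) θ * laplaceMoment ν α θ ^ 3 = K * laplaceMoment ν (α + 1 / 2) θ ^ 4

/-- The moment of order 1 enters one relation squared and the other to the fourth power, so it can
be eliminated. What remains is `a a'' = κ (a')²` for the moment `a` of order 1/2, with `κ = K' /
K²`. -/
theorem exists_gammaMeasure_of_central_mixed {ν : Measure ℝ} [IsProbabilityMeasure ν]
    (hpos : ∀ᵐ w ∂ν, 0 < w) (hnd : ∀ c : ℝ, ν ≠ Measure.dirac c)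
    (h₁ : CentralRelation ν (1 / 2)) (h₂ : MixedRelation ν (1 / 2)) :
    ∃ p b : ℝ, 0 < p ∧ 0 < b ∧ ν = gammaMeasure p b := by
  obtain ⟨K, hK⟩ := h₁
  obtain ⟨K', hK'⟩ := h₂
  norm_num at hK hK'
  have hK0 : K ≠ 0 := fun h0 => by
    have h1 := hK 1 one_pos
    have := laplaceMoment_pos hpos (α := 1 / 2) (by norm_num) one_pos
    have := laplaceMoment_pos hpos (α := 3 / 2) (by norm_num) one_pos
    rw [h0, zero_mul] at h1
    have : 0 < laplaceMoment ν (3 / 2) 1 * laplaceMoment ν (1 / 2) 1 := by positivity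
    linarith
  refine eq_gammaMeasure_of_laplaceMoment_relation hpos hnd (κ := K' / K ^ 2) fun θ hθ => ?_
  have ha := laplaceMoment_pos hpos (α := 1 / 2) (by norm_num) hθ
  have h1 := hK θ hθ
  have h2 := hK' θ hθ
  set a := laplaceMoment ν (1 / 2) θ
  set A := laplaceMoment ν (3 / 2) θ
  field_simp
  -- With `x = A a` and `y = K L²`, `L` being the moment of order 1, the factorisation `x² - y² = (x
  -- - y)(x + y)` gives the coefficient of `h1`.
  have : a ^ 2 * (a * laplaceMoment ν (5 / 2) θ * K ^ 2) = a ^ 2 * (K' * A ^ 2) := by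
    linear_combination K ^ 2 * h2 - K' * (A * a + K * laplaceMoment ν 1 θ ^ 2) * h1
  exact mul_left_cancel₀ (pow_ne_zero 2 ha.ne') (by linarith)

/-- Let `L_s` be the moment of order `s` and `a = L_{1/2}`. Differentiating the relation at 1/2
gives `a a'' + (a')² = 2 K L_1 L_2`, and the relation at 1 replaces `L_1 L_2` by `K' (a')²`; hence
`κ = 2 K K' - 1`. -/
theorem exists_gammaMeasure_of_central_central {ν : Measure ℝ} [IsProbabilityMeasure ν]
    (hpos : ∀ᵐ w ∂ν, 0 < w) (hnd : ∀ c : ℝ, ν ≠ Measure.dirac c)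
    (h₁ : CentralRelation ν (1 / 2)) (h₂ : CentralRelation ν 1) :
    ∃ p b : ℝ, 0 < p ∧ 0 < b ∧ ν = gammaMeasure p b := by
  obtain ⟨K, hK⟩ := h₁
  obtain ⟨K', hK'⟩ := h₂
  norm_num at hK hK'
  refine eq_gammaMeasure_of_laplaceMoment_relation hpos hnd (κ := 2 * K * K' - 1) fun θ hθ => ?_
  have d0 := hasDerivAt_laplaceMoment hpos (α := 1 / 2) (by norm_num) hθ
  have d1 := hasDerivAt_laplaceMoment hpos (α := 1) (by norm_num) hθ
  have d2 := hasDerivAt_laplaceMoment hpos (α := 3 / 2) (by norm_num) hθ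
  norm_num at d0 d1 d2
  have hl := d2.mul d0
  have hr := (d1.pow 2).const_mul K
  have heq : (laplaceMoment ν (3 / 2) * laplaceMoment ν (1 / 2)) =ᶠ[𝓝 θ]
      fun x => K * (laplaceMoment ν 1 ^ 2) x := by
    filter_upwards [Ioi_mem_nhds hθ] with x hx using hK x hx
  have := hl.unique (hr.congr_of_eventuallyEq heq)
  have h2 := hK' θ hθ
  norm_num at this
  linear_combination -this + 2 * K * h2

/-! ### Densities and linear images of Gaussian measures -/

section GaussianDensity

open scoped MatrixOrder

lemma pi_gaussianReal_eq_withDensity {ι : Type*} [Fintype ι] :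
    Measure.pi (fun _ : ι => gaussianReal 0 1) =
      volume.withDensity fun x : ι → ℝ => ENNReal.ofReal (∏ i, gaussianPDFReal 0 1 (x i)) := by
  refine (Measure.pi_eq fun s hs => ?_)
  rw [withDensity_apply _ (MeasurableSet.univ_pi hs),
    ← lintegral_indicator (MeasurableSet.univ_pi hs)]
  have h1 : ∀ x : ι → ℝ, (univ.pi s).indicator
      (fun x => ENNReal.ofReal (∏ i, gaussianPDFReal 0 1 (x i))) x =
      ENNReal.ofReal (∏ i, (s i).indicator (gaussianPDFReal 0 1) (x i)) := fun x => by
    by_cases hx : x ∈ univ.pi s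
    · rw [indicator_of_mem hx]
      congr 1
      refine Finset.prod_congr rfl fun i _ => ?_
      rw [indicator_of_mem (hx i (mem_univ i))]
    · rw [indicator_of_notMem hx]
      simp only [Set.mem_pi, mem_univ, true_implies, not_forall] at hx
      obtain ⟨i, hi⟩ := hx
      rw [Finset.prod_eq_zero (Finset.mem_univ i) (indicator_of_notMem hi _), ENNReal.ofReal_zero]
  have hi : ∀ i, Integrable ((s i).indicator (gaussianPDFReal 0 1)) := fun i =>
    (integrable_gaussianPDFReal 0 1).indicator (hs i)
  have hn : ∀ i x, 0 ≤ (s i).indicator (gaussianPDFReal 0 1) x := fun i x =>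
    indicator_nonneg (fun _ _ => gaussianPDFReal_nonneg 0 1 _) x
  simp_rw [h1]
  rw [volume_pi, ← ofReal_integral_eq_lintegral_ofReal (Integrable.fintype_prod hi)
    (ae_of_all _ fun x => Finset.prod_nonneg fun i _ => hn i _),
    integral_fintype_prod_eq_prod, ENNReal.ofReal_prod_of_nonneg
    (fun i _ => integral_nonneg (hn i))]
  refine Finset.prod_congr rfl fun i _ => ?_
  rw [integral_indicator (hs i), gaussianReal_apply_eq_integral 0 one_ne_zero]

lemma stdGaussian_eq_withDensity {ι : Type*} [Fintype ι] :
    stdGaussian (EuclideanSpace ℝ ι) = volume.withDensity fun x =>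
      ENNReal.ofReal ((√((2 * Real.pi) ^ Fintype.card ι))⁻¹ *
        Real.exp (-(x.ofLp ⬝ᵥ x.ofLp) / 2)) := by
  rw [← map_pi_eq_stdGaussian, pi_gaussianReal_eq_withDensity]
  ext s hs
  have hm : Measurable (WithLp.toLp 2 : (ι → ℝ) → EuclideanSpace ℝ ι) := by fun_prop
  rw [Measure.map_apply hm hs, withDensity_apply _ (hm hs), withDensity_apply _ hs,
    ← (PiLp.volume_preserving_toLp ι).setLIntegral_comp_preimage hs (by fun_prop)]
  refine lintegral_congr fun x => ?_
  congr 1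
  simp only [gaussianPDFReal, Finset.prod_mul_distrib, Finset.prod_const, Finset.card_univ,
    NNReal.coe_one, mul_one, sub_zero, ← Real.exp_sum]
  congr 1
  · rw [inv_pow]
    congr 1
    rw [Real.sqrt_eq_rpow, Real.sqrt_eq_rpow, ← Real.rpow_natCast, ← Real.rpow_natCast,
      ← Real.rpow_mul (by positivity), ← Real.rpow_mul (by positivity),
      mul_comm (1 / 2 : ℝ)]
  · rw [← Finset.sum_div, Finset.sum_neg_distrib, dotProduct]
    simp_rw [pow_two]

variable {ι κ : Type*} [Fintype ι] [DecidableEq ι] [Fintype κ] [DecidableEq κ]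

/-- The density of a nondegenerate Gaussian measure. -/
theorem multivariateGaussian_eq_withDensity {S : Matrix ι ι ℝ} (hS : S.PosDef) :
    multivariateGaussian 0 S = volume.withDensity fun x : EuclideanSpace ℝ ι =>
      ENNReal.ofReal ((√((2 * Real.pi) ^ Fintype.card ι * S.det))⁻¹ *
        Real.exp (-(x.ofLp ⬝ᵥ S⁻¹.mulVec x.ofLp) / 2)) := by
  -- The law is the image of the standard Gaussian measure under the symmetric root `T`. The
  -- Jacobian is `|det T| = √(det S)`, and the form of `S⁻¹` pulls back to the squared norm.
  set T := CFC.sqrt S with hT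
  have hTT : T * T = S := CFC.sqrt_mul_sqrt_self S hS.posSemidef.nonneg
  have hTs : T.transpose = T := by
    have : T.IsHermitian := (CFC.sqrt_nonneg S).isSelfAdjoint
    simpa [Matrix.IsHermitian, Matrix.conjTranspose_eq_transpose_of_trivial] using this
  have hdet : T.det ^ 2 = S.det := by rw [pow_two, ← Matrix.det_mul, hTT]
  have hSdet := hS.det_pos
  have hTdet : T.det ≠ 0 := fun h0 => by rw [h0] at hdet; simp at hdet; linarith
  set L : EuclideanSpace ℝ ι →L[ℝ] EuclideanSpace ℝ ι := Matrix.toEuclideanCLM (𝕜 := ℝ) T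
  have hLdet : LinearMap.det (L : EuclideanSpace ℝ ι →ₗ[ℝ] EuclideanSpace ℝ ι) = T.det := by
    have : (L : EuclideanSpace ℝ ι →ₗ[ℝ] EuclideanSpace ℝ ι) =
      Matrix.toLin (EuclideanSpace.basisFun ι ℝ).toBasis (EuclideanSpace.basisFun ι ℝ).toBasis T := by
      rw [Matrix.coe_toEuclideanCLM_eq_toEuclideanLin, Matrix.toEuclideanLin_eq_toLin_orthonormal]
    rw [this, LinearMap.det_toLin]
  have hLm : Measurable L := L.continuous.measurable
  have hmap : Measure.map L volume = ENNReal.ofReal |T.det⁻¹| • volume := by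
    have := Measure.map_linearMap_addHaar_eq_smul_addHaar
      (volume : Measure (EuclideanSpace ℝ ι)) (f := (L : EuclideanSpace ℝ ι →ₗ[ℝ] _))
      (by rw [hLdet]; exact hTdet)
    rw [hLdet] at this
    exact this
  have hq : ∀ x : EuclideanSpace ℝ ι,
      (L x).ofLp ⬝ᵥ S⁻¹.mulVec (L x).ofLp = x.ofLp ⬝ᵥ x.ofLp := fun x => by
    have hTu : IsUnit T.det := isUnit_iff_ne_zero.2 hTdet
    rw [Matrix.ofLp_toEuclideanCLM, ← hTT, Matrix.mul_inv_rev, Matrix.mulVec_mulVec, mul_assoc,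
      Matrix.nonsing_inv_mul _ hTu, mul_one, Matrix.dotProduct_mulVec, ← Matrix.mulVec_transpose,
      Matrix.transpose_nonsing_inv, hTs, Matrix.mulVec_mulVec, Matrix.nonsing_inv_mul _ hTu,
      Matrix.one_mulVec]
  rw [multivariateGaussian, stdGaussian_eq_withDensity]
  simp_rw [zero_add]
  ext s hs
  change Measure.map L _ s = _
  rw [Measure.map_apply hLm hs, withDensity_apply _ (hLm hs), withDensity_apply _ hs]
  have hG : ∀ x : EuclideanSpace ℝ ι,
      ENNReal.ofReal ((√((2 * Real.pi) ^ Fintype.card ι))⁻¹ *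
        Real.exp (-(x.ofLp ⬝ᵥ x.ofLp) / 2)) = (fun y : EuclideanSpace ℝ ι =>
      ENNReal.ofReal ((√((2 * Real.pi) ^ Fintype.card ι))⁻¹ *
        Real.exp (-(y.ofLp ⬝ᵥ S⁻¹.mulVec y.ofLp) / 2))) (L x) := fun x => by
    simp only [hq]
  have hGm : Measurable (fun y : EuclideanSpace ℝ ι =>
      ENNReal.ofReal ((√((2 * Real.pi) ^ Fintype.card ι))⁻¹ *
        Real.exp (-(y.ofLp ⬝ᵥ S⁻¹.mulVec y.ofLp) / 2))) := by
    have : Continuous fun y : EuclideanSpace ℝ ι => y.ofLp ⬝ᵥ S⁻¹.mulVec y.ofLp := by fun_prop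
    fun_prop
  simp_rw [hG]
  rw [← setLIntegral_map hs hGm hLm, hmap, Measure.restrict_smul, lintegral_smul_measure,
    smul_eq_mul, ← lintegral_const_mul _ hGm]
  refine lintegral_congr fun x => ?_
  rw [← ENNReal.ofReal_mul (abs_nonneg _), ← mul_assoc]
  congr 2
  rw [Real.sqrt_mul (by positivity), ← hdet, Real.sqrt_sq_eq_abs, abs_inv, mul_inv, mul_comm]

/-- Linear images of centred Gaussian measures. -/
theorem map_multivariateGaussian {S : Matrix ι ι ℝ} (hS : S.PosSemidef) (A : Matrix κ ι ℝ) :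
    (multivariateGaussian 0 S).map (fun x => WithLp.toLp 2 (A.mulVec x.ofLp)) =
      multivariateGaussian 0 (A * S * A.transpose) := by
  have hS' : (A * S * A.transpose).PosSemidef := by
    simpa [Matrix.conjTranspose_eq_transpose_of_trivial] using hS.mul_mul_conjTranspose_same A
  have hm : Measurable fun x : EuclideanSpace ℝ ι =>
      (WithLp.toLp 2 (A.mulVec x.ofLp) : EuclideanSpace ℝ κ) := by
    have : Continuous fun x : EuclideanSpace ℝ ι =>
      (WithLp.toLp 2 (A.mulVec x.ofLp) : EuclideanSpace ℝ κ) := by fun_prop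
    exact this.measurable
  have : IsProbabilityMeasure ((multivariateGaussian 0 S).map
      (fun x => (WithLp.toLp 2 (A.mulVec x.ofLp) : EuclideanSpace ℝ κ))) :=
    Measure.isProbabilityMeasure_map hm.aemeasurable
  refine Measure.ext_of_charFun ?_
  ext t
  have hin : ∀ x : EuclideanSpace ℝ ι,
      inner ℝ (WithLp.toLp 2 (A.mulVec x.ofLp) : EuclideanSpace ℝ κ) t =
      inner ℝ x (WithLp.toLp 2 (A.transpose.mulVec t.ofLp)) := fun x => by
    simp only [EuclideanSpace.inner_eq_star_dotProduct, star_trivial]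
    rw [Matrix.dotProduct_mulVec, ← Matrix.mulVec_transpose, dotProduct_comm,
      dotProduct_comm x.ofLp]
  rw [charFun_apply, integral_map hm.aemeasurable (by fun_prop)]
  simp_rw [hin]
  rw [← charFun_apply, charFun_multivariateGaussian hS, charFun_multivariateGaussian hS']
  simp only [inner_zero_right, Complex.ofReal_zero, zero_mul, zero_sub]
  congr 4
  rw [← Matrix.mulVec_mulVec, ← Matrix.mulVec_mulVec, Matrix.dotProduct_mulVec (v := t.ofLp),
    ← Matrix.mulVec_transpose]

end GaussianDensity

/-! ### Posterior distributions of the mixing variable -/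

/-- The weight `w ^ α exp (-θ w)`. -/
noncomputable def tilt (α θ w : ℝ) : ℝ≥0∞ := ENNReal.ofReal (w ^ α * Real.exp (-(θ * w)))

/-- The total mass of the tilted measure `w ^ α exp (-θ w) ν(dw)`. -/
noncomputable def tiltMass (ν : Measure ℝ) (α θ : ℝ) : ℝ≥0∞ := ∫⁻ w, tilt α θ w ∂ν

/-- The normalisation of the measure `w ^ α exp (-θ w) ν(dw)`. -/
noncomputable def posteriorMixing (ν : Measure ℝ) (α θ : ℝ) : Measure ℝ :=
  ν.withDensity fun w => (tiltMass ν α θ)⁻¹ * tilt α θ w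

instance sFinite_posteriorMixing (ν : Measure ℝ) [SFinite ν] (α θ : ℝ) :
    SFinite (posteriorMixing ν α θ) := by
  unfold posteriorMixing; infer_instance

lemma measurable_tilt_uncurry (α : ℝ) : Measurable fun p : ℝ × ℝ => tilt α p.1 p.2 := by
  unfold tilt; fun_prop

@[fun_prop]
lemma measurable_tilt (α θ : ℝ) : Measurable (tilt α θ) := by
  unfold tilt; fun_prop

lemma measurable_tiltMass (ν : Measure ℝ) [SFinite ν] (α : ℝ) : Measurable (tiltMass ν α) :=
  (measurable_tilt_uncurry α).lintegral_prod_right'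

lemma tiltMass_ne_zero {ν : Measure ℝ} [NeZero ν] (hpos : ∀ᵐ w ∂ν, 0 < w) (α θ : ℝ) :
    tiltMass ν α θ ≠ 0 := by
  intro h0
  rw [tiltMass, lintegral_eq_zero_iff (measurable_tilt α θ)] at h0
  have : ∀ᵐ w ∂ν, False := by
    filter_upwards [h0, hpos] with w h1 hw
    have : 0 < w ^ α * Real.exp (-(θ * w)) := by positivity
    simp only [tilt, Pi.zero_apply, ENNReal.ofReal_eq_zero] at h1
    linarith
  simp only [eventually_false_iff_eq_bot, ae_eq_bot] at this
  exact NeZero.ne ν this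

lemma tiltMass_eq_ofReal {ν : Measure ℝ} [IsFiniteMeasure ν] (hpos : ∀ᵐ w ∂ν, 0 < w) {α θ : ℝ}
    (hα : 0 ≤ α) (hθ : 0 < θ) : tiltMass ν α θ = ENNReal.ofReal (laplaceMoment ν α θ) := by
  rw [laplaceMoment, ofReal_integral_eq_lintegral_ofReal
    (integrable_rpow_mul_exp_neg hpos hα hθ)]
  · rfl
  · filter_upwards [hpos] with w hw
    simp only [Pi.zero_apply]; positivity

/-- If the tilted mass is infinite, its inverse is 0 and the posterior is the zero measure. Thus the
posteriors form a finite kernel without exceptional values of `θ`. -/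
lemma posterior_univ_le (ν : Measure ℝ) (α θ : ℝ) : posteriorMixing ν α θ univ ≤ 1 := by
  rw [posteriorMixing, withDensity_apply _ MeasurableSet.univ, Measure.restrict_univ,
    lintegral_const_mul _ (measurable_tilt α θ)]
  exact ENNReal.inv_mul_le_one _

lemma isProbabilityMeasure_posterior {ν : Measure ℝ} [NeZero ν] (hpos : ∀ᵐ w ∂ν, 0 < w)
    {α θ : ℝ} (h : tiltMass ν α θ ≠ ⊤) : IsProbabilityMeasure (posteriorMixing ν α θ) := by
  constructor
  rw [posteriorMixing, withDensity_apply _ MeasurableSet.univ, Measure.restrict_univ,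
    lintegral_const_mul _ (measurable_tilt α θ)]
  exact ENNReal.inv_mul_cancel (tiltMass_ne_zero hpos α θ) h

lemma lintegral_posterior (ν : Measure ℝ) [SFinite ν] (α θ : ℝ) {F : ℝ → ℝ≥0∞} (hF : Measurable F) :
    ∫⁻ w, F w ∂(posteriorMixing ν α θ) = (tiltMass ν α θ)⁻¹ * ∫⁻ w, tilt α θ w * F w ∂ν := by
  rw [posteriorMixing, lintegral_withDensity_eq_lintegral_mul _ (by fun_prop) hF,
    ← lintegral_const_mul _ (by fun_prop)]
  simp only [Pi.mul_apply, mul_assoc]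

/-- The posterior distribution as a kernel. -/
noncomputable def posteriorKernel {V : Type*} [MeasurableSpace V] (ν : Measure ℝ) [SFinite ν]
    (α : ℝ) (θ : V → ℝ) : Kernel V ℝ :=
  Kernel.withDensity (Kernel.const V ν) fun v w => (tiltMass ν α (θ v))⁻¹ * tilt α (θ v) w

lemma posteriorKernel_apply {V : Type*} [MeasurableSpace V] (ν : Measure ℝ) [SFinite ν]
    (α : ℝ) {θ : V → ℝ} (hθ : Measurable θ) (v : V) :
    posteriorKernel ν α θ v = posteriorMixing ν α (θ v) := by
  rw [posteriorKernel, Kernel.withDensity_apply _ _ v, Kernel.const_apply]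
  · rfl
  · have h1 : Measurable fun p : V × ℝ => tilt α (θ p.1) p.2 :=
      (measurable_tilt_uncurry α).comp ((hθ.comp measurable_fst).prodMk measurable_snd)
    have h2 : Measurable fun p : V × ℝ => (tiltMass ν α (θ p.1))⁻¹ :=
      ((measurable_tiltMass ν α).comp (hθ.comp measurable_fst)).inv
    exact h2.mul h1

lemma isFiniteKernel_posteriorKernel {V : Type*} [MeasurableSpace V] (ν : Measure ℝ) [SFinite ν]
    (α : ℝ) {θ : V → ℝ} (hθ : Measurable θ) : IsFiniteKernel (posteriorKernel ν α θ) :=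
  ⟨1, ENNReal.one_lt_top, fun v => by
    rw [posteriorKernel_apply ν α hθ]; exact posterior_univ_le ν α (θ v)⟩

/-! ### Scaled Gaussian vectors -/

section Scaled

variable {ι : Type*} [Fintype ι] [DecidableEq ι]

/-- Half the quadratic form of the inverse matrix. -/
noncomputable def halfQuadForm (S : Matrix ι ι ℝ) (v : ι → ℝ) : ℝ := (v ⬝ᵥ S⁻¹.mulVec v) / 2

/-- The normalising constant of the Gaussian density. -/
noncomputable def gaussianConst (S : Matrix ι ι ℝ) : ℝ :=
  (√((2 * Real.pi) ^ Fintype.card ι * S.det))⁻¹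

lemma continuous_halfQuadForm (S : Matrix ι ι ℝ) : Continuous (halfQuadForm S) := by
  unfold halfQuadForm; fun_prop

lemma gaussianConst_pos {S : Matrix ι ι ℝ} (hS : S.PosDef) : 0 < gaussianConst S := by
  have := hS.det_pos
  unfold gaussianConst; positivity

lemma halfQuadForm_nonneg {S : Matrix ι ι ℝ} (hS : S.PosDef) (v : ι → ℝ) :
    0 ≤ halfQuadForm S v := by
  have := hS.inv.posSemidef.dotProduct_mulVec_nonneg v
  simp only [star_trivial] at this
  unfold halfQuadForm; positivity

lemma halfQuadForm_pos {S : Matrix ι ι ℝ} (hS : S.PosDef) {v : ι → ℝ} (hv : v ≠ 0) :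
    0 < halfQuadForm S v := by
  have := hS.inv.dotProduct_mulVec_pos hv
  simp only [star_trivial] at this
  unfold halfQuadForm; positivity

lemma halfQuadForm_smul (S : Matrix ι ι ℝ) (t : ℝ) (v : ι → ℝ) :
    halfQuadForm S (t • v) = t ^ 2 * halfQuadForm S v := by
  simp only [halfQuadForm, Matrix.mulVec_smul, smul_dotProduct, dotProduct_smul, smul_eq_mul]
  ring

/-- Substituting `v = x / √w` produces the Jacobian `w ^ (n/2)` in dimension `n` and the exponent
`-w * halfQuadForm S v`. As a function of `w`, the density of `Z / √w` at `v` is thus a multiple of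
`tilt`: this is the likelihood behind the posterior laws. -/
lemma lintegral_smul_multivariateGaussian {S : Matrix ι ι ℝ} (hS : S.PosDef) {w : ℝ} (hw : 0 < w)
    {F : (ι → ℝ) → ℝ≥0∞} (hF : Measurable F) :
    ∫⁻ x, F ((√w)⁻¹ • x.ofLp) ∂(multivariateGaussian 0 S) =
      ∫⁻ v : ι → ℝ, ENNReal.ofReal (gaussianConst S) *
        (tilt (Fintype.card ι / 2) (halfQuadForm S v) w * F v) := by
  have hw' : 0 < √w := Real.sqrt_pos.2 hw
  have hq : Continuous fun x : EuclideanSpace ℝ ι => x.ofLp ⬝ᵥ S⁻¹.mulVec x.ofLp := by fun_prop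
  rw [multivariateGaussian_eq_withDensity hS,
    lintegral_withDensity_eq_lintegral_mul _ (by fun_prop) (by fun_prop),
    ← (PiLp.volume_preserving_toLp ι).lintegral_comp (by fun_prop)]
  set G : (ι → ℝ) → ℝ≥0∞ := fun v => ENNReal.ofReal (gaussianConst S *
    Real.exp (-(w * halfQuadForm S v))) * F v with hG
  have hGm : Measurable G := by
    have := (continuous_halfQuadForm S).measurable
    fun_prop
  have hc : (√w)⁻¹ ≠ 0 := by positivity
  have hint : ∀ y : ι → ℝ, ((fun x : EuclideanSpace ℝ ι =>
      ENNReal.ofReal ((√((2 * Real.pi) ^ Fintype.card ι * S.det))⁻¹ *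
        Real.exp (-(x.ofLp ⬝ᵥ S⁻¹.mulVec x.ofLp) / 2))) * fun x : EuclideanSpace ℝ ι => F ((√w)⁻¹ • x.ofLp))
        (WithLp.toLp 2 y) = G ((√w)⁻¹ • y) := fun y => by
    simp only [Pi.mul_apply, hG, halfQuadForm_smul]
    congr 4
    rw [inv_pow, Real.sq_sqrt hw.le, halfQuadForm]
    field_simp
  simp_rw [hint]
  have hmap := Measure.map_addHaar_smul (volume : Measure (ι → ℝ)) hc
  have hsm : Measurable fun y : ι → ℝ => (√w)⁻¹ • y := by fun_prop
  rw [← lintegral_map hGm hsm, hmap, lintegral_smul_measure, smul_eq_mul,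
    ← lintegral_const_mul _ hGm]
  refine lintegral_congr fun v => ?_
  simp only [hG, tilt]
  rw [← mul_assoc, ← mul_assoc, ← ENNReal.ofReal_mul (abs_nonneg _),
    ← ENNReal.ofReal_mul (gaussianConst_pos hS).le]
  congr 2
  have : |((√w)⁻¹ ^ Module.finrank ℝ (ι → ℝ))⁻¹| = w ^ ((Fintype.card ι : ℝ) / 2) := by
    rw [Module.finrank_fintype_fun_eq_card, inv_pow, inv_inv, abs_of_nonneg (by positivity),
      Real.sqrt_eq_rpow, ← Real.rpow_natCast, ← Real.rpow_mul hw.le]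
    congr 1; ring
  rw [this, mul_comm w]; ring

end Scaled

/-! ### Regression and conditional distributions -/

section Regression

variable {d : ℕ}

/-- The principal submatrix with index set `D`. -/
abbrev principalSubmatrix (S : Matrix (Fin d) (Fin d) ℝ) (D : Finset (Fin d)) :
    Matrix D D ℝ := S.submatrix Subtype.val Subtype.val

lemma posDef_principalSubmatrix {S : Matrix (Fin d) (Fin d) ℝ} (hS : S.PosDef)
    (D : Finset (Fin d)) : (principalSubmatrix S D).PosDef :=
  hS.submatrix Subtype.val_injective

/-- `u` is the coefficient vector of the residual of the `i`-th variable after regression on the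
variables in `D`. -/
structure IsResidualVector (S : Matrix (Fin d) (Fin d) ℝ) (D : Finset (Fin d)) (i : Fin d)
    (u : Fin d → ℝ) : Prop where
  self : u i = 1
  zero : ∀ l, l ∉ D → l ≠ i → u l = 0
  orth : ∀ k ∈ D, S.mulVec u k = 0

/-- The entries on `D` solve the normal equations, whose matrix is positive definite. -/
lemma exists_isResidualVector {S : Matrix (Fin d) (Fin d) ℝ} (hS : S.PosDef) {D : Finset (Fin d)}
    {i : Fin d} (hi : i ∉ D) : ∃ u, IsResidualVector S D i u := by
  set SD := principalSubmatrix S D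
  have hdet : IsUnit SD.det := isUnit_iff_ne_zero.2 (posDef_principalSubmatrix hS D).det_pos.ne'
  set b : D → ℝ := -(SD⁻¹.mulVec fun k => S k i)
  have hb : ∀ k : D, SD.mulVec b k = -S k i := fun k => by
    simp only [b, Matrix.mulVec_neg, Matrix.mulVec_mulVec, Matrix.mul_nonsing_inv _ hdet,
      Matrix.one_mulVec, Pi.neg_apply]
  refine ⟨fun l => if h : l ∈ D then b ⟨l, h⟩ else if l = i then 1 else 0, by simp [hi],
    fun l hl hli => by simp [hl, hli], fun k hk => ?_⟩
  have h1 : ∀ l, S k l * (if h : l ∈ D then b ⟨l, h⟩ else if l = i then 1 else 0) =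
      (if h : l ∈ D then S k l * b ⟨l, h⟩ else 0) + (if l = i then S k l else 0) := fun l => by
    by_cases hl : l ∈ D
    · have : l ≠ i := fun h => hi (h ▸ hl)
      simp [hl, this]
    · simp [hl]
  have h2 : ∑ l, (if h : l ∈ D then S k l * b ⟨l, h⟩ else 0) = SD.mulVec b ⟨k, hk⟩ := by
    rw [Matrix.mulVec, dotProduct, ← Finset.sum_subset (Finset.subset_univ D)
      (fun l _ hl => by simp [hl]), ← Finset.sum_attach, Finset.univ_eq_attach]
    refine Finset.sum_congr rfl fun l _ => ?_
    simp [SD]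
  rw [Matrix.mulVec, dotProduct]
  simp_rw [h1]
  rw [Finset.sum_add_distrib, h2, hb]
  simp

lemma IsResidualVector.dotProduct_eq {S : Matrix (Fin d) (Fin d) ℝ} {D : Finset (Fin d)}
    {i : Fin d} {u : Fin d → ℝ} (hu : IsResidualVector S D i u) (hi : i ∉ D) (x : Fin d → ℝ) :
    u ⬝ᵥ x = x i + ∑ k : D, u k * x k := by
  have h1 : ∀ l, u l * x l = (if l ∈ D then u l * x l else 0) + (if l = i then x l else 0) :=
    fun l => by
      by_cases hl : l ∈ D
      · have : l ≠ i := fun h => hi (h ▸ hl)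
        simp [hl, this]
      · by_cases hli : l = i
        · subst hli
          rw [hu.self, if_neg hi, if_pos rfl]; ring
        · rw [hu.zero l hl hli, if_neg hl, if_neg hli]; ring
  rw [dotProduct, Finset.sum_congr rfl fun l _ => h1 l, Finset.sum_add_distrib, Finset.sum_coe_sort D (fun k => u k * x k)]
  simp [add_comm]

/-- The vector of the variables in `D`. -/
def subvector (D : Finset (Fin d)) (x : Fin d → ℝ) : D → ℝ := fun k => x k

/-- The pair of residuals. -/
def residualPair (u v : Fin d → ℝ) (x : EuclideanSpace ℝ (Fin d)) : ℝ × ℝ :=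
  (u ⬝ᵥ x.ofLp, v ⬝ᵥ x.ofLp)

lemma continuous_residualPair (u v : Fin d → ℝ) : Continuous (residualPair u v) := by
  unfold residualPair; fun_prop

lemma continuous_subvector (D : Finset (Fin d)) : Continuous (subvector D) := by
  unfold subvector; fun_prop

lemma covariance_eval_dotProduct {S : Matrix (Fin d) (Fin d) ℝ} (hS : S.PosSemidef)
    (u : Fin d → ℝ) (k : Fin d) :
    cov[fun x : EuclideanSpace ℝ (Fin d) => x k, fun x => u ⬝ᵥ x.ofLp;
      multivariateGaussian 0 S] = S.mulVec u k := by
  have hL : ∀ l, MemLp (fun x : EuclideanSpace ℝ (Fin d) => x l) 2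
      (multivariateGaussian 0 S) := fun l =>
    (IsGaussian.memLp_two_id (μ := multivariateGaussian 0 S)).continuousLinearMap_comp
      (EuclideanSpace.proj (𝕜 := ℝ) l)
  simp only [dotProduct, Matrix.mulVec]
  rw [covariance_fun_sum_right (fun l => (hL l).const_mul _) (hL k)]
  refine Finset.sum_congr rfl fun l _ => ?_
  rw [covariance_const_mul_right, covariance_eval_multivariateGaussian hS, mul_comm]

/-- Both vectors are linear images of one Gaussian vector, so vanishing covariances are enough, and
these are the orthogonality conditions. -/
lemma indepFun_subvector_residualPair {S : Matrix (Fin d) (Fin d) ℝ} (hS : S.PosSemidef)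
    {D : Finset (Fin d)} {u v : Fin d → ℝ} (hu : ∀ k ∈ D, S.mulVec u k = 0)
    (hv : ∀ k ∈ D, S.mulVec v k = 0) :
    IndepFun (fun x => subvector D x.ofLp) (residualPair u v) (multivariateGaussian 0 S) := by
  have hG : HasGaussianLaw (fun x : EuclideanSpace ℝ (Fin d) =>
      ((fun k : D => x k), fun a : Fin 2 => (![u, v] a) ⬝ᵥ x.ofLp)) (multivariateGaussian 0 S) := by
    let L : EuclideanSpace ℝ (Fin d) →ₗ[ℝ] (D → ℝ) × (Fin 2 → ℝ) :=
      { toFun := fun x => ((fun k : D => x k), fun a : Fin 2 => (![u, v] a) ⬝ᵥ x.ofLp)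
        map_add' := fun x y => by
          ext <;> simp [dotProduct_add]
        map_smul' := fun c x => by
          ext <;> simp [dotProduct_smul] }
    exact (IsGaussian.hasGaussianLaw_id (μ := multivariateGaussian 0 S)).map L.toContinuousLinearMap
  have h := hG.indepFun_of_covariance_eval (fun k a => by
    rw [covariance_eval_dotProduct hS]
    fin_cases a
    · exact hu k k.2
    · exact hv k k.2)
  exact h.comp (φ := id) (ψ := fun e : Fin 2 → ℝ => (e 0, e 1)) measurable_id (by fun_prop)

lemma map_subvector_multivariateGaussian {S : Matrix (Fin d) (Fin d) ℝ} (hS : S.PosSemidef)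
    (D : Finset (Fin d)) :
    (multivariateGaussian 0 S).map (fun x => subvector D x.ofLp) =
      (multivariateGaussian 0 (principalSubmatrix S D)).map WithLp.ofLp := by
  set A : Matrix D (Fin d) ℝ := (1 : Matrix (Fin d) (Fin d) ℝ).submatrix Subtype.val id
  have hA : A * S * A.transpose = principalSubmatrix S D := by
    ext k l
    simp [A, Matrix.mul_apply, Matrix.one_apply]
  have hAv : ∀ x : Fin d → ℝ, A.mulVec x = subvector D x := fun x => by
    ext k
    simp [A, Matrix.mulVec, dotProduct, Matrix.one_apply, subvector]
  rw [← hA, ← map_multivariateGaussian hS A, Measure.map_map (by fun_prop) (by fun_prop)]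
  congr 1
  ext x : 1
  simp [hAv]

/-- The covariance matrix of the residuals. -/
def residualCov (S : Matrix (Fin d) (Fin d) ℝ) (u v : Fin d → ℝ) : Matrix (Fin 2) (Fin 2) ℝ :=
  Matrix.of ![u, v] * S * (Matrix.of ![u, v]).transpose

lemma map_residualPair_multivariateGaussian {S : Matrix (Fin d) (Fin d) ℝ} (hS : S.PosSemidef)
    (u v : Fin d → ℝ) :
    (multivariateGaussian 0 S).map (residualPair u v) =
      (multivariateGaussian 0 (residualCov S u v)).map fun e => (e 0, e 1) := by
  rw [residualCov, ← map_multivariateGaussian hS, Measure.map_map (by fun_prop) (by fun_prop)]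
  congr 1

/-- At the coordinates `i` and `j`, which lie outside `D`, the vectors `u` and `v` restrict to the
two unit vectors; so they are linearly independent. -/
lemma posDef_residualCov {S : Matrix (Fin d) (Fin d) ℝ} (hS : S.PosDef) {D : Finset (Fin d)}
    {i j : Fin d} (hij : i ≠ j) (hi : i ∉ D) (hj : j ∉ D) {u v : Fin d → ℝ}
    (hu : IsResidualVector S D i u) (hv : IsResidualVector S D j v) :
    (residualCov S u v).PosDef := by
  have h := hS.mul_mul_conjTranspose_same (B := Matrix.of ![u, v]) (by
    intro a b hab
    have h0 := congrFun hab
    have hi' := h0 i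
    have hj' := h0 j
    simp [Matrix.vecMul, dotProduct, Fin.sum_univ_two, hu.self, hv.self, hu.zero j hj hij.symm,
      hv.zero i hi hij] at hi' hj'
    ext l
    fin_cases l
    · exact hi'
    · exact hj')
  simpa [residualCov, Matrix.conjTranspose_eq_transpose_of_trivial] using h

lemma residualCov_apply (S : Matrix (Fin d) (Fin d) ℝ) (u v : Fin d → ℝ) (a b : Fin 2) :
    residualCov S u v a b = (![u, v] a) ⬝ᵥ S.mulVec (![u, v] b) := by
  rw [residualCov, Matrix.mul_assoc]
  rfl

/-- The values of the two variables in terms of the conditioning variables, the mixing variable and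
the residuals. -/
noncomputable def reconstruct (D : Finset (Fin d)) (u v : Fin d → ℝ) (z : D → ℝ) (w : ℝ) (e : ℝ × ℝ) : ℝ × ℝ :=
  ((√w)⁻¹ * e.1 - ∑ k : D, u k * z k, (√w)⁻¹ * e.2 - ∑ k : D, v k * z k)

lemma measurable_reconstruct (D : Finset (Fin d)) (u v : Fin d → ℝ) :
    Measurable fun p : (D → ℝ) × (ℝ × (ℝ × ℝ)) => reconstruct D u v p.1 p.2.1 p.2.2 := by
  unfold reconstruct; fun_prop

/-- The conditional distribution of the pair given the variables in `D`, as a kernel. -/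
noncomputable def pairKernel (S : Matrix (Fin d) (Fin d) ℝ) (ν : Measure ℝ) [SFinite ν]
    (D : Finset (Fin d)) (u v : Fin d → ℝ) : Kernel (D → ℝ) (ℝ × ℝ) :=
  (Kernel.id ×ₖ (posteriorKernel ν (Fintype.card D / 2) (halfQuadForm (principalSubmatrix S D)) ×ₖ
    Kernel.const _ ((multivariateGaussian 0 S).map (residualPair u v)))).map
    fun p => reconstruct D u v p.1 p.2.1 p.2.2

lemma pairKernel_apply (S : Matrix (Fin d) (Fin d) ℝ) (ν : Measure ℝ) [SFinite ν]
    (D : Finset (Fin d)) (u v : Fin d → ℝ) (z : D → ℝ) :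
    pairKernel S ν D u v z =
      ((posteriorMixing ν (Fintype.card D / 2) (halfQuadForm (principalSubmatrix S D) z)).prod
        ((multivariateGaussian 0 S).map (residualPair u v))).map
        fun p => reconstruct D u v z p.1 p.2 := by
  have hq := (continuous_halfQuadForm (principalSubmatrix S D)).measurable
  have := isFiniteKernel_posteriorKernel ν (Fintype.card D / 2) hq
  rw [pairKernel, Kernel.map_apply _ (measurable_reconstruct D u v), Kernel.prod_apply,
    Kernel.prod_apply, Kernel.id_apply, Kernel.const_apply, posteriorKernel_apply _ _ hq,
    Measure.dirac_prod, Measure.map_map (measurable_reconstruct D u v) (by fun_prop)]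
  rfl

instance isFiniteKernel_pairKernel (S : Matrix (Fin d) (Fin d) ℝ) (ν : Measure ℝ) [SFinite ν]
    (D : Finset (Fin d)) (u v : Fin d → ℝ) : IsFiniteKernel (pairKernel S ν D u v) := by
  have hq := (continuous_halfQuadForm (principalSubmatrix S D)).measurable
  have := isFiniteKernel_posteriorKernel ν (Fintype.card D / 2) hq
  have : IsFiniteMeasure ((multivariateGaussian 0 S).map (residualPair u v)) :=
    Measure.isFiniteMeasure_map _ _
  unfold pairKernel
  infer_instance

lemma lintegral_normalScaleMixture (S : Matrix (Fin d) (Fin d) ℝ) (ν : Measure ℝ)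
    [IsFiniteMeasure ν] {F : EuclideanSpace ℝ (Fin d) → ℝ≥0∞} (hF : Measurable F) :
    ∫⁻ x, F x ∂(normalScaleMixture S ν) =
      ∫⁻ w, ∫⁻ x, F ((√w)⁻¹ • x) ∂(multivariateGaussian 0 S) ∂ν := by
  rw [normalScaleMixture, lintegral_map hF (by fun_prop), lintegral_prod _ (by fun_prop)]

/-- The density of the variables in `D`. -/
lemma map_subvector_normalScaleMixture {S : Matrix (Fin d) (Fin d) ℝ} (hS : S.PosDef)
    {ν : Measure ℝ} [IsProbabilityMeasure ν] (hpos : ∀ᵐ w ∂ν, 0 < w) (D : Finset (Fin d)) :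
    (normalScaleMixture S ν).map (fun x => subvector D x.ofLp) =
      volume.withDensity fun z => ENNReal.ofReal (gaussianConst (principalSubmatrix S D)) *
        tiltMass ν (Fintype.card D / 2) (halfQuadForm (principalSubmatrix S D) z) := by
  have hD := posDef_principalSubmatrix hS D
  have hsub := (continuous_subvector D).measurable
  have hq := (continuous_halfQuadForm (principalSubmatrix S D)).measurable
  have hM : Measurable fun z => tiltMass ν (Fintype.card D / 2)
      (halfQuadForm (principalSubmatrix S D) z) := (measurable_tiltMass ν _).comp hq
  have ht : Measurable fun p : (D → ℝ) × ℝ =>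
      tilt (Fintype.card D / 2) (halfQuadForm (principalSubmatrix S D) p.1) p.2 :=
    (measurable_tilt_uncurry _).comp ((hq.comp measurable_fst).prodMk measurable_snd)
  refine Measure.ext_of_lintegral _ fun F hF => ?_
  rw [lintegral_map hF (by fun_prop), lintegral_normalScaleMixture _ _ (by fun_prop),
    lintegral_withDensity_eq_lintegral_mul _ (hM.const_mul _) hF]
  have h1 : ∀ᵐ w ∂ν, ∫⁻ x, F (subvector D ((√w)⁻¹ • x).ofLp) ∂(multivariateGaussian 0 S) =
      ∫⁻ z : D → ℝ, ENNReal.ofReal (gaussianConst (principalSubmatrix S D)) *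
        (tilt (Fintype.card D / 2) (halfQuadForm (principalSubmatrix S D) z) w * F z) := by
    filter_upwards [hpos] with w hw
    rw [← lintegral_smul_multivariateGaussian hD hw hF]
    have e1 : ∫⁻ x, F (subvector D ((√w)⁻¹ • x).ofLp) ∂(multivariateGaussian 0 S) =
        ∫⁻ z, F ((√w)⁻¹ • z) ∂((multivariateGaussian 0 S).map fun x => subvector D x.ofLp) := by
      rw [lintegral_map (by fun_prop) (by fun_prop)]
      rfl
    rw [e1, map_subvector_multivariateGaussian hS.posSemidef, lintegral_map (by fun_prop)
      (by fun_prop)]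
  rw [lintegral_congr_ae h1, lintegral_lintegral_swap]
  · refine lintegral_congr fun z => ?_
    rw [lintegral_const_mul _ (by fun_prop), lintegral_mul_const _ (by fun_prop), Pi.mul_apply,
      mul_assoc]
    rfl
  · refine Measurable.aemeasurable ?_
    refine Measurable.const_mul (Measurable.mul ?_ (by fun_prop)) _
    exact ht.comp measurable_swap

/-- The conditional distribution of two variables of a scale mixture of Normals. -/
theorem condDistrib_pair_normalScaleMixture {S : Matrix (Fin d) (Fin d) ℝ} (hS : S.PosDef)
    {ν : Measure ℝ} [IsProbabilityMeasure ν] (hpos : ∀ᵐ w ∂ν, 0 < w) {D : Finset (Fin d)}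
    {i j : Fin d} (hi : i ∉ D) (hj : j ∉ D) {u v : Fin d → ℝ}
    (hu : IsResidualVector S D i u) (hv : IsResidualVector S D j v) :
    condDistrib (fun x : EuclideanSpace ℝ (Fin d) => (x i, x j)) (fun x (k : D) => x k)
      (normalScaleMixture S ν) =ᵐ[(normalScaleMixture S ν).map fun x (k : D) => x k]
      pairKernel S ν D u v := by
  refine condDistrib_ae_eq_of_measure_eq_compProd _ (by fun_prop) ?_
  have hD := posDef_principalSubmatrix hS D
  have hsub := (continuous_subvector D).measurable
  have hres := (continuous_residualPair u v).measurable
  have hq := (continuous_halfQuadForm (principalSubmatrix S D)).measurable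
  have hM : Measurable fun z => tiltMass ν (Fintype.card D / 2)
      (halfQuadForm (principalSubmatrix S D) z) := (measurable_tiltMass ν _).comp hq
  have hrec := measurable_reconstruct D u v
  have ht : Measurable fun p : (D → ℝ) × ℝ =>
      tilt (Fintype.card D / 2) (halfQuadForm (principalSubmatrix S D) p.1) p.2 :=
    (measurable_tilt_uncurry _).comp ((hq.comp measurable_fst).prodMk measurable_snd)
  set P := (multivariateGaussian 0 S).map (residualPair u v)
  have : IsProbabilityMeasure P := Measure.isProbabilityMeasure_map hres.aemeasurable
  set c := ENNReal.ofReal (gaussianConst (principalSubmatrix S D))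
  have hmap := map_subvector_normalScaleMixture hS hpos D
  -- The tilted mass may be infinite at exceptional `z`, but up to a positive factor it is the
  -- density of a finite measure. Cancelling it against its inverse below needs finiteness.
  have hfin : ∀ᵐ z : D → ℝ,
      tiltMass ν (Fintype.card D / 2) (halfQuadForm (principalSubmatrix S D) z) ≠ ⊤ := by
    have h1 : ∫⁻ z, c * tiltMass ν (Fintype.card D / 2)
        (halfQuadForm (principalSubmatrix S D) z) ≠ ⊤ := by
      rw [← setLIntegral_univ, ← withDensity_apply _ MeasurableSet.univ, ← hmap]
      exact measure_ne_top _ _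
    filter_upwards [ae_lt_top (hM.const_mul _) h1] with z hz htop
    rw [htop, ENNReal.mul_top] at hz
    · exact lt_irrefl _ hz
    · simpa [c] using gaussianConst_pos hD
  refine Measure.ext_of_lintegral _ fun F hF => ?_
  set H : (D → ℝ) → ℝ → ℝ≥0∞ := fun z w => ∫⁻ e, F (z, reconstruct D u v z w e) ∂P with hH
  have hHm : Measurable fun p : (D → ℝ) × ℝ => H p.1 p.2 := by
    refine Measurable.lintegral_prod_right' (f := fun q : ((D → ℝ) × ℝ) × (ℝ × ℝ) =>
      F (q.1.1, reconstruct D u v q.1.1 q.1.2 q.2)) ?_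
    refine hF.comp ((measurable_fst.comp measurable_fst).prodMk ?_)
    exact hrec.comp ((measurable_fst.comp measurable_fst).prodMk
      ((measurable_snd.comp measurable_fst).prodMk measurable_snd))
  have hHz : ∀ z, Measurable (H z) := fun z => hHm.comp (measurable_const.prodMk measurable_id)
  rw [lintegral_map hF (by fun_prop), Measure.lintegral_compProd hF,
    lintegral_normalScaleMixture _ _ (by fun_prop)]
  change _ = ∫⁻ z, _ ∂((normalScaleMixture S ν).map (fun x => subvector D x.ofLp))
  have hker : ∀ z, ∫⁻ y, F (z, y) ∂(pairKernel S ν D u v z) =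
      (tiltMass ν (Fintype.card D / 2) (halfQuadForm (principalSubmatrix S D) z))⁻¹ *
        ∫⁻ w, tilt (Fintype.card D / 2) (halfQuadForm (principalSubmatrix S D) z) w * H z w ∂ν :=
    fun z => by
      have hr : Measurable fun p : ℝ × (ℝ × ℝ) => reconstruct D u v z p.1 p.2 :=
        hrec.comp (measurable_const.prodMk measurable_id)
      rw [pairKernel_apply, lintegral_map (by fun_prop) hr,
        lintegral_prod _ (Measurable.aemeasurable (by fun_prop)), ← lintegral_posterior _ _ _ (hHz z)]
  simp_rw [hker]
  rw [hmap, lintegral_withDensity_eq_lintegral_mul _ (hM.const_mul _)]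
  swap
  · refine (hM.inv).mul ?_
    exact (ht.mul hHm).lintegral_prod_right'
  have hR : ∀ᵐ z : D → ℝ, ((fun z => c * tiltMass ν (Fintype.card D / 2)
      (halfQuadForm (principalSubmatrix S D) z)) * fun z =>
      (tiltMass ν (Fintype.card D / 2) (halfQuadForm (principalSubmatrix S D) z))⁻¹ *
        ∫⁻ w, tilt (Fintype.card D / 2) (halfQuadForm (principalSubmatrix S D) z) w * H z w ∂ν) z =
      ∫⁻ w, c * (tilt (Fintype.card D / 2) (halfQuadForm (principalSubmatrix S D) z) w * H z w) ∂ν := by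
    filter_upwards [hfin] with z hz
    have := hHz z
    rw [Pi.mul_apply, lintegral_const_mul _ (by fun_prop), mul_assoc c, ← mul_assoc (tiltMass _ _ _),
      ENNReal.mul_inv_cancel (tiltMass_ne_zero hpos _ _) hz, one_mul]
  rw [lintegral_congr_ae hR, lintegral_lintegral_swap (f := fun z w =>
    c * (tilt (Fintype.card D / 2) (halfQuadForm (principalSubmatrix S D) z) w * H z w))
    ((ht.mul hHm).const_mul c).aemeasurable]
  refine lintegral_congr_ae ?_
  filter_upwards [hpos] with w hw
  have hHw : Measurable fun z => H z w := hHm.comp (measurable_id.prodMk measurable_const)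
  -- For fixed `w` the weight in `z` is turned back into the Gaussian law of `Z_D / √w`;
  -- independence from the residuals then reassembles the law of `Z`.
  rw [← lintegral_smul_multivariateGaussian hD hw hHw]
  have hind := indepFun_subvector_residualPair hS.posSemidef hu.orth hv.orth
  rw [indepFun_iff_map_prod_eq_prod_map_map (by fun_prop) (by fun_prop)] at hind
  have e1 : ∫⁻ z, H ((√w)⁻¹ • z.ofLp) w ∂(multivariateGaussian 0 (principalSubmatrix S D)) =
      ∫⁻ z, H ((√w)⁻¹ • z) w ∂((multivariateGaussian 0 S).map fun x => subvector D x.ofLp) := by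
    rw [map_subvector_multivariateGaussian hS.posSemidef, lintegral_map (by fun_prop) (by fun_prop)]
  have hFm : Measurable fun q : (D → ℝ) × (ℝ × ℝ) =>
      F ((√w)⁻¹ • q.1, reconstruct D u v ((√w)⁻¹ • q.1) w q.2) := by
    refine hF.comp (Measurable.prodMk (by fun_prop) ?_)
    exact hrec.comp (Measurable.prodMk (by fun_prop) (measurable_const.prodMk measurable_snd))
  rw [e1]
  simp only [hH]
  rw [← lintegral_prod (fun q : (D → ℝ) × (ℝ × ℝ) =>
      F ((√w)⁻¹ • q.1, reconstruct D u v ((√w)⁻¹ • q.1) w q.2)) hFm.aemeasurable,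
    ← hind, lintegral_map hFm (by fun_prop)]
  refine lintegral_congr fun x => ?_
  congr 2
  have hri := hu.dotProduct_eq hi x.ofLp
  have hrj := hv.dotProduct_eq hj x.ofLp
  have hs : ∀ t : Fin d → ℝ, ∑ k : D, t k * ((√w)⁻¹ • subvector D x.ofLp) k =
      (√w)⁻¹ * ∑ k : D, t k * x.ofLp k := fun t => by
    rw [Finset.mul_sum]
    refine Finset.sum_congr rfl fun k _ => ?_
    simp only [subvector, Pi.smul_apply, smul_eq_mul]; ring
  simp only [reconstruct, residualPair, hs, hri, hrj, PiLp.smul_apply, smul_eq_mul]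
  ext <;> simp <;> ring

end Regression

/-! ### Reduction of the simplifying assumption to copulas of mixtures over posterior laws -/

section Reduction

variable {d : ℕ}

/-- The law of `e / √w` where `w` and `e` are independent with laws `ν` and `P`. -/
noncomputable def mixPair (ν : Measure ℝ) (P : Measure (ℝ × ℝ)) : Measure (ℝ × ℝ) :=
  (ν.prod P).map fun p => (√p.1)⁻¹ • p.2

/-- `C` expresses the joint distribution function of `π` by its marginal distribution functions. -/
def IsCopulaOf (C : ℝ → ℝ → ℝ) (π : Measure (ℝ × ℝ)) : Prop :=
  ∀ a b : ℝ, π.real (Iic a ×ˢ Iic b) = C (π.real (Iic a ×ˢ univ)) (π.real (univ ×ˢ Iic b))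

/-- The law of the residual pair. -/
noncomputable def residualLaw (S : Matrix (Fin d) (Fin d) ℝ) (u v : Fin d → ℝ) :
    Measure (ℝ × ℝ) := (multivariateGaussian 0 S).map (residualPair u v)

instance isProbabilityMeasure_residualLaw (S : Matrix (Fin d) (Fin d) ℝ) (u v : Fin d → ℝ) :
    IsProbabilityMeasure (residualLaw S u v) :=
  Measure.isProbabilityMeasure_map (continuous_residualPair u v).measurable.aemeasurable

lemma pairKernel_eq_map_mixPair (S : Matrix (Fin d) (Fin d) ℝ) (ν : Measure ℝ) [SFinite ν]
    (D : Finset (Fin d)) (u v : Fin d → ℝ) (z : D → ℝ) :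
    pairKernel S ν D u v z =
      (mixPair (posteriorMixing ν (Fintype.card D / 2) (halfQuadForm (principalSubmatrix S D) z))
        (residualLaw S u v)).map
        fun y => (y.1 - ∑ k : D, u k * z k, y.2 - ∑ k : D, v k * z k) := by
  rw [pairKernel_apply, mixPair, Measure.map_map (by fun_prop) (by fun_prop)]
  rfl

/-- A shift only relabels the thresholds, over all of which `IsCopulaOf` quantifies. This removes
the regression means from the conditional law, so that `z` enters through the posterior alone. -/
lemma isCopulaOf_map_sub_iff (C : ℝ → ℝ → ℝ) (π : Measure (ℝ × ℝ)) (s t : ℝ) :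
    IsCopulaOf C (π.map fun y => (y.1 - s, y.2 - t)) ↔ IsCopulaOf C π := by
  have hm : Measurable fun y : ℝ × ℝ => (y.1 - s, y.2 - t) := by fun_prop
  have h1 : ∀ a b : ℝ, (fun y : ℝ × ℝ => (y.1 - s, y.2 - t)) ⁻¹' (Iic a ×ˢ Iic b) =
      Iic (a + s) ×ˢ Iic (b + t) := fun a b => by
    ext y; simp [Prod.le_def]
  have h2 : ∀ a : ℝ, (fun y : ℝ × ℝ => (y.1 - s, y.2 - t)) ⁻¹' (Iic a ×ˢ univ) =
      Iic (a + s) ×ˢ univ := fun a => by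
    ext y; simp
  have h3 : ∀ b : ℝ, (fun y : ℝ × ℝ => (y.1 - s, y.2 - t)) ⁻¹' (univ ×ˢ Iic b) =
      univ ×ˢ Iic (b + t) := fun b => by
    ext y; simp
  unfold IsCopulaOf
  simp_rw [map_measureReal_apply hm (measurableSet_Iic.prod measurableSet_Iic),
    map_measureReal_apply hm (measurableSet_Iic.prod MeasurableSet.univ),
    map_measureReal_apply hm (MeasurableSet.univ.prod measurableSet_Iic), h1, h2, h3]
  refine ⟨fun h a b => ?_, fun h a b => h _ _⟩
  have := h (a - s) (b - t)
  simpa using this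

/-- The simplifying assumption for one edge, in terms of the posterior distributions of the mixing
variable. -/
theorem hasConstantConditionalCopula_normalScaleMixture_iff {S : Matrix (Fin d) (Fin d) ℝ}
    (hS : S.PosDef) {ν : Measure ℝ} [IsProbabilityMeasure ν] (hpos : ∀ᵐ w ∂ν, 0 < w)
    {D : Finset (Fin d)} {i j : Fin d} (hi : i ∉ D) (hj : j ∉ D) {u v : Fin d → ℝ}
    (hu : IsResidualVector S D i u) (hv : IsResidualVector S D j v) :
    HasConstantConditionalCopula (normalScaleMixture S ν) i j D ↔
      ∃ C, IsBivariateCopula C ∧ ∀ᵐ z : D → ℝ, IsCopulaOf C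
        (mixPair (posteriorMixing ν (Fintype.card D / 2)
          (halfQuadForm (principalSubmatrix S D) z)) (residualLaw S u v)) := by
  unfold HasConstantConditionalCopula
  refine exists_congr fun C => and_congr_right fun _ => ?_
  have hpair := condDistrib_pair_normalScaleMixture hS hpos hi hj hu hv
  have hfst := condDistrib_comp (μ := normalScaleMixture S ν)
    (fun (x : EuclideanSpace ℝ (Fin d)) (k : D) => x k)
    (Y := fun x : EuclideanSpace ℝ (Fin d) => (x i, x j)) (mβ := MeasurableSpace.pi)
    (by fun_prop) measurable_fst
  have hsnd := condDistrib_comp (μ := normalScaleMixture S ν)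
    (fun (x : EuclideanSpace ℝ (Fin d)) (k : D) => x k)
    (Y := fun x : EuclideanSpace ℝ (Fin d) => (x i, x j)) (mβ := MeasurableSpace.pi)
    (by fun_prop) measurable_snd
  have hiff : ∀ᵐ z ∂((normalScaleMixture S ν).map fun x (k : D) => x k),
      ((∀ a b : ℝ, (condDistrib (fun x => (x i, x j)) (fun x (k : D) => x k)
          (normalScaleMixture S ν) z).real (Iic a ×ˢ Iic b) =
          C ((condDistrib (fun x => x i) (fun x (k : D) => x k)
              (normalScaleMixture S ν) z).real (Iic a))
            ((condDistrib (fun x => x j) (fun x (k : D) => x k)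
              (normalScaleMixture S ν) z).real (Iic b))) ↔
        IsCopulaOf C (mixPair (posteriorMixing ν (Fintype.card D / 2)
          (halfQuadForm (principalSubmatrix S D) z)) (residualLaw S u v))) := by
    filter_upwards [hpair, hfst, hsnd] with z h1 h2 h3
    rw [Kernel.map_apply _ measurable_fst, h1] at h2
    rw [Kernel.map_apply _ measurable_snd, h1] at h3
    rw [← isCopulaOf_map_sub_iff C _ (∑ k : D, u k * z k) (∑ k : D, v k * z k),
      ← pairKernel_eq_map_mixPair]
    refine forall_congr' fun a => forall_congr' fun b => ?_
    have e1 : (condDistrib (fun x : EuclideanSpace ℝ (Fin d) => x i) (fun x (k : D) => x k)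
        (normalScaleMixture S ν) z).real (Iic a) = (pairKernel S ν D u v z).real (Iic a ×ˢ univ) := by
      rw [prod_univ, ← map_measureReal_apply measurable_fst measurableSet_Iic, ← h2]
      rfl
    have e2 : (condDistrib (fun x : EuclideanSpace ℝ (Fin d) => x j) (fun x (k : D) => x k)
        (normalScaleMixture S ν) z).real (Iic b) = (pairKernel S ν D u v z).real (univ ×ˢ Iic b) := by
      rw [univ_prod, ← map_measureReal_apply measurable_snd measurableSet_Iic, ← h3]
      rfl
    rw [h1, e1, e2]
  rw [eventually_congr hiff]
  change (∀ᵐ z ∂((normalScaleMixture S ν).map fun x => subvector D x.ofLp), _) ↔ _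
  have hM : Measurable fun z => tiltMass ν (Fintype.card D / 2)
      (halfQuadForm (principalSubmatrix S D) z) :=
    (measurable_tiltMass ν _).comp (continuous_halfQuadForm _).measurable
  rw [map_subvector_normalScaleMixture hS hpos, ae_withDensity_iff (hM.const_mul _)]
  refine eventually_congr (Eventually.of_forall fun z => ?_)
  -- The density of the conditioning variables vanishes nowhere, so almost everywhere for their law
  -- is Lebesgue almost everywhere.
  have hne : ENNReal.ofReal (gaussianConst (principalSubmatrix S D)) *
      tiltMass ν (Fintype.card D / 2) (halfQuadForm (principalSubmatrix S D) z) ≠ 0 :=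
    mul_ne_zero (by simpa using gaussianConst_pos (posDef_principalSubmatrix hS D))
      (tiltMass_ne_zero hpos _ _)
  simp only [hne, ne_eq, not_false_eq_true, true_implies]

end Reduction

/-! ### Existence of copulas and the gamma case -/

section Sklar

lemma continuous_measureReal_Iic (μ : Measure ℝ) [IsProbabilityMeasure μ] [NullSingletonClass μ] :
    Continuous fun x => μ.real (Iic x) := by
  refine continuous_iff_continuousAt.2 fun x => ?_
  have h : (cdf μ).measure {x} = 0 := by rw [measure_cdf]; exact measure_singleton x
  rw [StieltjesFunction.measure_singleton, ENNReal.ofReal_eq_zero] at h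
  have hc : ContinuousAt (cdf μ) x := by
    rw [(cdf μ).mono.continuousAt_iff_leftLim_eq_rightLim, StieltjesFunction.rightLim_eq]
    exact le_antisymm ((cdf μ).mono.leftLim_le le_rfl) (by linarith)
  have he : (fun x => μ.real (Iic x)) = cdf μ := funext fun x => (cdf_eq_real μ x).symm
  rw [he]
  exact hc

lemma strictMono_measureReal_Iic (μ : Measure ℝ) [IsProbabilityMeasure μ]
    [μ.IsOpenPosMeasure] : StrictMono fun x => μ.real (Iic x) := by
  intro x y hxy
  have h : μ.real (Iic y) = μ.real (Iic x) + μ.real (Ioc x y) := by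
    rw [← measureReal_union (Iic_disjoint_Ioc le_rfl) measurableSet_Ioc, Iic_union_Ioc_eq_Iic hxy.le]
  have h2 : 0 < μ.real (Ioc x y) := by
    refine ENNReal.toReal_pos ?_ (measure_ne_top _ _)
    exact (((Measure.measure_Ioo_pos μ).2 hxy).trans_le (measure_mono Ioo_subset_Ioc_self)).ne'
  simp only
  linarith

/-- The probability integral transform. -/
lemma map_measureReal_Iic (μ : Measure ℝ) [IsProbabilityMeasure μ] [NullSingletonClass μ]
    [μ.IsOpenPosMeasure] :
    μ.map (fun x => μ.real (Iic x)) = volume.restrict (Icc 0 1) := by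
  have hc := continuous_measureReal_Iic μ
  have hs := strictMono_measureReal_Iic μ
  have : IsProbabilityMeasure (volume.restrict (Icc (0 : ℝ) 1)) := ⟨by simp⟩
  have : IsProbabilityMeasure (μ.map (fun x => μ.real (Iic x))) :=
    Measure.isProbabilityMeasure_map hc.measurable.aemeasurable
  have hbot : Tendsto (fun x => μ.real (Iic x)) atBot (𝓝 0) := by
    simpa only [cdf_eq_real] using (tendsto_cdf_atBot μ).congr fun x => cdf_eq_real μ x
  have htop : Tendsto (fun x => μ.real (Iic x)) atTop (𝓝 1) := by
    simpa only [cdf_eq_real] using (tendsto_cdf_atTop μ).congr fun x => cdf_eq_real μ x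
  refine Measure.ext_of_Iic _ _ fun t => ?_
  rw [Measure.map_apply hc.measurable measurableSet_Iic, Measure.restrict_apply measurableSet_Iic]
  rcases le_or_gt t 0 with ht | ht
  · have h1 : (fun x => μ.real (Iic x)) ⁻¹' Iic t = ∅ := by
      ext x
      simp only [mem_preimage, mem_Iic, mem_empty_iff_false, iff_false, not_le]
      exact ht.trans_lt (measureReal_nonneg.trans_lt (hs (sub_one_lt x)))
    have h2 : volume (Iic t ∩ Icc 0 1) = 0 := by
      refine measure_mono_null (t := {0}) (fun x hx => ?_) (by simp)
      exact le_antisymm (hx.1.trans ht) hx.2.1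
    rw [h1, h2, measure_empty]
  rcases le_or_gt 1 t with ht1 | ht1
  · have h1 : (fun x => μ.real (Iic x)) ⁻¹' Iic t = univ := by
      ext x
      simp only [mem_preimage, mem_Iic, mem_univ, iff_true]
      exact measureReal_le_one.trans ht1
    have h2 : Iic t ∩ Icc 0 1 = Icc (0 : ℝ) 1 :=
      inter_eq_right.2 fun x hx => hx.2.trans ht1
    rw [h1, h2, measure_univ]
    simp
  · obtain ⟨x, hx⟩ : ∃ x, μ.real (Iic x) = t := by
      obtain ⟨a, ha⟩ := (hbot.eventually (gt_mem_nhds ht)).exists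
      obtain ⟨b, hb⟩ := (htop.eventually (lt_mem_nhds ht1)).exists
      exact mem_range_of_exists_le_of_exists_ge hc ⟨a, ha.le⟩ ⟨b, hb.le⟩
    have h1 : (fun x => μ.real (Iic x)) ⁻¹' Iic t = Iic x := by
      ext y
      simp only [mem_preimage, mem_Iic, ← hx]
      exact hs.le_iff_le
    have h2 : Iic t ∩ Icc 0 1 = Icc (0 : ℝ) t := by
      ext y
      simp only [mem_inter_iff, mem_Iic, mem_Icc]
      exact ⟨fun h => ⟨h.2.1, h.1⟩, fun h => ⟨h.2, h.1, h.2.trans ht1.le⟩⟩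
    rw [h1, h2, Real.volume_Icc, sub_zero, ← hx, ofReal_measureReal]

/-- Sklar's theorem for marginal distribution functions that are continuous and strictly
increasing. -/
theorem exists_isCopulaOf (π : Measure (ℝ × ℝ)) [IsProbabilityMeasure π]
    [NullSingletonClass (π.map Prod.fst)] [NullSingletonClass (π.map Prod.snd)]
    [(π.map Prod.fst).IsOpenPosMeasure] [(π.map Prod.snd).IsOpenPosMeasure] :
    ∃ C, IsBivariateCopula C ∧ IsCopulaOf C π := by
  have i₁ : IsProbabilityMeasure (π.map Prod.fst) :=
    Measure.isProbabilityMeasure_map measurable_fst.aemeasurable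
  have i₂ : IsProbabilityMeasure (π.map Prod.snd) :=
    Measure.isProbabilityMeasure_map measurable_snd.aemeasurable
  set F := fun x => (π.map Prod.fst).real (Iic x) with hF
  set G := fun x => (π.map Prod.snd).real (Iic x) with hG
  have hFm : Measurable F := (continuous_measureReal_Iic _).measurable
  have hGm : Measurable G := (continuous_measureReal_Iic _).measurable
  have hFs : StrictMono F := strictMono_measureReal_Iic _
  have hGs : StrictMono G := strictMono_measureReal_Iic _
  have hm : Measurable (Prod.map F G) := hFm.prodMap hGm
  -- The copula is the distribution function of `(F X, G Y)` for `(X, Y)` with law `π`: the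
  -- probability integral transform makes the margins uniform, and strict monotonicity turns `F X ≤
  -- F a` into `X ≤ a`.
  refine ⟨fun u v => (π.map (Prod.map F G)).real (Iic u ×ˢ Iic v),
    ⟨π.map (Prod.map F G), Measure.isProbabilityMeasure_map hm.aemeasurable, ?_, ?_,
      fun _ _ => rfl⟩, fun a b => ?_⟩
  · rw [Measure.map_map measurable_fst hm, ← map_measureReal_Iic (π.map Prod.fst),
      Measure.map_map hFm measurable_fst]
    rfl
  · rw [Measure.map_map measurable_snd hm, ← map_measureReal_Iic (π.map Prod.snd),
      Measure.map_map hGm measurable_snd]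
    rfl
  · have e1 : π.real (Iic a ×ˢ univ) = F a := by
      rw [hF, prod_univ]
      exact (map_measureReal_apply measurable_fst measurableSet_Iic).symm
    have e2 : π.real (univ ×ˢ Iic b) = G b := by
      rw [hG, univ_prod]
      exact (map_measureReal_apply measurable_snd measurableSet_Iic).symm
    rw [e1, e2]
    simp only
    rw [map_measureReal_apply hm (measurableSet_Iic.prod measurableSet_Iic)]
    congr 1
    ext ⟨x, y⟩
    simp [hFs.le_iff_le, hGs.le_iff_le]

lemma IsCopulaOf.map_scale {C : ℝ → ℝ → ℝ} {π : Measure (ℝ × ℝ)} (h : IsCopulaOf C π) {s t : ℝ}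
    (hs : 0 < s) (ht : 0 < t) : IsCopulaOf C (π.map fun y => (s * y.1, t * y.2)) := by
  have hm : Measurable fun y : ℝ × ℝ => (s * y.1, t * y.2) := by fun_prop
  have h0 : ∀ {c : ℝ}, 0 < c → ∀ a x : ℝ, c * x ≤ a ↔ x ≤ a / c := fun hc a x => by
    rw [le_div_iff₀ hc, mul_comm]
  intro a b
  have h1 : (fun y : ℝ × ℝ => (s * y.1, t * y.2)) ⁻¹' (Iic a ×ˢ Iic b) =
      Iic (a / s) ×ˢ Iic (b / t) := by
    ext y; simp only [mem_preimage, mem_prod, mem_Iic, h0 hs, h0 ht]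
  have h2 : (fun y : ℝ × ℝ => (s * y.1, t * y.2)) ⁻¹' (Iic a ×ˢ univ) = Iic (a / s) ×ˢ univ := by
    ext y; simp only [mem_preimage, mem_prod, mem_Iic, h0 hs, mem_univ]
  have h3 : (fun y : ℝ × ℝ => (s * y.1, t * y.2)) ⁻¹' (univ ×ˢ Iic b) = univ ×ˢ Iic (b / t) := by
    ext y; simp only [mem_preimage, mem_prod, mem_Iic, h0 ht, mem_univ]
  rw [map_measureReal_apply hm (measurableSet_Iic.prod measurableSet_Iic),
    map_measureReal_apply hm (measurableSet_Iic.prod MeasurableSet.univ),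
    map_measureReal_apply hm (MeasurableSet.univ.prod measurableSet_Iic), h1, h2, h3]
  exact h _ _

lemma nullSingletonClass_map_inv_sqrt_mul {ν η : Measure ℝ} [SFinite ν] [SFinite η] [NullSingletonClass η]
    (hpos : ∀ᵐ w ∂ν, 0 < w) : NullSingletonClass ((ν.prod η).map fun p => (√p.1)⁻¹ * p.2) := by
  refine ⟨fun a => ?_⟩
  have hm : Measurable fun p : ℝ × ℝ => (√p.1)⁻¹ * p.2 := by fun_prop
  rw [Measure.map_apply hm (measurableSet_singleton a),
    Measure.measure_prod_null (hm (measurableSet_singleton a))]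
  filter_upwards [hpos] with w hw
  have hw' : 0 < √w := Real.sqrt_pos.2 hw
  refine measure_mono_null (t := {√w * a}) (fun x hx => ?_) (measure_singleton _)
  simp only [mem_preimage, mem_singleton_iff] at hx ⊢
  rw [← hx]; field_simp

lemma isOpenPosMeasure_map_inv_sqrt_mul {ν η : Measure ℝ} [NeZero ν] [SFinite ν] [SFinite η]
    [η.IsOpenPosMeasure] (hpos : ∀ᵐ w ∂ν, 0 < w) :
    ((ν.prod η).map fun p => (√p.1)⁻¹ * p.2).IsOpenPosMeasure := by
  refine ⟨fun U hU hne h0 => ?_⟩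
  have hm : Measurable fun p : ℝ × ℝ => (√p.1)⁻¹ * p.2 := by fun_prop
  rw [Measure.map_apply hm hU.measurableSet,
    Measure.measure_prod_null (hm hU.measurableSet)] at h0
  have : ∀ᵐ w ∂ν, False := by
    filter_upwards [h0, hpos] with w h1 hw
    have hw' : 0 < √w := Real.sqrt_pos.2 hw
    obtain ⟨y, hy⟩ := hne
    have ho : IsOpen ((fun x : ℝ => (√w)⁻¹ * x) ⁻¹' U) := hU.preimage (by fun_prop)
    refine ho.measure_ne_zero η ⟨√w * y, ?_⟩ h1
    simp only [mem_preimage]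
    rwa [inv_mul_cancel_left₀ hw'.ne']
  simp only [eventually_false_iff_eq_bot, ae_eq_bot] at this
  exact NeZero.ne ν this

lemma mixPair_map_fst (ν : Measure ℝ) (P : Measure (ℝ × ℝ)) [SFinite ν] [IsFiniteMeasure P] :
    (mixPair ν P).map Prod.fst = (ν.prod (P.map Prod.fst)).map fun p => (√p.1)⁻¹ * p.2 := by
  have h : ν.prod (P.map Prod.fst) = (ν.prod P).map (Prod.map id Prod.fst) := by
    rw [← Measure.map_prod_map _ _ measurable_id measurable_fst, Measure.map_id]
  rw [h, mixPair, Measure.map_map (by fun_prop) (by fun_prop),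
    Measure.map_map (by fun_prop) (by fun_prop)]
  rfl

lemma mixPair_map_snd (ν : Measure ℝ) (P : Measure (ℝ × ℝ)) [SFinite ν] [IsFiniteMeasure P] :
    (mixPair ν P).map Prod.snd = (ν.prod (P.map Prod.snd)).map fun p => (√p.1)⁻¹ * p.2 := by
  have h : ν.prod (P.map Prod.snd) = (ν.prod P).map (Prod.map id Prod.snd) := by
    rw [← Measure.map_prod_map _ _ measurable_id measurable_snd, Measure.map_id]
  rw [h, mixPair, Measure.map_map (by fun_prop) (by fun_prop),
    Measure.map_map (by fun_prop) (by fun_prop)]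
  rfl

/-- For each `w > 0` the coordinates of `e / √w` are nondegenerate normal; mixing over `w` keeps the
margins free of atoms and of full support, as needed for continuous and strictly increasing
distribution functions. -/
lemma exists_isCopulaOf_mixPair {ν : Measure ℝ} [IsProbabilityMeasure ν] (hpos : ∀ᵐ w ∂ν, 0 < w)
    {P : Measure (ℝ × ℝ)} [IsProbabilityMeasure P] {s t : NNReal} (hs : s ≠ 0) (ht : t ≠ 0)
    (h₁ : P.map Prod.fst = gaussianReal 0 s) (h₂ : P.map Prod.snd = gaussianReal 0 t) :
    ∃ C, IsBivariateCopula C ∧ IsCopulaOf C (mixPair ν P) := by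
  have o₁ : (gaussianReal 0 s).IsOpenPosMeasure :=
    (gaussianReal_absolutelyContinuous' 0 hs).isOpenPosMeasure
  have o₂ : (gaussianReal 0 t).IsOpenPosMeasure :=
    (gaussianReal_absolutelyContinuous' 0 ht).isOpenPosMeasure
  have a₁ := nullSingletonClass_gaussianReal (μ := 0) hs
  have a₂ := nullSingletonClass_gaussianReal (μ := 0) ht
  have : IsProbabilityMeasure (mixPair ν P) := Measure.isProbabilityMeasure_map (by fun_prop)
  have : NullSingletonClass ((mixPair ν P).map Prod.fst) := by
    rw [mixPair_map_fst, h₁]; exact nullSingletonClass_map_inv_sqrt_mul hpos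
  have : NullSingletonClass ((mixPair ν P).map Prod.snd) := by
    rw [mixPair_map_snd, h₂]; exact nullSingletonClass_map_inv_sqrt_mul hpos
  have : ((mixPair ν P).map Prod.fst).IsOpenPosMeasure := by
    rw [mixPair_map_fst, h₁]; exact isOpenPosMeasure_map_inv_sqrt_mul hpos
  have : ((mixPair ν P).map Prod.snd).IsOpenPosMeasure := by
    rw [mixPair_map_snd, h₂]; exact isOpenPosMeasure_map_inv_sqrt_mul hpos
  exact exists_isCopulaOf (mixPair ν P)

end Sklar

/-! ### Gamma mixing distributions -/

section GammaMixing

lemma ae_pos_gammaMeasure (a r : ℝ) : ∀ᵐ w ∂(gammaMeasure a r), 0 < w := by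
  rw [gammaMeasure_eq_withDensity_Ioi]
  exact (withDensity_absolutelyContinuous _ _).ae_le (ae_restrict_mem measurableSet_Ioi)

lemma lintegral_gammaMeasure (a r : ℝ) {F : ℝ → ℝ≥0∞} (hF : Measurable F) :
    ∫⁻ w, F w ∂(gammaMeasure a r) = ∫⁻ w in Ioi 0,
      ENNReal.ofReal (r ^ a / Real.Gamma a * (w ^ (a - 1) * Real.exp (-(r * w)))) * F w := by
  rw [gammaMeasure_eq_withDensity_Ioi, lintegral_withDensity_eq_lintegral_mul _ (by fun_prop) hF]
  rfl

instance sFinite_gammaMeasure (a r : ℝ) : SFinite (gammaMeasure a r) := by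
  unfold gammaMeasure; infer_instance

lemma tiltMass_gammaMeasure {p b : ℝ} (hp : 0 < p) (hb : 0 < b) {α θ : ℝ} (hα : 0 ≤ α)
    (hθ : 0 ≤ θ) : tiltMass (gammaMeasure p b) α θ =
      ENNReal.ofReal (b ^ p / Real.Gamma p * ((1 / (b + θ)) ^ (p + α) * Real.Gamma (p + α))) := by
  have hΓ := Real.Gamma_pos_of_pos hp
  rw [tiltMass, lintegral_gammaMeasure _ _ (by fun_prop), ENNReal.ofReal_mul (by positivity),
    ← lintegral_Ioi_rpow_mul_exp_neg (by linarith) (by linarith), ← lintegral_const_mul _ (by fun_prop)]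
  refine setLIntegral_congr_fun measurableSet_Ioi fun w hw => ?_
  have hw : 0 < w := hw
  simp only [tilt]
  rw [← ENNReal.ofReal_mul (by positivity), ← ENNReal.ofReal_mul (by positivity)]
  congr 1
  rw [show p + α - 1 = (p - 1) + α by ring, Real.rpow_add hw,
    show -((b + θ) * w) = -(b * w) + -(θ * w) by ring, Real.exp_add]
  ring

/-- Conjugacy: the weight adds `α` to the shape and `θ` to the rate. Of the two parameters only the
rate feels the conditioning value. -/
lemma posteriorMixing_gammaMeasure {p b : ℝ} (hp : 0 < p) (hb : 0 < b) {α θ : ℝ} (hα : 0 ≤ α)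
    (hθ : 0 ≤ θ) : posteriorMixing (gammaMeasure p b) α θ = gammaMeasure (p + α) (b + θ) := by
  have hΓ := Real.Gamma_pos_of_pos hp
  have hΓ' := Real.Gamma_pos_of_pos (show 0 < p + α by linarith)
  have hbθ : 0 < b + θ := by linarith
  refine Measure.ext_of_lintegral _ fun F hF => ?_
  rw [lintegral_posterior _ _ _ hF, lintegral_gammaMeasure _ _ (by fun_prop),
    lintegral_gammaMeasure _ _ hF, tiltMass_gammaMeasure hp hb hα hθ,
    ← lintegral_const_mul _ (by fun_prop)]
  refine setLIntegral_congr_fun measurableSet_Ioi fun w hw => ?_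
  have hw : 0 < w := hw
  simp only [tilt]
  rw [← ENNReal.ofReal_inv_of_pos (by positivity), ← mul_assoc, ← mul_assoc,
    ← ENNReal.ofReal_mul (by positivity), ← ENNReal.ofReal_mul (by positivity)]
  congr 2
  rw [show p + α - 1 = (p - 1) + α by ring, Real.rpow_add hw,
    show -((b + θ) * w) = -(b * w) + -(θ * w) by ring, Real.exp_add,
    Real.div_rpow zero_le_one hbθ.le, Real.one_rpow]
  have : 0 < (b + θ) ^ (p + α) := by positivity
  have : 0 < b ^ p := by positivity
  field_simp

lemma gammaMeasure_eq_map {a r : ℝ} (ha : 0 < a) (hr : 0 < r) :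
    gammaMeasure a r = (gammaMeasure a 1).map fun w => r⁻¹ * w := by
  have hΓ := Real.Gamma_pos_of_pos ha
  have hm : Measurable fun w : ℝ => r⁻¹ * w := by fun_prop
  refine Measure.ext_of_lintegral _ fun F hF => ?_
  rw [lintegral_map hF hm, lintegral_gammaMeasure _ _ hF, lintegral_gammaMeasure (F := fun w => F (r⁻¹ * w)) _ _ (hF.comp hm)]
  set G : ℝ → ℝ≥0∞ := fun w => (Ioi 0).indicator (fun w => ENNReal.ofReal
    (r ^ a / Real.Gamma a * (w ^ (a - 1) * Real.exp (-(r * w)))) * F w) w with hG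
  have hGm : Measurable G := Measurable.indicator (by fun_prop) measurableSet_Ioi
  have h1 := Real.map_volume_mul_left (a := r⁻¹) (by positivity)
  have h2 : ∫⁻ w, G (r⁻¹ * w) = ENNReal.ofReal r * ∫⁻ w, G w := by
    rw [← lintegral_map hGm hm, h1, lintegral_smul_measure, inv_inv, abs_of_pos hr, smul_eq_mul]
  have hr' : ENNReal.ofReal r ≠ 0 := by simpa using hr
  have h3 : ∫⁻ w, G w = (ENNReal.ofReal r)⁻¹ * ∫⁻ w, G (r⁻¹ * w) := by
    rw [h2, ← mul_assoc, ENNReal.inv_mul_cancel hr' ENNReal.ofReal_ne_top, one_mul]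
  have h4 : ∫⁻ w in Ioi 0, ENNReal.ofReal
      (r ^ a / Real.Gamma a * (w ^ (a - 1) * Real.exp (-(r * w)))) * F w = ∫⁻ w, G w :=
    (lintegral_indicator measurableSet_Ioi _).symm
  rw [h4, h3, ← lintegral_const_mul (f := fun w => G (r⁻¹ * w)) _ (hGm.comp hm),
    ← lintegral_indicator measurableSet_Ioi]
  refine lintegral_congr fun w => ?_
  by_cases hw : 0 < w
  · have hw' : r⁻¹ * w ∈ Ioi (0 : ℝ) := by simp only [mem_Ioi]; positivity
    simp only [hG]
    rw [indicator_of_mem hw', indicator_of_mem (show w ∈ Ioi 0 from hw), ← mul_assoc,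
      ← ENNReal.ofReal_inv_of_pos hr, ← ENNReal.ofReal_mul (by positivity)]
    congr 2
    rw [Real.one_rpow, Real.mul_rpow (by positivity) hw.le, Real.inv_rpow hr.le,
      Real.rpow_sub_one hr.ne', mul_inv_cancel_left₀ hr.ne', one_mul]
    have : 0 < r ^ a := by positivity
    field_simp
  · have hw' : r⁻¹ * w ∉ Ioi (0 : ℝ) := by
      simp only [mem_Ioi, not_lt]
      exact mul_nonpos_of_nonneg_of_nonpos (by positivity) (not_lt.1 hw)
    simp only [hG]
    rw [indicator_of_notMem hw', indicator_of_notMem (show w ∉ Ioi 0 from hw), mul_zero]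

/-- A Gamma variable of rate `r` is `r⁻¹` times one of rate 1, so the rate acts on the pair as a
scaling, which copulas ignore. -/
lemma mixPair_gammaMeasure {a r : ℝ} (ha : 0 < a) (hr : 0 < r) (P : Measure (ℝ × ℝ))
    [IsProbabilityMeasure P] :
    mixPair (gammaMeasure a r) P = (mixPair (gammaMeasure a 1) P).map fun y => √r • y := by
  have := isProbabilityMeasure_gammaMeasure ha one_pos
  have h : (gammaMeasure a r).prod P =
      ((gammaMeasure a 1).prod P).map (Prod.map (fun w => r⁻¹ * w) id) := by
    rw [gammaMeasure_eq_map ha hr, ← Measure.map_prod_map _ _ (by fun_prop) measurable_id,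
      Measure.map_id]
  rw [mixPair, mixPair, h, Measure.map_map (by fun_prop) (by fun_prop),
    Measure.map_map (by fun_prop) (by fun_prop)]
  congr 1
  ext p : 1
  simp only [Function.comp_apply, Prod.map_fst, Prod.map_snd, id]
  rw [Real.sqrt_mul (by positivity), Real.sqrt_inv, mul_inv, inv_inv, mul_smul]

variable {d : ℕ}

lemma residualLaw_map_fst {S : Matrix (Fin d) (Fin d) ℝ} (hS : S.PosSemidef) (u v : Fin d → ℝ)
    (hR : (residualCov S u v).PosSemidef) :
    (residualLaw S u v).map Prod.fst = gaussianReal 0 (residualCov S u v 0 0).toNNReal := by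
  rw [residualLaw, map_residualPair_multivariateGaussian hS,
    Measure.map_map measurable_fst (by fun_prop)]
  exact (measurePreserving_eval_multivariateGaussian (μ := 0) hR (i := 0)).map_eq

lemma residualLaw_map_snd {S : Matrix (Fin d) (Fin d) ℝ} (hS : S.PosSemidef) (u v : Fin d → ℝ)
    (hR : (residualCov S u v).PosSemidef) :
    (residualLaw S u v).map Prod.snd = gaussianReal 0 (residualCov S u v 1 1).toNNReal := by
  rw [residualLaw, map_residualPair_multivariateGaussian hS,
    Measure.map_map measurable_snd (by fun_prop)]
  exact (measurePreserving_eval_multivariateGaussian (μ := 0) hR (i := 1)).map_eq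

/-- Gamma scale mixtures of Normals satisfy the simplifying assumption for all conditional
copulas of pairs. -/
theorem hasConstantConditionalCopula_gamma {S : Matrix (Fin d) (Fin d) ℝ} (hS : S.PosDef)
    {p b : ℝ} (hp : 0 < p) (hb : 0 < b) [IsProbabilityMeasure (gammaMeasure p b)]
    {D : Finset (Fin d)} {i j : Fin d} (hij : i ≠ j)
    (hi : i ∉ D) (hj : j ∉ D) :
    HasConstantConditionalCopula (normalScaleMixture S (gammaMeasure p b)) i j D := by
  obtain ⟨u, hu⟩ := exists_isResidualVector hS hi
  obtain ⟨v, hv⟩ := exists_isResidualVector hS hj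
  rw [hasConstantConditionalCopula_normalScaleMixture_iff hS (ae_pos_gammaMeasure p b) hi hj hu hv]
  have hR := posDef_residualCov hS hij hi hj hu hv
  set α : ℝ := (Fintype.card D : ℝ) / 2
  have hα : 0 ≤ α := by positivity
  have := isProbabilityMeasure_gammaMeasure (show 0 < p + α by linarith) one_pos
  -- The copula at rate 1 serves all values of `z`.
  obtain ⟨C, hC, hCπ⟩ := exists_isCopulaOf_mixPair (ae_pos_gammaMeasure (p + α) 1)
    (P := residualLaw S u v) (by simpa using hR.diag_pos) (by simpa using hR.diag_pos)
    (residualLaw_map_fst hS.posSemidef u v hR.posSemidef)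
    (residualLaw_map_snd hS.posSemidef u v hR.posSemidef)
  refine ⟨C, hC, ae_of_all _ fun z => ?_⟩
  have hq := halfQuadForm_nonneg (posDef_principalSubmatrix hS D) z
  rw [posteriorMixing_gammaMeasure hp hb hα hq, mixPair_gammaMeasure (by linarith) (by linarith)]
  exact hCπ.map_scale (Real.sqrt_pos.2 (by linarith)) (Real.sqrt_pos.2 (by linarith))

/-- Gamma scale mixtures of Normals are Student-t distributions. -/
theorem normalScaleMixture_gammaMeasure {S : Matrix (Fin d) (Fin d) ℝ} (hS : S.PosDef)
    {p b : ℝ} (hp : 0 < p) (hb : 0 < b) :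
    normalScaleMixture S (gammaMeasure p b) = multivariateStudentT (2 * p) ((b / p) • S) := by
  have := isProbabilityMeasure_gammaMeasure hp hb
  have hΓ := Real.Gamma_pos_of_pos hp
  have hdet := hS.det_pos
  have hΓ' := Real.Gamma_pos_of_pos (show 0 < p + (d : ℝ) / 2 by positivity)
  have hq := (continuous_halfQuadForm S).measurable
  have ht : Measurable fun q : (Fin d → ℝ) × ℝ => tilt (Fintype.card (Fin d) / 2)
      (halfQuadForm S q.1) q.2 :=
    (measurable_tilt_uncurry _).comp ((hq.comp measurable_fst).prodMk measurable_snd)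
  have hd : Measurable fun x : EuclideanSpace ℝ (Fin d) => ENNReal.ofReal
      (Real.Gamma ((2 * p + d) / 2) / (Real.Gamma (2 * p / 2) * (2 * p * Real.pi) ^ ((d : ℝ) / 2) *
        √((b / p) • S).det) *
      (1 + (x.ofLp ⬝ᵥ ((b / p) • S)⁻¹.mulVec x.ofLp) / (2 * p)) ^ (-((2 * p + d) / 2))) := by
    have : Continuous fun x : EuclideanSpace ℝ (Fin d) =>
      x.ofLp ⬝ᵥ ((b / p) • S)⁻¹.mulVec x.ofLp := by fun_prop
    fun_prop
  refine Measure.ext_of_lintegral _ fun F hF => ?_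
  rw [lintegral_normalScaleMixture _ _ hF, multivariateStudentT,
    lintegral_withDensity_eq_lintegral_mul _ hd hF,
    ← (PiLp.volume_preserving_toLp (Fin d)).lintegral_comp (by fun_prop)]
  have h1 : ∀ᵐ w ∂(gammaMeasure p b), ∫⁻ x, F ((√w)⁻¹ • x) ∂(multivariateGaussian 0 S) =
      ∫⁻ v : Fin d → ℝ, ENNReal.ofReal (gaussianConst S) *
        (tilt (Fintype.card (Fin d) / 2) (halfQuadForm S v) w * F (WithLp.toLp 2 v)) := by
    filter_upwards [ae_pos_gammaMeasure p b] with w hw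
    rw [← lintegral_smul_multivariateGaussian hS hw (F := fun v => F (WithLp.toLp 2 v))
      (by fun_prop)]
    rfl
  rw [lintegral_congr_ae h1, lintegral_lintegral_swap]
  swap
  · refine Measurable.aemeasurable ?_
    refine Measurable.const_mul (Measurable.mul ?_ (by fun_prop)) _
    exact ht.comp measurable_swap
  refine lintegral_congr fun z => ?_
  have hz := halfQuadForm_nonneg hS z
  rw [lintegral_const_mul _ (by fun_prop), lintegral_mul_const _ (by fun_prop), Pi.mul_apply,
    ← mul_assoc]
  congr 1
  -- Integrating out `w` gives a multiple of `(b + halfQuadForm S z) ^ (-(p + d/2))`, the Student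
  -- kernel with `2 p` degrees of freedom; what remains is matching constants.
  change _ * tiltMass (gammaMeasure p b) _ _ = _
  rw [tiltMass_gammaMeasure hp hb (by positivity) hz,
    ← ENNReal.ofReal_mul (gaussianConst_pos hS).le]
  congr 1
  have hinv : ((b / p) • S)⁻¹ = (p / b) • S⁻¹ := by
    refine Matrix.inv_eq_left_inv ?_
    rw [smul_mul_smul_comm, Matrix.nonsing_inv_mul _ (isUnit_iff_ne_zero.2 hdet.ne'),
      div_mul_div_cancel₀ hb.ne', div_self hp.ne', one_smul]
  have hquad : 1 + (z ⬝ᵥ ((b / p) • S)⁻¹.mulVec z) / (2 * p) = (b + halfQuadForm S z) / b := by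
    rw [hinv, Matrix.smul_mulVec, dotProduct_smul, smul_eq_mul, halfQuadForm]
    field_simp
  rw [hquad, gaussianConst, Matrix.det_smul, Fintype.card_fin,
    show (2 * p + d) / 2 = p + (d : ℝ) / 2 by ring, show 2 * p / 2 = p by ring]
  have hB : 0 < b + halfQuadForm S z := by linarith
  have hsq : ∀ x : ℝ, 0 < x → √(x ^ d) = x ^ ((d : ℝ) / 2) := fun x hx => by
    rw [Real.sqrt_eq_rpow, ← Real.rpow_natCast, ← Real.rpow_mul hx.le]; congr 1; ring
  rw [Real.sqrt_mul (by positivity), Real.sqrt_mul (by positivity), hsq _ (by positivity),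
    hsq _ (by positivity), Real.rpow_neg (by positivity), Real.div_rpow hB.le hb.le,
    Real.div_rpow zero_le_one hB.le, Real.one_rpow, Real.div_rpow hb.le hp.le,
    Real.mul_rpow (by positivity) Real.pi_pos.le, Real.mul_rpow (by positivity) Real.pi_pos.le,
    Real.mul_rpow (by positivity) hp.le, Real.rpow_add hb]
  have : 0 < √S.det := Real.sqrt_pos.2 hdet
  field_simp

end GammaMixing

/-! ### Asymptotics of scale mixtures near the median -/

section Asymptotics

/-- The limit bounds the ratio near 0, and boundedness of `A` does so away from 0. The bound must be
global because `√w * ε` is unbounded in `w` for every `ε`. -/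
lemma exists_le_mul_pow_of_tendsto {A : ℝ → ℝ} {M a : ℝ} {n : ℕ} (hM : ∀ r, |A r| ≤ M)
    (ha : Tendsto (fun r => A r / r ^ n) (𝓝[>] 0) (𝓝 a)) :
    ∃ C, ∀ r, 0 < r → |A r| ≤ C * r ^ n := by
  have h1 : ∀ᶠ r in 𝓝[>] (0 : ℝ), |A r / r ^ n| < |a| + 1 :=
    ha.abs.eventually (gt_mem_nhds (by linarith))
  obtain ⟨δ, hδ, h2⟩ := mem_nhdsGT_iff_exists_Ioo_subset.1 h1
  have hδ : 0 < δ := hδ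
  have hM0 : 0 ≤ M := (abs_nonneg _).trans (hM 0)
  refine ⟨(|a| + 1) + M / δ ^ n, fun r hr => ?_⟩
  have hrn : 0 < r ^ n := by positivity
  rcases lt_or_ge r δ with h | h
  · have h3 : |A r / r ^ n| < |a| + 1 := h2 ⟨hr, h⟩
    rw [abs_div, abs_of_pos hrn, div_lt_iff₀ hrn] at h3
    have : 0 ≤ M / δ ^ n * r ^ n := by positivity
    nlinarith
  · have h3 : M ≤ M / δ ^ n * r ^ n := by
      rw [div_mul_eq_mul_div, le_div_iff₀ (by positivity)]
      gcongr
    have : 0 ≤ (|a| + 1) * r ^ n := by positivity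
    nlinarith [hM r]

lemma integral_posteriorMixing {ν : Measure ℝ} [IsFiniteMeasure ν] (hpos : ∀ᵐ w ∂ν, 0 < w)
    {α θ : ℝ} (hα : 0 ≤ α) (hθ : 0 < θ) (F : ℝ → ℝ) :
    ∫ w, F w ∂(posteriorMixing ν α θ) =
      (laplaceMoment ν α θ)⁻¹ * ∫ w, w ^ α * Real.exp (-(θ * w)) * F w ∂ν := by
  rcases eq_or_ne ν 0 with rfl | hν
  · simp [posteriorMixing]
  have : NeZero ν := ⟨hν⟩
  have hm : tiltMass ν α θ ≠ 0 := tiltMass_ne_zero hpos α θ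
  rw [posteriorMixing, integral_withDensity_eq_integral_toReal_smul₀ (by fun_prop),
    ← integral_const_mul]
  · refine integral_congr_ae ?_
    filter_upwards [hpos] with w hw
    have hL : 0 ≤ laplaceMoment ν α θ := integral_nonneg_of_ae (by
      filter_upwards [hpos] with w hw
      simp only [Pi.zero_apply]; positivity)
    rw [tiltMass_eq_ofReal hpos hα hθ, ENNReal.toReal_mul, ENNReal.toReal_inv,
      ENNReal.toReal_ofReal hL, tilt, ENNReal.toReal_ofReal (by positivity), smul_eq_mul, mul_assoc]
  · refine ae_of_all _ fun w => ENNReal.mul_lt_top ?_ ENNReal.ofReal_lt_top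
    exact ENNReal.inv_lt_top.2 (pos_iff_ne_zero.2 hm)

/-- Small-scale asymptotics of the posterior mean of a function of `√w ε`. -/
lemma tendsto_integral_posteriorMixing {ν : Measure ℝ} [IsFiniteMeasure ν]
    (hpos : ∀ᵐ w ∂ν, 0 < w) {α θ : ℝ} (hα : 0 ≤ α) (hθ : 0 < θ) {A : ℝ → ℝ}
    (hA : Measurable A) {M a : ℝ} {n : ℕ} (hM : ∀ r, |A r| ≤ M)
    (ha : Tendsto (fun r => A r / r ^ n) (𝓝[>] 0) (𝓝 a)) :
    Tendsto (fun ε => (∫ w, A (√w * ε) ∂(posteriorMixing ν α θ)) / ε ^ n) (𝓝[>] 0)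
      (𝓝 (a * laplaceMoment ν (α + n / 2) θ / laplaceMoment ν α θ)) := by
  obtain ⟨C, hC⟩ := exists_le_mul_pow_of_tendsto hM ha
  have hsq : ∀ w : ℝ, 0 < w → ∀ s, w ^ α * s * √w ^ n = w ^ (α + n / 2) * s := fun w hw s => by
    rw [Real.rpow_add hw, Real.sqrt_eq_rpow, ← Real.rpow_natCast, ← Real.rpow_mul hw.le,
      show (1 / 2 : ℝ) * n = n / 2 by ring]
    ring
  -- Dominated convergence: `A (√w ε) / ε ^ n` tends to `a w ^ (n/2)` and is at most `C w ^ (n/2)`.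
  -- So order `n` in `ε` raises the exponent of the moment by `n/2`.
  have key : Tendsto (fun ε => ∫ w, w ^ α * Real.exp (-(θ * w)) * (A (√w * ε) / ε ^ n) ∂ν)
      (𝓝[>] 0) (𝓝 (∫ w, a * (w ^ (α + n / 2) * Real.exp (-(θ * w))) ∂ν)) := by
    refine tendsto_integral_filter_of_dominated_convergence
      (fun w => C * (w ^ (α + n / 2) * Real.exp (-(θ * w)))) ?_ ?_ ?_ ?_
    · refine Eventually.of_forall fun ε => Measurable.aestronglyMeasurable ?_
      have : Measurable fun w => A (√w * ε) := hA.comp (by fun_prop)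
      fun_prop
    · filter_upwards [self_mem_nhdsWithin] with ε hε
      have hε : 0 < ε := hε
      filter_upwards [hpos] with w hw
      have hw' : 0 < √w := Real.sqrt_pos.2 hw
      rw [← hsq w hw, norm_mul, Real.norm_of_nonneg (by positivity), Real.norm_eq_abs, abs_div,
        abs_of_pos (show 0 < ε ^ n by positivity)]
      have h1 : |A (√w * ε)| / ε ^ n ≤ C * √w ^ n := by
        rw [div_le_iff₀ (by positivity)]
        have := hC (√w * ε) (by positivity)
        rwa [mul_pow, ← mul_assoc] at this
      calc w ^ α * Real.exp (-(θ * w)) * (|A (√w * ε)| / ε ^ n)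
          ≤ w ^ α * Real.exp (-(θ * w)) * (C * √w ^ n) := by gcongr
        _ = C * (w ^ α * Real.exp (-(θ * w)) * √w ^ n) := by ring
    · exact (integrable_rpow_mul_exp_neg hpos (by positivity) hθ).const_mul C
    · filter_upwards [hpos] with w hw
      have hw' : 0 < √w := Real.sqrt_pos.2 hw
      have h1 : Tendsto (fun ε => √w * ε) (𝓝[>] 0) (𝓝[>] 0) := by
        refine tendsto_nhdsWithin_iff.2 ⟨?_, ?_⟩
        · have : Tendsto (fun ε => √w * ε) (𝓝 0) (𝓝 (√w * 0)) :=
            (continuous_const_mul (√w)).tendsto 0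
          rw [mul_zero] at this
          exact this.mono_left nhdsWithin_le_nhds
        · filter_upwards [self_mem_nhdsWithin] with ε hε
          have hε : 0 < ε := hε
          exact mul_pos hw' hε
      have h2 := ((ha.comp h1).mul_const (√w ^ n)).const_mul (w ^ α * Real.exp (-(θ * w)))
      rw [show w ^ α * Real.exp (-(θ * w)) * (a * √w ^ n) =
        a * (w ^ (α + n / 2) * Real.exp (-(θ * w))) by rw [← hsq w hw]; ring] at h2
      refine h2.congr' ?_
      filter_upwards [self_mem_nhdsWithin] with ε hε
      have hε : 0 < ε := hε
      simp only [Function.comp_apply, mul_pow]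
      field_simp
  rw [integral_const_mul] at key
  have key2 := key.const_mul (laplaceMoment ν α θ)⁻¹
  rw [show (laplaceMoment ν α θ)⁻¹ * (a * ∫ w, w ^ (α + n / 2) * Real.exp (-(θ * w)) ∂ν) =
    a * laplaceMoment ν (α + n / 2) θ / laplaceMoment ν α θ by
      rw [div_eq_inv_mul (a * _)]; rfl] at key2
  refine key2.congr fun ε => ?_
  rw [integral_posteriorMixing hpos hα hθ, mul_div_assoc, ← integral_div]
  simp only [mul_div_assoc]

/-- If `G` is a function of `Φ` near zero, the ratio of the leading coefficients is determined by
that function. -/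
lemma div_pow_eq_of_comp_eq {Φ₁ Φ₂ G₁ G₂ R : ℝ → ℝ} {n : ℕ} {g₁ g₂ φ₁ φ₂ : ℝ}
    (hc₁ : Continuous Φ₁) (hc₂ : Continuous Φ₂) (h0₁ : Φ₁ 0 = 0) (h0₂ : Φ₂ 0 = 0)
    (hp₁ : ∀ r, 0 < r → 0 < Φ₁ r) (hp₂ : ∀ r, 0 < r → 0 < Φ₂ r)
    (hφ₁ : Tendsto (fun r => Φ₁ r / r) (𝓝[>] 0) (𝓝 φ₁))
    (hφ₂ : Tendsto (fun r => Φ₂ r / r) (𝓝[>] 0) (𝓝 φ₂)) (hφ₁0 : φ₁ ≠ 0) (hφ₂0 : φ₂ ≠ 0)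
    (hg₁ : Tendsto (fun r => G₁ r / r ^ n) (𝓝[>] 0) (𝓝 g₁))
    (hg₂ : Tendsto (fun r => G₂ r / r ^ n) (𝓝[>] 0) (𝓝 g₂))
    (hR₁ : ∀ r, 0 < r → G₁ r = R (Φ₁ r)) (hR₂ : ∀ r, 0 < r → G₂ r = R (Φ₂ r)) :
    g₁ / φ₁ ^ n = g₂ / φ₂ ^ n := by
  have key : ∀ {Φ G : ℝ → ℝ} {g φ : ℝ}, Continuous Φ → Φ 0 = 0 → (∀ r, 0 < r → 0 < Φ r) →
      Tendsto (fun r => Φ r / r) (𝓝[>] 0) (𝓝 φ) → φ ≠ 0 →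
      Tendsto (fun r => G r / r ^ n) (𝓝[>] 0) (𝓝 g) → (∀ r, 0 < r → G r = R (Φ r)) →
      Tendsto (fun t => R t / t ^ n) (𝓝[>] 0) (𝓝 (g / φ ^ n)) := by
    intro Φ G g φ hc h0 hp hφ hφ0 hg hR
    have h1 : Tendsto (fun r => R (Φ r) / Φ r ^ n) (𝓝[>] 0) (𝓝 (g / φ ^ n)) := by
      refine (hg.div (hφ.pow n) (pow_ne_zero n hφ0)).congr' ?_
      filter_upwards [self_mem_nhdsWithin] with r hr
      have hr : 0 < r := hr
      have := hp r hr
      simp only [Pi.div_apply]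
      rw [← hR r hr, div_pow]
      field_simp
    -- By the intermediate value theorem the image of `(0, δ)` contains `(0, Φ δ)`, so a limit along
    -- `Φ r` is a limit in `t` itself; monotonicity of `Φ` plays no role.
    have h2 : 𝓝[>] (0 : ℝ) ≤ map Φ (𝓝[>] 0) := by
      intro s hs
      obtain ⟨δ, hδ, hs⟩ := mem_nhdsGT_iff_exists_Ioo_subset.1 (mem_map.1 hs)
      have hδ : 0 < δ := hδ
      have h3 := intermediate_value_Ioo hδ.le hc.continuousOn
      rw [h0] at h3
      refine mem_of_superset (Ioo_mem_nhdsGT (hp δ hδ)) (h3.trans ?_)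
      rintro _ ⟨r, hr, rfl⟩
      exact hs hr
    exact (tendsto_map'_iff.2 h1).mono_left h2
  exact tendsto_nhds_unique (key hc₁ h0₁ hp₁ hφ₁ hφ₁0 hg₁ hR₁) (key hc₂ h0₂ hp₂ hφ₂ hφ₂0 hg₂ hR₂)

end Asymptotics

/-! ### Quadrant masses -/

section Quadrants

/-- The mass of the square of side `r` in the first quadrant. -/
noncomputable def massPP (π : Measure (ℝ × ℝ)) (r : ℝ) : ℝ := π.real (Ioc 0 r ×ˢ Ioc 0 r)

/-- The mass of the square of side `r` in the fourth quadrant. -/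
noncomputable def massPM (π : Measure (ℝ × ℝ)) (r : ℝ) : ℝ := π.real (Ioc 0 r ×ˢ Ioc (-r) 0)

/-- The marginal mass of the interval `(0, r]`. -/
noncomputable def massMargin (π : Measure (ℝ × ℝ)) (r : ℝ) : ℝ := π.real (Ioc 0 r ×ˢ univ)

lemma monotone_massPP (π : Measure (ℝ × ℝ)) [IsFiniteMeasure π] : Monotone (massPP π) :=
  fun _ _ h => measureReal_mono (prod_mono (Ioc_subset_Ioc_right h) (Ioc_subset_Ioc_right h))

lemma monotone_massPM (π : Measure (ℝ × ℝ)) [IsFiniteMeasure π] : Monotone (massPM π) :=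
  fun _ _ h => measureReal_mono
    (prod_mono (Ioc_subset_Ioc_right h) (Ioc_subset_Ioc_left (neg_le_neg h)))

lemma monotone_massMargin (π : Measure (ℝ × ℝ)) [IsFiniteMeasure π] : Monotone (massMargin π) :=
  fun _ _ h => measureReal_mono (prod_mono (Ioc_subset_Ioc_right h) Subset.rfl)

lemma measureReal_rectangle (π : Measure (ℝ × ℝ)) [IsFiniteMeasure π] {a b c d : ℝ} (hab : a ≤ b)
    (hcd : c ≤ d) : π.real (Ioc a b ×ˢ Ioc c d) =
      π.real (Iic b ×ˢ Iic d) - π.real (Iic a ×ˢ Iic d) - π.real (Iic b ×ˢ Iic c) +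
        π.real (Iic a ×ˢ Iic c) := by
  have h : ∀ t : ℝ, π.real (Ioc a b ×ˢ Iic t) =
      π.real (Iic b ×ˢ Iic t) - π.real (Iic a ×ˢ Iic t) := fun t => by
    have hu : Iic b ×ˢ Iic t = (Iic a ×ˢ Iic t) ∪ (Ioc a b ×ˢ Iic t) := by
      rw [← union_prod, Iic_union_Ioc_eq_Iic hab]
    rw [hu, measureReal_union ((Iic_disjoint_Ioc le_rfl).set_prod_left _ _)
      (measurableSet_Ioc.prod measurableSet_Iic)]
    ring
  have hu : Ioc a b ×ˢ Iic d = (Ioc a b ×ˢ Iic c) ∪ (Ioc a b ×ˢ Ioc c d) := by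
    rw [← prod_union, Iic_union_Ioc_eq_Iic hcd]
  have h2 := congrArg π.real hu
  rw [measureReal_union ((Iic_disjoint_Ioc le_rfl).set_prod_right _ _)
    (measurableSet_Ioc.prod measurableSet_Ioc), h, h] at h2
  linarith

lemma measureReal_Iic_neg {m : Measure ℝ} [IsProbabilityMeasure m] [NullSingletonClass m]
    (hsym : m.map (fun x => -x) = m) (r : ℝ) : m.real (Iic (-r)) = 1 - m.real (Iic r) := by
  have h1 : m.real (Iic (-r)) = m.real (Ici r) := by
    conv_lhs => rw [← hsym]
    rw [map_measureReal_apply measurable_neg measurableSet_Iic]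
    congr 1
    ext x; simp
  have h2 : m.real (Ici r) = m.real (Ioi r) := measureReal_congr Ioi_ae_eq_Ici.symm
  rw [h1, h2, ← compl_Iic, probReal_compl_eq_one_sub measurableSet_Iic]

/-- The quadrant masses of a law with identical symmetric margins are determined by its copula and
the marginal mass. -/
lemma IsCopulaOf.mass_eq {C : ℝ → ℝ → ℝ} {π : Measure (ℝ × ℝ)} [IsProbabilityMeasure π]
    (h : IsCopulaOf C π) (heq : π.map Prod.fst = π.map Prod.snd)
    [NullSingletonClass (π.map Prod.fst)]
    (hsym : (π.map Prod.fst).map (fun x => -x) = π.map Prod.fst) {r : ℝ} (hr : 0 < r) :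
    massPP π r = (fun t => C (1 / 2 + t) (1 / 2 + t) - C (1 / 2) (1 / 2 + t) -
        C (1 / 2 + t) (1 / 2) + C (1 / 2) (1 / 2)) (massMargin π r) ∧
      massPP π r - massPM π r = (fun t => (C (1 / 2 + t) (1 / 2 + t) - C (1 / 2) (1 / 2 + t) -
        C (1 / 2 + t) (1 / 2) + C (1 / 2) (1 / 2)) - (C (1 / 2 + t) (1 / 2) - C (1 / 2) (1 / 2) -
        C (1 / 2 + t) (1 / 2 - t) + C (1 / 2) (1 / 2 - t))) (massMargin π r) := by
  have : IsProbabilityMeasure (π.map Prod.fst) :=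
    Measure.isProbabilityMeasure_map measurable_fst.aemeasurable
  set m := π.map Prod.fst with hm
  have e1 : ∀ a : ℝ, π.real (Iic a ×ˢ univ) = m.real (Iic a) := fun a => by
    rw [hm, prod_univ]
    exact (map_measureReal_apply measurable_fst measurableSet_Iic).symm
  have e2 : ∀ b : ℝ, π.real (univ ×ˢ Iic b) = m.real (Iic b) := fun b => by
    rw [heq, univ_prod]
    exact (map_measureReal_apply measurable_snd measurableSet_Iic).symm
  -- Symmetry without atoms puts the median at 0, so the corners of the rectangles correspond to the
  -- copula levels 1/2 and 1/2 ± t, where `t` is the marginal mass.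
  have h0 : m.real (Iic 0) = 1 / 2 := by
    have := measureReal_Iic_neg hsym 0
    rw [neg_zero] at this
    linarith
  have h1 : m.real (Iic r) = 1 / 2 + massMargin π r := by
    have e : massMargin π r = m.real (Ioc 0 r) := by
      rw [massMargin, prod_univ, hm]
      exact (map_measureReal_apply measurable_fst measurableSet_Ioc).symm
    rw [e, ← h0, ← measureReal_union (Iic_disjoint_Ioc le_rfl) measurableSet_Ioc,
      Iic_union_Ioc_eq_Iic hr.le]
  have h2 : m.real (Iic (-r)) = 1 / 2 - massMargin π r := by
    rw [measureReal_Iic_neg hsym, h1]; ring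
  have hF : ∀ a b : ℝ, π.real (Iic a ×ˢ Iic b) = C (m.real (Iic a)) (m.real (Iic b)) :=
    fun a b => by rw [h a b, e1, e2]
  rw [massPP, massPM, measureReal_rectangle π hr.le hr.le,
    measureReal_rectangle π hr.le (by linarith : -r ≤ 0)]
  simp only [hF, h0, h1, h2, true_and]

lemma mixPair_real_eq_integral {ν : Measure ℝ} [IsFiniteMeasure ν] (hpos : ∀ᵐ w ∂ν, 0 < w)
    (P : Measure (ℝ × ℝ)) [IsFiniteMeasure P] {s : Set (ℝ × ℝ)} (hs : MeasurableSet s)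
    {A : ℝ → ℝ} (hA : ∀ w, 0 < w → P.real ((fun e => (√w)⁻¹ • e) ⁻¹' s) = A w) :
    (mixPair ν P).real s = ∫ w, A w ∂ν := by
  have hm : Measurable fun p : ℝ × (ℝ × ℝ) => (√p.1)⁻¹ • p.2 := by fun_prop
  rw [mixPair, Measure.real, Measure.map_apply hm hs, Measure.prod_apply (hm hs),
    ← integral_toReal (measurable_measure_prodMk_left (hm hs)).aemeasurable
      (ae_of_all _ fun w => measure_lt_top _ _)]
  refine integral_congr_ae ?_
  filter_upwards [hpos] with w hw
  rw [← hA w hw]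
  rfl

lemma mixPair_mass_eq_integral {ν : Measure ℝ} [IsFiniteMeasure ν] (hpos : ∀ᵐ w ∂ν, 0 < w)
    (P : Measure (ℝ × ℝ)) [IsFiniteMeasure P] (r : ℝ) :
    massPP (mixPair ν P) r = ∫ w, massPP P (√w * r) ∂ν ∧
    massPM (mixPair ν P) r = ∫ w, massPM P (√w * r) ∂ν ∧
    massMargin (mixPair ν P) r = ∫ w, massMargin P (√w * r) ∂ν := by
  have h1 : ∀ w : ℝ, 0 < w → ∀ x t : ℝ, (√w)⁻¹ * x ≤ t ↔ x ≤ √w * t := fun w hw x t => by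
    rw [inv_mul_le_iff₀ (Real.sqrt_pos.2 hw)]
  have h2 : ∀ w : ℝ, 0 < w → ∀ x t : ℝ, t < (√w)⁻¹ * x ↔ √w * t < x := fun w hw x t => by
    rw [lt_inv_mul_iff₀ (Real.sqrt_pos.2 hw)]
  refine ⟨?_, ?_, ?_⟩
  · refine mixPair_real_eq_integral hpos P (measurableSet_Ioc.prod measurableSet_Ioc)
      fun w hw => ?_
    rw [massPP]
    congr 1
    ext e
    simp only [mem_preimage, mem_prod, mem_Ioc, Prod.smul_fst, Prod.smul_snd, smul_eq_mul,
      h1 w hw, h2 w hw, mul_zero]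
  · refine mixPair_real_eq_integral hpos P (measurableSet_Ioc.prod measurableSet_Ioc)
      fun w hw => ?_
    rw [massPM]
    congr 1
    ext e
    simp only [mem_preimage, mem_prod, mem_Ioc, Prod.smul_fst, Prod.smul_snd, smul_eq_mul,
      h1 w hw, h2 w hw, mul_zero, mul_neg]
  · refine mixPair_real_eq_integral hpos P (measurableSet_Ioc.prod MeasurableSet.univ)
      fun w hw => ?_
    rw [massMargin]
    congr 1
    ext e
    simp only [mem_preimage, mem_prod, mem_Ioc, Prod.smul_fst, smul_eq_mul,
      h1 w hw, h2 w hw, mul_zero, mem_univ]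

end Quadrants

/-! ### The bivariate normal distribution near the origin -/

section Bivariate

/-- The bivariate normal density. -/
noncomputable def bivariateDensity (R : Matrix (Fin 2) (Fin 2) ℝ) (x y : ℝ) : ℝ :=
  gaussianConst R * Real.exp (-(R⁻¹ 0 0 * x ^ 2 + 2 * R⁻¹ 0 1 * (x * y) + R⁻¹ 1 1 * y ^ 2) / 2)

/-- The bivariate normal distribution as a measure on `ℝ × ℝ`. -/
noncomputable def bivariateGaussian (R : Matrix (Fin 2) (Fin 2) ℝ) : Measure (ℝ × ℝ) :=
  (multivariateGaussian 0 R).map fun e => (e 0, e 1)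

instance isProbabilityMeasure_bivariateGaussian (R : Matrix (Fin 2) (Fin 2) ℝ) :
    IsProbabilityMeasure (bivariateGaussian R) :=
  Measure.isProbabilityMeasure_map (by fun_prop)

lemma continuous_bivariateDensity (R : Matrix (Fin 2) (Fin 2) ℝ) :
    Continuous fun p : ℝ × ℝ => bivariateDensity R p.1 p.2 := by
  unfold bivariateDensity; fun_prop

lemma bivariateDensity_pos {R : Matrix (Fin 2) (Fin 2) ℝ} (hR : R.PosDef) (x y : ℝ) :
    0 < bivariateDensity R x y := by
  have := gaussianConst_pos hR
  unfold bivariateDensity; positivity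

lemma bivariateGaussian_eq_withDensity {R : Matrix (Fin 2) (Fin 2) ℝ} (hR : R.PosDef) :
    bivariateGaussian R =
      volume.withDensity fun p => ENNReal.ofReal (bivariateDensity R p.1 p.2) := by
  have hf := (continuous_bivariateDensity R).measurable
  have hsym : R⁻¹ 1 0 = R⁻¹ 0 1 := by
    have := hR.inv.isHermitian.apply 0 1
    simpa using this
  have hq : Continuous fun x : EuclideanSpace ℝ (Fin 2) => x.ofLp ⬝ᵥ R⁻¹.mulVec x.ofLp := by fun_prop
  refine Measure.ext_of_lintegral _ fun F hF => ?_
  rw [bivariateGaussian, lintegral_map hF (by fun_prop), multivariateGaussian_eq_withDensity hR,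
    lintegral_withDensity_eq_lintegral_mul _ (by fun_prop) (by fun_prop),
    lintegral_withDensity_eq_lintegral_mul _ (by fun_prop) hF,
    ← (PiLp.volume_preserving_toLp (Fin 2)).lintegral_comp (by fun_prop),
    ← (volume_preserving_finTwoArrow ℝ).lintegral_comp (by fun_prop)]
  refine lintegral_congr fun x => ?_
  simp only [Pi.mul_apply, bivariateDensity, gaussianConst, MeasurableEquiv.finTwoArrow_apply]
  congr 4
  simp only [dotProduct, Matrix.mulVec, Fin.sum_univ_two, hsym]
  ring

lemma bivariateGaussian_real_rectangle {R : Matrix (Fin 2) (Fin 2) ℝ} (hR : R.PosDef)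
    {a b c d : ℝ} (hab : a ≤ b) (hcd : c ≤ d) :
    (bivariateGaussian R).real (Ioc a b ×ˢ Ioc c d) =
      ∫ x in a..b, ∫ y in c..d, bivariateDensity R x y := by
  have hf := continuous_bivariateDensity R
  have hi : IntegrableOn (fun p : ℝ × ℝ => bivariateDensity R p.1 p.2) (Ioc a b ×ˢ Ioc c d) :=
    (hf.continuousOn.integrableOn_compact (isCompact_Icc.prod isCompact_Icc)).mono_set
      (prod_mono Ioc_subset_Icc_self Ioc_subset_Icc_self)
  rw [bivariateGaussian_eq_withDensity hR, Measure.real,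
    withDensity_apply _ (measurableSet_Ioc.prod measurableSet_Ioc),
    ← integral_eq_lintegral_of_nonneg_ae (ae_of_all _ fun p => (bivariateDensity_pos hR _ _).le)
      hf.aestronglyMeasurable, Measure.volume_eq_prod, setIntegral_prod _ hi,
    intervalIntegral.integral_of_le hab]
  refine setIntegral_congr_fun measurableSet_Ioc fun x _ => ?_
  rw [intervalIntegral.integral_of_le hcd]

/-- Rescaling to the unit square reduces the limit `r → 0` to continuity of a parametric integral.
-/
lemma massPP_bivariateGaussian {R : Matrix (Fin 2) (Fin 2) ℝ} (hR : R.PosDef) {r : ℝ}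
    (hr : 0 < r) : massPP (bivariateGaussian R) r =
      r ^ 2 * ∫ s in (0 : ℝ)..1, ∫ t in (0 : ℝ)..1, bivariateDensity R (r * s) (r * t) := by
  rw [massPP, bivariateGaussian_real_rectangle hR hr.le hr.le]
  have h1 := intervalIntegral.smul_integral_comp_mul_left (a := 0) (b := 1)
    (fun x : ℝ => ∫ y in (0 : ℝ)..r, bivariateDensity R x y) r
  rw [mul_zero, mul_one] at h1
  rw [← h1, pow_two, mul_assoc, smul_eq_mul]
  congr 1
  rw [← intervalIntegral.integral_const_mul]
  refine intervalIntegral.integral_congr (μ := volume) fun s _ => ?_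
  have h2 := intervalIntegral.smul_integral_comp_mul_left (a := 0) (b := 1)
    (fun y : ℝ => bivariateDensity R (r * s) y) r
  rw [mul_zero, mul_one] at h2
  exact h2.symm

lemma massPM_bivariateGaussian {R : Matrix (Fin 2) (Fin 2) ℝ} (hR : R.PosDef) {r : ℝ}
    (hr : 0 < r) : massPM (bivariateGaussian R) r =
      r ^ 2 * ∫ s in (0 : ℝ)..1, ∫ t in (0 : ℝ)..1, bivariateDensity R (r * s) (-(r * t)) := by
  rw [massPM, bivariateGaussian_real_rectangle hR hr.le (by linarith)]
  have h1 := intervalIntegral.smul_integral_comp_mul_left (a := 0) (b := 1)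
    (fun x : ℝ => ∫ y in (-r)..0, bivariateDensity R x y) r
  rw [mul_zero, mul_one] at h1
  rw [← h1, pow_two, mul_assoc, smul_eq_mul]
  congr 1
  rw [← intervalIntegral.integral_const_mul]
  refine intervalIntegral.integral_congr (μ := volume) fun s _ => ?_
  have h2 := intervalIntegral.smul_integral_comp_mul_left (a := 0) (b := 1)
    (fun y : ℝ => bivariateDensity R (r * s) (-y)) r
  rw [mul_zero, mul_one, intervalIntegral.integral_comp_neg, neg_zero] at h2
  exact h2.symm

lemma tendsto_massPP_bivariateGaussian {R : Matrix (Fin 2) (Fin 2) ℝ} (hR : R.PosDef) :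
    Tendsto (fun r => massPP (bivariateGaussian R) r / r ^ 2) (𝓝[>] 0) (𝓝 (gaussianConst R)) := by
  have hc : Continuous fun r : ℝ =>
      ∫ s in (0 : ℝ)..1, ∫ t in (0 : ℝ)..1, bivariateDensity R (r * s) (r * t) := by
    refine intervalIntegral.continuous_parametric_intervalIntegral_of_continuous' ?_ 0 1
    refine intervalIntegral.continuous_parametric_intervalIntegral_of_continuous' ?_ 0 1
    unfold Function.uncurry
    exact (continuous_bivariateDensity R).comp (by fun_prop : Continuous fun q : (ℝ × ℝ) × ℝ =>
      (q.1.1 * q.1.2, q.1.1 * q.2))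
  have h0 := hc.tendsto 0
  have hval : ∫ s in (0 : ℝ)..1, ∫ t in (0 : ℝ)..1, bivariateDensity R (0 * s) (0 * t) =
      gaussianConst R := by simp [bivariateDensity]
  rw [hval] at h0
  refine (h0.mono_left nhdsWithin_le_nhds).congr' ?_
  filter_upwards [self_mem_nhdsWithin] with r hr
  have hr : 0 < r := hr
  rw [massPP_bivariateGaussian hR hr, mul_div_cancel_left₀ _ (by positivity)]

/-- The terms of order `r²` cancel, since both squares touch the origin. The mixed term of the
exponent is odd in `y` and contributes at order `r⁴`. -/
lemma tendsto_massPP_sub_massPM_bivariateGaussian {R : Matrix (Fin 2) (Fin 2) ℝ}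
    (hR : R.PosDef) :
    Tendsto (fun r => (massPP (bivariateGaussian R) r - massPM (bivariateGaussian R) r) / r ^ 4)
      (𝓝[>] 0) (𝓝 (-(gaussianConst R * R⁻¹ 0 1) / 2)) := by
  -- This is `sinh x / x`, extended by 1 at 0. The density at `(x, y)` minus that at `(x, -y)`
  -- contains `sinh (R⁻¹ 0 1 * (x * y))`; with `S`, the factor `r²` splits off and leaves a function
  -- continuous at `r = 0`.
  set S := dslope Real.sinh 0 with hS
  have hSc : Continuous S := by
    rw [← continuousOn_univ, hS, continuousOn_dslope univ_mem]
    exact ⟨Real.continuous_sinh.continuousOn, Real.differentiable_sinh 0⟩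
  have hS0 : S 0 = 1 := by rw [hS, dslope_same, Real.deriv_sinh, Real.cosh_zero]
  have hSx : ∀ x, Real.sinh x = x * S x := fun x => by
    have := sub_smul_dslope Real.sinh 0 x
    simp only [sub_zero, smul_eq_mul, Real.sinh_zero] at this
    exact this.symm
  set g : ℝ → ℝ → ℝ → ℝ := fun r s t => -2 * gaussianConst R *
    Real.exp (-(R⁻¹ 0 0 * (r * s) ^ 2 + R⁻¹ 1 1 * (r * t) ^ 2) / 2) *
    (R⁻¹ 0 1 * (s * t) * S (R⁻¹ 0 1 * ((r * s) * (r * t)))) with hg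
  have hdiff : ∀ r s t : ℝ, bivariateDensity R (r * s) (r * t) -
      bivariateDensity R (r * s) (-(r * t)) = r ^ 2 * g r s t := fun r s t => by
    have e : r ^ 2 * g r s t = -2 * gaussianConst R *
      Real.exp (-(R⁻¹ 0 0 * (r * s) ^ 2 + R⁻¹ 1 1 * (r * t) ^ 2) / 2) *
      Real.sinh (R⁻¹ 0 1 * ((r * s) * (r * t))) := by
      rw [hSx]; simp only [hg]; ring
    have e1 : bivariateDensity R (r * s) (r * t) = gaussianConst R *
        (Real.exp (-(R⁻¹ 0 0 * (r * s) ^ 2 + R⁻¹ 1 1 * (r * t) ^ 2) / 2) *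
        Real.exp (-(R⁻¹ 0 1 * ((r * s) * (r * t))))) := by
      rw [bivariateDensity, ← Real.exp_add]; congr 2; ring
    have e2 : bivariateDensity R (r * s) (-(r * t)) = gaussianConst R *
        (Real.exp (-(R⁻¹ 0 0 * (r * s) ^ 2 + R⁻¹ 1 1 * (r * t) ^ 2) / 2) *
        Real.exp (R⁻¹ 0 1 * ((r * s) * (r * t)))) := by
      rw [bivariateDensity, ← Real.exp_add]; congr 2; ring
    rw [e, e1, e2, Real.sinh_eq]; ring
  have hc : Continuous fun r : ℝ => ∫ s in (0 : ℝ)..1, ∫ t in (0 : ℝ)..1, g r s t := by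
    refine intervalIntegral.continuous_parametric_intervalIntegral_of_continuous' ?_ 0 1
    refine intervalIntegral.continuous_parametric_intervalIntegral_of_continuous' ?_ 0 1
    unfold Function.uncurry
    fun_prop
  have h0 := hc.tendsto 0
  -- The integral of `s t` over the unit square is 1/4.
  have hval : ∫ s in (0 : ℝ)..1, ∫ t in (0 : ℝ)..1, g 0 s t =
      -(gaussianConst R * R⁻¹ 0 1) / 2 := by
    have e : ∀ s t : ℝ, g 0 s t = -2 * gaussianConst R * R⁻¹ 0 1 * s * t := fun s t => by
      have : g 0 s t = -2 * gaussianConst R * Real.exp 0 * (R⁻¹ 0 1 * (s * t) * S 0) := by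
        simp only [hg]; congr 3 <;> ring_nf
      rw [this, hS0, Real.exp_zero]; ring
    have h1 : ∀ s : ℝ, ∫ t in (0 : ℝ)..1, g 0 s t = -2 * gaussianConst R * R⁻¹ 0 1 / 2 * s :=
      fun s => by
        rw [intervalIntegral.integral_congr (μ := volume) fun t _ => e s t,
          intervalIntegral.integral_const_mul, integral_id]
        ring
    rw [intervalIntegral.integral_congr (μ := volume) fun s _ => h1 s,
      intervalIntegral.integral_const_mul, integral_id]
    ring
  rw [hval] at h0
  refine (h0.mono_left nhdsWithin_le_nhds).congr' ?_
  filter_upwards [self_mem_nhdsWithin] with r hr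
  have hr : 0 < r := hr
  have hin : ∀ δ s : ℝ, IntervalIntegrable
      (fun t => bivariateDensity R (r * s) (δ * (r * t))) volume 0 1 := fun δ s =>
    ((continuous_bivariateDensity R).comp (by fun_prop : Continuous fun t : ℝ =>
      (r * s, δ * (r * t)))).intervalIntegrable 0 1
  have hout : ∀ δ : ℝ, IntervalIntegrable
      (fun s => ∫ t in (0 : ℝ)..1, bivariateDensity R (r * s) (δ * (r * t))) volume 0 1 := fun δ => by
    refine Continuous.intervalIntegrable ?_ 0 1
    refine intervalIntegral.continuous_parametric_intervalIntegral_of_continuous' ?_ 0 1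
    exact (continuous_bivariateDensity R).comp (by fun_prop : Continuous fun q : ℝ × ℝ =>
      (r * q.1, δ * (r * q.2)))
  have i1 := hin 1
  have i2 := hin (-1)
  have o1 := hout 1
  have o2 := hout (-1)
  simp only [one_mul, neg_mul] at i1 i2 o1 o2
  rw [massPP_bivariateGaussian hR hr, massPM_bivariateGaussian hR hr, ← mul_sub,
    ← intervalIntegral.integral_sub o1 o2]
  have e3 : ∀ s : ℝ, (∫ t in (0 : ℝ)..1, bivariateDensity R (r * s) (r * t)) -
      (∫ t in (0 : ℝ)..1, bivariateDensity R (r * s) (-(r * t))) =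
      r ^ 2 * ∫ t in (0 : ℝ)..1, g r s t := fun s => by
    rw [← intervalIntegral.integral_sub (i1 s) (i2 s), ← intervalIntegral.integral_const_mul]
    simp only [hdiff]
  simp only [e3, intervalIntegral.integral_const_mul]
  field_simp

lemma bivariateGaussian_map_fst {R : Matrix (Fin 2) (Fin 2) ℝ} (hR : R.PosDef) (h : R 0 0 = 1) :
    (bivariateGaussian R).map Prod.fst = gaussianReal 0 1 := by
  rw [bivariateGaussian, Measure.map_map measurable_fst (by fun_prop)]
  have := (measurePreserving_eval_multivariateGaussian (μ := 0) hR.posSemidef (i := 0)).map_eq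
  rw [h, Real.toNNReal_one] at this
  exact this

lemma bivariateGaussian_map_snd {R : Matrix (Fin 2) (Fin 2) ℝ} (hR : R.PosDef) (h : R 1 1 = 1) :
    (bivariateGaussian R).map Prod.snd = gaussianReal 0 1 := by
  rw [bivariateGaussian, Measure.map_map measurable_snd (by fun_prop)]
  have := (measurePreserving_eval_multivariateGaussian (μ := 0) hR.posSemidef (i := 1)).map_eq
  rw [h, Real.toNNReal_one] at this
  exact this

lemma tendsto_massMargin_bivariateGaussian {R : Matrix (Fin 2) (Fin 2) ℝ} (hR : R.PosDef)
    (h : R 0 0 = 1) :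
    Tendsto (fun r => massMargin (bivariateGaussian R) r / r ^ 1) (𝓝[>] 0)
      (𝓝 (gaussianPDFReal 0 1 0)) := by
  have hg : Continuous (gaussianPDFReal 0 1) := by
    unfold gaussianPDFReal; fun_prop
  have hc : Continuous fun r : ℝ => ∫ s in (0 : ℝ)..1, gaussianPDFReal 0 1 (r * s) := by
    refine intervalIntegral.continuous_parametric_intervalIntegral_of_continuous' ?_ 0 1
    unfold Function.uncurry
    exact hg.comp (by fun_prop : Continuous fun q : ℝ × ℝ => q.1 * q.2)
  have h0 := hc.tendsto 0
  simp only [zero_mul, intervalIntegral.integral_const, sub_zero, one_smul] at h0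
  refine (h0.mono_left nhdsWithin_le_nhds).congr' ?_
  filter_upwards [self_mem_nhdsWithin] with r hr
  have hr : 0 < r := hr
  have h1 : massMargin (bivariateGaussian R) r = ∫ x in (0 : ℝ)..r, gaussianPDFReal 0 1 x := by
    have e : massMargin (bivariateGaussian R) r = (gaussianReal 0 1).real (Ioc 0 r) := by
      rw [← bivariateGaussian_map_fst hR h, massMargin, prod_univ]
      exact (map_measureReal_apply measurable_fst measurableSet_Ioc).symm
    rw [e, Measure.real, gaussianReal_apply_eq_integral 0 one_ne_zero, ENNReal.toReal_ofReal
      (integral_nonneg fun x => gaussianPDFReal_nonneg 0 1 x), intervalIntegral.integral_of_le hr.le]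
  have h2 := intervalIntegral.smul_integral_comp_mul_left (a := 0) (b := 1) (gaussianPDFReal 0 1) r
  rw [mul_zero, mul_one, smul_eq_mul] at h2
  rw [h1, ← h2, pow_one, mul_div_cancel_left₀ _ hr.ne']

end Bivariate

/-! ### Necessary conditions for a constant conditional copula -/

section Necessity

lemma mixPair_map_scale (ν : Measure ℝ) (P : Measure (ℝ × ℝ)) [SFinite ν] [IsFiniteMeasure P]
    (s t : ℝ) : (mixPair ν P).map (fun y => (s * y.1, t * y.2)) =
      mixPair ν (P.map fun y => (s * y.1, t * y.2)) := by
  have hm : Measurable fun y : ℝ × ℝ => (s * y.1, t * y.2) := by fun_prop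
  have h : ν.prod (P.map fun y => (s * y.1, t * y.2)) =
      (ν.prod P).map (Prod.map id fun y => (s * y.1, t * y.2)) := by
    rw [← Measure.map_prod_map _ _ measurable_id hm, Measure.map_id]
  rw [mixPair, mixPair, h, Measure.map_map hm (by fun_prop),
    Measure.map_map (by fun_prop) (by fun_prop)]
  congr 1
  ext p <;> simp [mul_left_comm]

lemma residualLaw_map_scale {d : ℕ} {S : Matrix (Fin d) (Fin d) ℝ} (hS : S.PosSemidef)
    (u v : Fin d → ℝ) (s t : ℝ) :
    (residualLaw S u v).map (fun y => (s * y.1, t * y.2)) =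
      bivariateGaussian (residualCov S (s • u) (t • v)) := by
  rw [bivariateGaussian, ← map_residualPair_multivariateGaussian hS, residualLaw,
    Measure.map_map (by fun_prop) (continuous_residualPair u v).measurable]
  congr 1
  ext x <;> simp [residualPair]

lemma residualCov_smul {d : ℕ} (S : Matrix (Fin d) (Fin d) ℝ) (u v : Fin d → ℝ) (s t : ℝ)
    (a b : Fin 2) : residualCov S (s • u) (t • v) a b = ![s, t] a * ![s, t] b * residualCov S u v a b := by
  simp only [residualCov_apply]
  fin_cases a <;> fin_cases b <;> simp [Matrix.mulVec_smul] <;> ring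

lemma posDef_residualCov_smul {d : ℕ} {S : Matrix (Fin d) (Fin d) ℝ} {u v : Fin d → ℝ}
    (hR : (residualCov S u v).PosDef) {s t : ℝ} (hs : s ≠ 0) (ht : t ≠ 0) :
    (residualCov S (s • u) (t • v)).PosDef := by
  have h := hR.mul_mul_conjTranspose_same (B := Matrix.diagonal ![s, t]) (by
    intro a b hab
    ext l
    have := congrFun hab l
    beta_reduce at this
    rw [Matrix.vecMul_diagonal, Matrix.vecMul_diagonal] at this
    fin_cases l
    · exact mul_right_cancel₀ hs this
    · exact mul_right_cancel₀ ht this)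
  convert h using 1
  ext a b
  rw [residualCov_smul, Matrix.diagonal_conjTranspose, Matrix.mul_diagonal, Matrix.diagonal_mul]
  simp; ring

lemma massMargin_eq (π : Measure (ℝ × ℝ)) [IsFiniteMeasure π] (r : ℝ) :
    massMargin π r = (π.map Prod.fst).real (Ioc 0 r) := by
  rw [massMargin, prod_univ]
  exact (map_measureReal_apply measurable_fst measurableSet_Ioc).symm

lemma continuous_massMargin (π : Measure (ℝ × ℝ)) [IsProbabilityMeasure π]
    [NullSingletonClass (π.map Prod.fst)] : Continuous (massMargin π) := by
  have : IsProbabilityMeasure (π.map Prod.fst) :=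
    Measure.isProbabilityMeasure_map measurable_fst.aemeasurable
  have hc := continuous_measureReal_Iic (π.map Prod.fst)
  have h : massMargin π = fun r => (π.map Prod.fst).real (Iic (max r 0)) -
      (π.map Prod.fst).real (Iic 0) := by
    ext r
    rw [massMargin_eq]
    rcases le_total r 0 with h | h
    · rw [max_eq_right h, Ioc_eq_empty (by simpa using h)]; simp
    · rw [max_eq_left h, ← Iic_union_Ioc_eq_Iic h,
        measureReal_union (Iic_disjoint_Ioc le_rfl) measurableSet_Ioc]
      ring
  rw [h]
  exact (hc.comp (continuous_id.max continuous_const)).sub continuous_const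

lemma massMargin_pos (π : Measure (ℝ × ℝ)) [IsProbabilityMeasure π]
    [(π.map Prod.fst).IsOpenPosMeasure] {r : ℝ} (hr : 0 < r) : 0 < massMargin π r := by
  have : IsProbabilityMeasure (π.map Prod.fst) :=
    Measure.isProbabilityMeasure_map measurable_fst.aemeasurable
  rw [massMargin_eq]
  have h1 : 0 < (π.map Prod.fst).real (Ioo 0 r) :=
    ENNReal.toReal_pos (isOpen_Ioo.measure_ne_zero _ (nonempty_Ioo.2 hr)) (measure_ne_top _ _)
  exact h1.trans_le (measureReal_mono Ioo_subset_Ioc_self)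

lemma map_neg_map_inv_sqrt_mul (ν : Measure ℝ) [SFinite ν] {η : Measure ℝ} [SFinite η]
    (h : η.map (fun x => -x) = η) :
    ((ν.prod η).map fun p => (√p.1)⁻¹ * p.2).map (fun x => -x) =
      (ν.prod η).map fun p => (√p.1)⁻¹ * p.2 := by
  have h1 : ν.prod η = (ν.prod η).map (Prod.map id fun x => -x) := by
    conv_lhs => rw [← h, ← Measure.map_id (μ := ν)]
    exact Measure.map_prod_map _ _ measurable_id measurable_neg
  conv_rhs => rw [h1]
  rw [Measure.map_map (by fun_prop) (by fun_prop), Measure.map_map (by fun_prop) (by fun_prop)]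
  congr 1
  ext p; simp

lemma ae_pos_posteriorMixing {ν : Measure ℝ} (hpos : ∀ᵐ w ∂ν, 0 < w) (α θ : ℝ) :
    ∀ᵐ w ∂(posteriorMixing ν α θ), 0 < w :=
  (withDensity_absolutelyContinuous ν _).ae_le hpos

/-- The limits of the mass of the square over the squared marginal mass, and of the excess over its
fourth power, are determined by the copula, hence equal for the two parameters. The small-scale
asymptotics express them by the moments. -/
lemma laplaceMoment_ratio_eq {R : Matrix (Fin 2) (Fin 2) ℝ} (hR : R.PosDef) (h00 : R 0 0 = 1)
    (h11 : R 1 1 = 1) {ν : Measure ℝ} [IsProbabilityMeasure ν] (hpos : ∀ᵐ w ∂ν, 0 < w)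
    {α θ₁ θ₂ : ℝ} (hα : 0 ≤ α) (hθ₁ : 0 < θ₁) (hθ₂ : 0 < θ₂) {C : ℝ → ℝ → ℝ}
    (h₁ : IsCopulaOf C (mixPair (posteriorMixing ν α θ₁) (bivariateGaussian R)))
    (h₂ : IsCopulaOf C (mixPair (posteriorMixing ν α θ₂) (bivariateGaussian R))) :
    laplaceMoment ν (α + 1) θ₁ * laplaceMoment ν α θ₁ / laplaceMoment ν (α + 1 / 2) θ₁ ^ 2 =
      laplaceMoment ν (α + 1) θ₂ * laplaceMoment ν α θ₂ / laplaceMoment ν (α + 1 / 2) θ₂ ^ 2 ∧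
    (R⁻¹ 0 1 ≠ 0 →
      laplaceMoment ν (α + 2) θ₁ * laplaceMoment ν α θ₁ ^ 3 / laplaceMoment ν (α + 1 / 2) θ₁ ^ 4 =
      laplaceMoment ν (α + 2) θ₂ * laplaceMoment ν α θ₂ ^ 3 /
        laplaceMoment ν (α + 1 / 2) θ₂ ^ 4) := by
  set P := bivariateGaussian R with hP
  have m1 : P.map Prod.fst = gaussianReal 0 1 := bivariateGaussian_map_fst hR h00
  have m2 : P.map Prod.snd = gaussianReal 0 1 := bivariateGaussian_map_snd hR h11
  have o₁ : (gaussianReal 0 1).IsOpenPosMeasure :=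
    (gaussianReal_absolutelyContinuous' 0 one_ne_zero).isOpenPosMeasure
  have a₁ := nullSingletonClass_gaussianReal (μ := 0) (v := 1) one_ne_zero
  have hgs : (gaussianReal 0 1).map (fun x => -x) = gaussianReal 0 1 := by
    rw [gaussianReal_map_neg, neg_zero]
  have hb : ∀ {f : ℝ → ℝ}, (∀ r, 0 ≤ f r ∧ f r ≤ 1) → ∀ r, |f r| ≤ 1 := fun hf r =>
    abs_le.2 ⟨by linarith [(hf r).1], (hf r).2⟩
  have hφ0 : gaussianPDFReal 0 1 0 ≠ 0 := (gaussianPDFReal_pos 0 1 0 one_ne_zero).ne'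
  have hg0 := (gaussianConst_pos hR).ne'
  -- `F` and `G` depend on `C` only, so the same functions serve for `θ₁` and `θ₂`.
  obtain ⟨F, hF⟩ : ∃ F : ℝ → ℝ, F = fun t => C (1 / 2 + t) (1 / 2 + t) - C (1 / 2) (1 / 2 + t) -
    C (1 / 2 + t) (1 / 2) + C (1 / 2) (1 / 2) := ⟨_, rfl⟩
  obtain ⟨G, hG⟩ : ∃ G : ℝ → ℝ, G = fun t => (C (1 / 2 + t) (1 / 2 + t) - C (1 / 2) (1 / 2 + t) -
    C (1 / 2 + t) (1 / 2) + C (1 / 2) (1 / 2)) - (C (1 / 2 + t) (1 / 2) - C (1 / 2) (1 / 2) -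
    C (1 / 2 + t) (1 / 2 - t) + C (1 / 2) (1 / 2 - t)) := ⟨_, rfl⟩
  have key : ∀ θ, 0 < θ → IsCopulaOf C (mixPair (posteriorMixing ν α θ) P) →
      Continuous (massMargin (mixPair (posteriorMixing ν α θ) P)) ∧
      (∀ r, 0 < r → 0 < massMargin (mixPair (posteriorMixing ν α θ) P) r) ∧
      Tendsto (fun r => massMargin (mixPair (posteriorMixing ν α θ) P) r / r) (𝓝[>] 0)
        (𝓝 (gaussianPDFReal 0 1 0 * laplaceMoment ν (α + 1 / 2) θ / laplaceMoment ν α θ)) ∧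
      Tendsto (fun r => massPP (mixPair (posteriorMixing ν α θ) P) r / r ^ 2) (𝓝[>] 0)
        (𝓝 (gaussianConst R * laplaceMoment ν (α + 1) θ / laplaceMoment ν α θ)) ∧
      Tendsto (fun r => (massPP (mixPair (posteriorMixing ν α θ) P) r -
          massPM (mixPair (posteriorMixing ν α θ) P) r) / r ^ 4) (𝓝[>] 0)
        (𝓝 (-(gaussianConst R * R⁻¹ 0 1) / 2 * laplaceMoment ν (α + 2) θ /
          laplaceMoment ν α θ)) ∧
      (∀ r, 0 < r → massPP (mixPair (posteriorMixing ν α θ) P) r =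
        F (massMargin (mixPair (posteriorMixing ν α θ) P) r)) ∧
      (∀ r, 0 < r → massPP (mixPair (posteriorMixing ν α θ) P) r -
          massPM (mixPair (posteriorMixing ν α θ) P) r =
        G (massMargin (mixPair (posteriorMixing ν α θ) P) r)) := by
    intro θ hθ hC
    have hpos' := ae_pos_posteriorMixing hpos α θ
    have : IsProbabilityMeasure (posteriorMixing ν α θ) :=
      isProbabilityMeasure_posterior hpos (by rw [tiltMass_eq_ofReal hpos hα hθ]; simp)
    have : IsProbabilityMeasure (mixPair (posteriorMixing ν α θ) P) :=
      Measure.isProbabilityMeasure_map (by fun_prop)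
    have n₁ : NullSingletonClass ((mixPair (posteriorMixing ν α θ) P).map Prod.fst) := by
      rw [mixPair_map_fst, m1]; exact nullSingletonClass_map_inv_sqrt_mul hpos'
    have p₁ : ((mixPair (posteriorMixing ν α θ) P).map Prod.fst).IsOpenPosMeasure := by
      rw [mixPair_map_fst, m1]; exact isOpenPosMeasure_map_inv_sqrt_mul hpos'
    have heq : (mixPair (posteriorMixing ν α θ) P).map Prod.fst =
        (mixPair (posteriorMixing ν α θ) P).map Prod.snd := by
      rw [mixPair_map_fst, mixPair_map_snd, m1, m2]
    have hsym : ((mixPair (posteriorMixing ν α θ) P).map Prod.fst).map (fun x => -x) =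
        (mixPair (posteriorMixing ν α θ) P).map Prod.fst := by
      rw [mixPair_map_fst, m1]; exact map_neg_map_inv_sqrt_mul _ hgs
    have hint := fun r => mixPair_mass_eq_integral hpos' P r
    have b1 : ∀ r, |massPP P r| ≤ 1 := hb fun r => ⟨measureReal_nonneg, measureReal_le_one⟩
    have b2 : ∀ r, |massPM P r| ≤ 1 := hb fun r => ⟨measureReal_nonneg, measureReal_le_one⟩
    have b3 : ∀ r, |massMargin P r| ≤ 1 := hb fun r => ⟨measureReal_nonneg, measureReal_le_one⟩
    have hPP := (monotone_massPP P).measurable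
    have hPM := (monotone_massPM P).measurable
    have hMM := (monotone_massMargin P).measurable
    have t1 := tendsto_integral_posteriorMixing hpos hα hθ hMM b3
      (tendsto_massMargin_bivariateGaussian hR h00)
    have t2 := tendsto_integral_posteriorMixing hpos hα hθ hPP b1
      (tendsto_massPP_bivariateGaussian hR)
    have t3 := tendsto_integral_posteriorMixing hpos hα hθ (hPP.sub hPM)
      (fun r => (abs_sub _ _).trans (add_le_add (b1 r) (b2 r)))
      (tendsto_massPP_sub_massPM_bivariateGaussian hR)
    have i1 : ∀ r, Integrable (fun w => massPP P (√w * r)) (posteriorMixing ν α θ) := fun r =>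
      Integrable.of_bound (hPP.comp (by fun_prop)).aestronglyMeasurable 1
        (ae_of_all _ fun w => b1 _)
    have i2 : ∀ r, Integrable (fun w => massPM P (√w * r)) (posteriorMixing ν α θ) := fun r =>
      Integrable.of_bound (hPM.comp (by fun_prop)).aestronglyMeasurable 1
        (ae_of_all _ fun w => b2 _)
    refine ⟨continuous_massMargin _, fun r hr => massMargin_pos _ hr, ?_, ?_, ?_,
      fun r hr => hF ▸ (hC.mass_eq heq hsym hr).1, fun r hr => hG ▸ (hC.mass_eq heq hsym hr).2⟩
    · simp only [pow_one, Nat.cast_one] at t1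
      simpa only [(hint _).2.2] using t1
    · simp only [Nat.cast_ofNat, show α + 2 / 2 = α + 1 by ring] at t2
      simpa only [(hint _).1] using t2
    · simp only [Nat.cast_ofNat, show α + 4 / 2 = α + 2 by ring, Pi.sub_apply,
        integral_sub (i1 _) (i2 _)] at t3
      simpa only [(hint _).1, (hint _).2.1] using t3
  have hL := fun {β θ : ℝ} (hβ : 0 ≤ β) (hθ : 0 < θ) => (laplaceMoment_pos hpos hβ hθ).ne'
  obtain ⟨c₁, q₁, x₁, y₁, z₁, u₁, v₁⟩ := key θ₁ hθ₁ h₁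
  obtain ⟨c₂, q₂, x₂, y₂, z₂, u₂, v₂⟩ := key θ₂ hθ₂ h₂
  have e0 : ∀ π : Measure (ℝ × ℝ), massMargin π 0 = 0 := fun π => by simp [massMargin]
  have a0 := @hL α θ₁ hα hθ₁
  have a1 := @hL (α + 1 / 2) θ₁ (by linarith) hθ₁
  have b0 := @hL α θ₂ hα hθ₂
  have b1 := @hL (α + 1 / 2) θ₂ (by linarith) hθ₂
  have f₁ : gaussianPDFReal 0 1 0 * laplaceMoment ν (α + 1 / 2) θ₁ / laplaceMoment ν α θ₁ ≠ 0 :=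
    div_ne_zero (mul_ne_zero hφ0 a1) a0
  have f₂ : gaussianPDFReal 0 1 0 * laplaceMoment ν (α + 1 / 2) θ₂ / laplaceMoment ν α θ₂ ≠ 0 :=
    div_ne_zero (mul_ne_zero hφ0 b1) b0
  have e2 := div_pow_eq_of_comp_eq c₁ c₂ (e0 _) (e0 _) q₁ q₂ x₁ x₂ f₁ f₂ y₁ y₂ u₁ u₂
  have e4 := div_pow_eq_of_comp_eq c₁ c₂ (e0 _) (e0 _) q₁ q₂ x₁ x₂ f₁ f₂ z₁ z₂ v₁ v₂
  clear key hL u₁ u₂ v₁ v₂ x₁ x₂ y₁ y₂ z₁ z₂ f₁ f₂ c₁ c₂ q₁ q₂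
  generalize laplaceMoment ν (α + 1 / 2) θ₁ = A1 at *
  generalize laplaceMoment ν (α + 1 / 2) θ₂ = B1 at *
  generalize laplaceMoment ν α θ₁ = A0 at *
  generalize laplaceMoment ν α θ₂ = B0 at *
  generalize gaussianPDFReal 0 1 0 = φ at *
  generalize gaussianConst R = g at *
  constructor
  -- The factors `g` and `φ` do not depend on `θ` and are split off from the ratio of moments.
  · have l : ∀ x y z : ℝ, x ≠ 0 → y ≠ 0 → g * z / x / (φ * y / x) ^ 2 =
        g / φ ^ 2 * (z * x / y ^ 2) := fun x y z hx hy => by field_simp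
    rw [l _ _ _ a0 a1, l _ _ _ b0 b1] at e2
    exact mul_left_cancel₀ (div_ne_zero hg0 (pow_ne_zero _ hφ0)) e2
  · intro hr
    have l : ∀ x y z : ℝ, x ≠ 0 → y ≠ 0 → -(g * R⁻¹ 0 1) / 2 * z / x / (φ * y / x) ^ 4 =
        -(g * R⁻¹ 0 1) / 2 / φ ^ 4 * (z * x ^ 3 / y ^ 4) := fun x y z hx hy => by field_simp
    rw [l _ _ _ a0 a1, l _ _ _ b0 b1] at e4
    exact mul_left_cancel₀ (div_ne_zero (div_ne_zero (neg_ne_zero.2 (mul_ne_zero hg0 hr))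
      two_ne_zero) (pow_ne_zero _ hφ0)) e4

lemma inv_apply_zero_one_ne_zero {R : Matrix (Fin 2) (Fin 2) ℝ} (hR : R.PosDef) (h : R 0 1 ≠ 0) :
    R⁻¹ 0 1 ≠ 0 := by
  rw [Matrix.inv_def, Matrix.adjugate_fin_two, Ring.inverse_eq_inv']
  simpa using ⟨hR.det_pos.ne', h⟩

/-- A constant conditional copula forces relations between the Laplace transforms of the mixing
distribution. -/
theorem relations_of_hasConstantConditionalCopula {d : ℕ} {S : Matrix (Fin d) (Fin d) ℝ}
    (hS : S.PosDef) {ν : Measure ℝ} [IsProbabilityMeasure ν] (hpos : ∀ᵐ w ∂ν, 0 < w)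
    {D : Finset (Fin d)} (hD : D.Nonempty) {i j : Fin d} (hij : i ≠ j) (hi : i ∉ D) (hj : j ∉ D)
    {u v : Fin d → ℝ} (hu : IsResidualVector S D i u) (hv : IsResidualVector S D j v)
    (h : HasConstantConditionalCopula (normalScaleMixture S ν) i j D) :
    CentralRelation ν (D.card / 2) ∧ (residualCov S u v 0 1 ≠ 0 → MixedRelation ν (D.card / 2)) := by
  rw [hasConstantConditionalCopula_normalScaleMixture_iff hS hpos hi hj hu hv] at h
  obtain ⟨C, -, hC⟩ := h
  rw [Fintype.card_coe] at hC
  have hR := posDef_residualCov hS hij hi hj hu hv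
  have hSD := posDef_principalSubmatrix hS D
  set q := halfQuadForm (principalSubmatrix S D) with hq
  have hqc : Continuous q := continuous_halfQuadForm _
  set α : ℝ := D.card / 2 with hα'
  have hα : 0 ≤ α := by positivity
  have r0 : 0 < residualCov S u v 0 0 := hR.diag_pos
  have r1 : 0 < residualCov S u v 1 1 := hR.diag_pos
  -- Scaling the residuals to unit variance keeps the copula and makes the two margins equal, as
  -- `IsCopulaOf.mass_eq` requires.
  set s := (√(residualCov S u v 0 0))⁻¹ with hs
  set t := (√(residualCov S u v 1 1))⁻¹ with ht
  have hs0 : 0 < s := by positivity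
  have ht0 : 0 < t := by positivity
  set R := residualCov S (s • u) (t • v) with hR'
  have hRp : R.PosDef := posDef_residualCov_smul hR hs0.ne' ht0.ne'
  have h00 : R 0 0 = 1 := by
    rw [hR', residualCov_smul]
    simp only [Matrix.cons_val_zero, hs]
    rw [← mul_inv, Real.mul_self_sqrt r0.le, inv_mul_cancel₀ r0.ne']
  have h11 : R 1 1 = 1 := by
    rw [hR', residualCov_smul]
    simp only [Matrix.cons_val_one, Matrix.cons_val_zero, ht]
    rw [← mul_inv, Real.mul_self_sqrt r1.le, inv_mul_cancel₀ r1.ne']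
  have hC' : ∀ᵐ z : D → ℝ, IsCopulaOf C (mixPair (posteriorMixing ν α (q z)) (bivariateGaussian R)) := by
    filter_upwards [hC] with z hz
    rw [hR', ← residualLaw_map_scale hS.posSemidef, ← mixPair_map_scale]
    exact hz.map_scale hs0 ht0
  have hqpos : ∀ z : D → ℝ, z ≠ 0 → 0 < q z := fun z hz => halfQuadForm_pos hSD hz
  have : Nonempty D := hD.to_subtype
  have hz1 : (1 : D → ℝ) ≠ 0 := one_ne_zero
  -- The copula identity holds for almost all `z`, hence on a dense set. Since `q` maps the nonzero
  -- vectors onto the positive half-line and the ratios are continuous in `θ`, constancy extends to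
  -- all `θ > 0`. The value `z = 0` is left out because the moments may be infinite at `θ = 0`.
  have hdense : Dense {z : D → ℝ |
      IsCopulaOf C (mixPair (posteriorMixing ν α (q z)) (bivariateGaussian R))} :=
    Measure.dense_of_ae hC'
  obtain ⟨z₀, hz₀, hz₀C⟩ := hdense.inter_open_nonempty {z | z ≠ 0} isOpen_ne ⟨1, hz1⟩
  have hsurj : ∀ θ, 0 < θ → ∃ z : D → ℝ, z ≠ 0 ∧ q z = θ := fun θ hθ => by
    have h1 := hqpos 1 hz1
    refine ⟨√(θ / q 1) • 1, smul_ne_zero (by positivity) hz1, ?_⟩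
    rw [hq, halfQuadForm_smul, ← hq, Real.sq_sqrt (by positivity)]
    field_simp
  have hext : ∀ L : ℝ → ℝ, (∀ θ, 0 < θ → ContinuousAt L θ) →
      (∀ z, z ≠ 0 → IsCopulaOf C (mixPair (posteriorMixing ν α (q z)) (bivariateGaussian R)) →
        L (q z) = L (q z₀)) → ∀ θ, 0 < θ → L θ = L (q z₀) := fun L hL hg θ hθ => by
    obtain ⟨z, hz, rfl⟩ := hsurj θ hθ
    have hd : z ∈ closure ({z : D → ℝ | z ≠ 0} ∩ {z : D → ℝ |
        IsCopulaOf C (mixPair (posteriorMixing ν α (q z)) (bivariateGaussian R))}) :=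
      hdense.open_subset_closure_inter isOpen_ne hz
    have hne := mem_closure_iff_nhdsWithin_neBot.1 hd
    have h1 : Tendsto (fun z => L (q z)) (𝓝[{z : D → ℝ | z ≠ 0} ∩ {z : D → ℝ |
        IsCopulaOf C (mixPair (posteriorMixing ν α (q z)) (bivariateGaussian R))}] z)
        (𝓝 (L (q z))) :=
      ((hL _ (hqpos z hz)).comp hqc.continuousAt).tendsto.mono_left nhdsWithin_le_nhds
    refine tendsto_nhds_unique (h1.congr' ?_) tendsto_const_nhds
    filter_upwards [self_mem_nhdsWithin] with y hy
    exact hg y hy.1 hy.2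
  have hc : ∀ {β θ : ℝ}, 0 ≤ β → 0 < θ → ContinuousAt (laplaceMoment ν β) θ := fun hβ hθ =>
    continuousAt_laplaceMoment hpos hβ hθ
  have hne : ∀ {θ : ℝ}, 0 < θ → laplaceMoment ν (α + 1 / 2) θ ≠ 0 := fun hθ =>
    (laplaceMoment_pos hpos (by positivity) hθ).ne'
  constructor
  · refine ⟨_, fun θ hθ => (div_eq_iff (pow_ne_zero 2 (hne hθ))).1 (hext (fun θ =>
      laplaceMoment ν (α + 1) θ * laplaceMoment ν α θ / laplaceMoment ν (α + 1 / 2) θ ^ 2)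
      (fun θ hθ => ((hc (by positivity) hθ).mul (hc hα hθ)).div ((hc (by positivity) hθ).pow 2)
        (pow_ne_zero 2 (hne hθ)))
      (fun z hz hzC => (laplaceMoment_ratio_eq hRp h00 h11 hpos hα (hqpos z hz) (hqpos z₀ hz₀)
        hzC hz₀C).1) θ hθ)⟩
  · intro h01
    have hr01 : R⁻¹ 0 1 ≠ 0 := inv_apply_zero_one_ne_zero hRp (by
      rw [hR', residualCov_smul]
      simp only [Matrix.cons_val_one, Matrix.cons_val_zero]
      positivity)
    refine ⟨_, fun θ hθ => (div_eq_iff (pow_ne_zero 4 (hne hθ))).1 (hext (fun θ =>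
      laplaceMoment ν (α + 2) θ * laplaceMoment ν α θ ^ 3 / laplaceMoment ν (α + 1 / 2) θ ^ 4)
      (fun θ hθ => ((hc (by positivity) hθ).mul ((hc hα hθ).pow 3)).div
        ((hc (by positivity) hθ).pow 4) (pow_ne_zero 4 (hne hθ)))
      (fun z hz hzC => (laplaceMoment_ratio_eq hRp h00 h11 hpos hα (hqpos z hz) (hqpos z₀ hz₀)
        hzC hz₀C).2 hr01) θ hθ)⟩

end Necessity

/-! ### Edges of regular vines -/

section Vines

variable {d : ℕ}

lemma card_edgeSet_induce_of_support_subset {V : Type*} {G : SimpleGraph V} {s : Set V}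
    (h : G.support ⊆ s) : Nat.card (G.induce s).edgeSet = Nat.card G.edgeSet := by
  conv_rhs => rw [← (G.spanningCoe_induce_eq_self s).2 h]
  rw [SimpleGraph.spanningCoe, SimpleGraph.edgeSet_map, Nat.card_coe_set_eq, Nat.card_coe_set_eq,
    Set.ncard_image_of_injective _ (Function.Embedding.injective _)]

instance finite_vineNode (d : ℕ) : (k : ℕ) → Finite (VineNode d k)
  | 0 => inferInstanceAs (Finite (Fin d))
  | k + 1 => by
    have := finite_vineNode d k
    exact inferInstanceAs (Finite (Sym2 (VineNode d k)))

/-- A tree has one edge fewer than nodes, and its edges are the next node set. -/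
lemma RegularVine.card_vineNodeSet (V : RegularVine d) :
    ∀ k, k < d → Nat.card (vineNodeSet V.tree k) + k = d
  | 0, _ => by
    change Nat.card (Set.univ : Set (Fin d)) + 0 = d
    simp
  | k + 1, h => by
    have ih := V.card_vineNodeSet k (by omega)
    have h1 := (SimpleGraph.isTree_iff_connected_and_card.1 (V.isTree k h)).2
    rw [card_edgeSet_induce_of_support_subset (V.support_subset k h)] at h1
    change Nat.card (V.tree k).edgeSet + (k + 1) = d
    omega

lemma RegularVine.exists_adj (V : RegularVine d) {k : ℕ} (h : k + 1 < d) :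
    ∃ a ∈ vineNodeSet V.tree k, ∃ b ∈ vineNodeSet V.tree k, (V.tree k).Adj a b := by
  have h1 := V.card_vineNodeSet k (by omega)
  have : Nontrivial (vineNodeSet V.tree k) := Finite.one_lt_card_iff_nontrivial.1 (by omega)
  obtain ⟨a⟩ := (V.isTree k h).connected.nonempty
  obtain ⟨b, hb⟩ := (V.isTree k h).connected.preconnected.exists_adj_of_nontrivial a
  exact ⟨a, a.2, b, b.2, hb⟩

lemma RegularVine.isAcyclic_tree_zero (V : RegularVine d) (h : 1 < d) :
    (V.tree 0).IsAcyclic := by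
  have h1 : ((V.tree 0).induce (Set.univ : Set (VineNode d 0))).IsTree := V.isTree 0 h
  exact (SimpleGraph.Iso.isAcyclic_iff (SimpleGraph.induceUnivIso (V.tree 0))).1 h1.isAcyclic

/-- Two different edges of the first tree that share a node. -/
lemma RegularVine.exists_of_adj_one (V : RegularVine d) (h : 2 < d) {e f : VineNode d 1}
    (he : e ∈ (V.tree 0).edgeSet) (hf : f ∈ (V.tree 0).edgeSet) (hef : (V.tree 1).Adj e f) :
    ∃ a b c : Fin d, e = s((a : VineNode d 0), (b : VineNode d 0)) ∧
      f = s((c : VineNode d 0), (b : VineNode d 0)) ∧ a ≠ b ∧ c ≠ b ∧ a ≠ c := by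
  obtain ⟨b, hbe, hbf⟩ := V.proximity 0 h e f hef
  obtain ⟨a, rfl⟩ := Sym2.mem_iff_exists.1 hbe
  obtain ⟨c, rfl⟩ := Sym2.mem_iff_exists.1 hbf
  refine ⟨a, b, c, Sym2.eq_swap, Sym2.eq_swap, ?_, ?_, ?_⟩
  · exact (SimpleGraph.mem_edgeSet _ |>.1 he).ne'
  · exact (SimpleGraph.mem_edgeSet _ |>.1 hf).ne'
  · rintro rfl; exact hef.ne rfl

/-- The second tree of a regular vine has an edge with one conditioning variable. -/
lemma RegularVine.exists_edge_one (V : RegularVine d) (h : 3 ≤ d) :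
    ∃ e f : VineNode d 1, (V.tree 1).Adj e f ∧ ∃ i j b : Fin d,
      i ∈ VineNode.vars 1 e \ VineNode.vars 1 f ∧ j ∈ VineNode.vars 1 f \ VineNode.vars 1 e ∧
      VineNode.vars 1 e ∩ VineNode.vars 1 f = {b} := by
  obtain ⟨e, he, f, hf, hef⟩ := V.exists_adj (k := 1) (by omega)
  obtain ⟨a, b, c, rfl, rfl, hab, hcb, hac⟩ := V.exists_of_adj_one h he hf hef
  refine ⟨_, _, hef, a, c, b, ?_, ?_, ?_⟩
  · change a ∈ ({a, b} : Finset (Fin d)) \ {c, b}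
    simp [hab, hac]
  · change c ∈ ({c, b} : Finset (Fin d)) \ {a, b}
    simp [hcb, hac.symm]
  · change ({a, b} : Finset (Fin d)) ∩ {c, b} = {b}
    clear he hf hef
    ext x
    simp only [Finset.mem_inter, Finset.mem_insert, Finset.mem_singleton]
    grind

/-- The third tree of a regular vine has an edge with two conditioning variables. -/
lemma RegularVine.exists_edge_two (V : RegularVine d) (h : 4 ≤ d) :
    ∃ e f : VineNode d 2, (V.tree 2).Adj e f ∧ ∃ i j : Fin d,
      i ∈ VineNode.vars 2 e \ VineNode.vars 2 f ∧ j ∈ VineNode.vars 2 f \ VineNode.vars 2 e ∧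
      (VineNode.vars 2 e ∩ VineNode.vars 2 f).card = 2 := by
  obtain ⟨E, hE, F, hF, hEF⟩ := V.exists_adj (k := 2) (by omega)
  obtain ⟨e, heE, heF⟩ := V.proximity 1 (by omega) E F hEF
  obtain ⟨f, rfl⟩ := Sym2.mem_iff_exists.1 heE
  obtain ⟨g, rfl⟩ := Sym2.mem_iff_exists.1 heF
  have hfg : f ≠ g := by rintro rfl; exact hEF.ne rfl
  have hef : (V.tree 1).Adj e f := hE
  have heg : (V.tree 1).Adj e g := hF
  have hs := V.support_subset 1 (by omega)
  have he : e ∈ (V.tree 0).edgeSet := hs ((V.tree 1).mem_support.2 ⟨f, hef⟩)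
  have hf : f ∈ (V.tree 0).edgeSet := hs ((V.tree 1).mem_support.2 ⟨e, hef.symm⟩)
  have hg : g ∈ (V.tree 0).edgeSet := hs ((V.tree 1).mem_support.2 ⟨e, heg.symm⟩)
  obtain ⟨a, b, c, rfl, rfl, hab, hcb, hac⟩ := V.exists_of_adj_one (by omega) he hf hef
  obtain ⟨a', b', c', he', rfl, hab', hcb', hac'⟩ := V.exists_of_adj_one (by omega) he hg heg
  -- The edges `f` and `g` attach new variables `c` and `c'` to `e = {a, b}`. If these were equal,
  -- then `f = g` when both attach at the same node, and otherwise `a, b, c` would be a triangle in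
  -- the first tree. So `e` accounts for all the common variables.
  have hcc : c ≠ c' := by
    rintro rfl
    rcases Sym2.eq_iff.1 he' with ⟨h1, h2⟩ | ⟨h1, h2⟩
    · exact hfg (by rw [h2])
    · have h3 : (V.tree 0).CliqueFree 3 := (V.isAcyclic_tree_zero (by omega)).cliqueFree le_rfl
      have a1 : (V.tree 0).Adj a b := he
      have a2 : (V.tree 0).Adj c b := hf
      have a3 : (V.tree 0).Adj c a := by rw [h1]; exact hg
      exact h3 {a, b, c} (SimpleGraph.is3Clique_triple_iff.2 ⟨a1, a3.symm, a2.symm⟩)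
  have hset : ({a, b} : Finset (Fin d)) = {a', b'} := by
    have := congrArg (VineNode.vars 1) he'
    exact this
  have ha : c' ≠ a ∧ c' ≠ b := by
    rcases Sym2.eq_iff.1 he' with ⟨h1, h2⟩ | ⟨h1, h2⟩ <;> subst h1 h2
    · exact ⟨hac'.symm, hcb'⟩
    · exact ⟨hcb', hac'.symm⟩
  have hb' : b' = a ∨ b' = b := by
    have : b' ∈ ({a, b} : Finset (Fin d)) := by rw [hset]; simp
    simpa using this
  obtain ⟨h1, h2⟩ := ha
  refine ⟨_, _, hEF, c, c', ?_, ?_, ?_⟩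
  · change c ∈ (({a, b} : Finset (Fin d)) ∪ {c, b}) \ ({a, b} ∪ {c', b'})
    clear * - hb' hcc hac hcb
    simp only [Finset.mem_sdiff, Finset.mem_union, Finset.mem_insert, Finset.mem_singleton]
    grind
  · change c' ∈ (({a, b} : Finset (Fin d)) ∪ {c', b'}) \ ({a, b} ∪ {c, b})
    clear * - hcc h1 h2
    simp only [Finset.mem_sdiff, Finset.mem_union, Finset.mem_insert, Finset.mem_singleton]
    grind
  · change ((({a, b} : Finset (Fin d)) ∪ {c, b}) ∩ ({a, b} ∪ {c', b'})).card = 2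
    have h3 : (({a, b} : Finset (Fin d)) ∪ {c, b}) ∩ ({a, b} ∪ {c', b'}) = {a, b} := by
      clear * - hb' hcc hac hcb h1 h2
      ext x
      simp only [Finset.mem_inter, Finset.mem_union, Finset.mem_insert, Finset.mem_singleton]
      grind
    rw [h3, Finset.card_pair hab]

/-- Connectedness gives at least `n` edges; every edge joins consecutive vertices, so there are at
most `n`. -/
lemma isTree_pathGraph (n : ℕ) : (SimpleGraph.pathGraph (n + 1)).IsTree := by
  have hc := SimpleGraph.pathGraph_connected n
  refine SimpleGraph.isTree_iff_connected_and_card.2 ⟨hc, le_antisymm ?_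
    hc.card_vert_le_card_edgeSet_add_one⟩
  have hsub : (SimpleGraph.pathGraph (n + 1)).edgeSet ⊆
      Set.range fun i : Fin n => s(i.castSucc, i.succ) := by
    intro e
    induction e with | h a b
    intro hab
    rw [SimpleGraph.mem_edgeSet, SimpleGraph.pathGraph_adj] at hab
    rcases hab with hab | hab
    · exact ⟨⟨a, by omega⟩, Sym2.eq_iff.2 (Or.inl ⟨rfl, Fin.ext hab⟩)⟩
    · exact ⟨⟨b, by omega⟩, Sym2.eq_iff.2 (Or.inr ⟨rfl, Fin.ext hab⟩)⟩
  have h1 : Nat.card (SimpleGraph.pathGraph (n + 1)).edgeSet ≤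
      Nat.card (Set.range fun i : Fin n => s(i.castSucc, i.succ)) :=
    Nat.card_mono (Set.toFinite _) hsub
  have h2 := Finite.card_range_le fun i : Fin n => s(i.castSucc, i.succ)
  simp only [Nat.card_eq_fintype_card, Fintype.card_fin] at h1 h2 ⊢
  omega

/-- The nodes of the D-vine. -/
def pathNode (d : ℕ) [NeZero d] : (k : ℕ) → ℕ → VineNode d k
  -- `Fin.ofNat` wraps modulo `d`. Node `i` of level `k` is built from the variables `i, …, i + k`,
  -- so nothing wraps in the relevant range `i + k < d`.
  | 0 => fun i => (Fin.ofNat d i : Fin d)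
  | k + 1 => fun i => s(pathNode d k i, pathNode d k (i + 1))

lemma pathNode_injOn [NeZero d] : ∀ (k i j : ℕ), i + k < d → j + k < d →
    pathNode d k i = pathNode d k j → i = j
  | 0, i, j, hi, hj, h => by
    have h : (Fin.ofNat d i : Fin d) = Fin.ofNat d j := h
    have := congrArg Fin.val h
    simpa [Fin.ofNat, Nat.mod_eq_of_lt (show i < d from hi),
      Nat.mod_eq_of_lt (show j < d from hj)] using this
  | k + 1, i, j, hi, hj, h => by
    rcases Sym2.eq_iff.1 h with ⟨h1, -⟩ | ⟨h1, h2⟩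
    · exact pathNode_injOn k i j (by omega) (by omega) h1
    · have a1 := pathNode_injOn k i (j + 1) (by omega) (by omega) h1
      have a2 := pathNode_injOn k (i + 1) j (by omega) (by omega) h2
      omega

/-- The trees of the D-vine. -/
def pathTree (d : ℕ) [NeZero d] (k : ℕ) : SimpleGraph (VineNode d k) :=
  SimpleGraph.fromEdgeSet {e | ∃ i, i + k + 1 < d ∧ e = s(pathNode d k i, pathNode d k (i + 1))}

lemma pathTree_adj [NeZero d] {k : ℕ} {a b : VineNode d k} : (pathTree d k).Adj a b ↔
    ∃ i, i + k + 1 < d ∧ s(a, b) = s(pathNode d k i, pathNode d k (i + 1)) := by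
  rw [pathTree, SimpleGraph.fromEdgeSet_adj]
  refine ⟨fun h => h.1, fun h => ⟨h, ?_⟩⟩
  obtain ⟨i, hi, h⟩ := h
  rintro rfl
  have h1 : pathNode d k i = pathNode d k (i + 1) := by
    rcases Sym2.eq_iff.1 h with ⟨h1, h2⟩ | ⟨h1, h2⟩
    · exact h1.symm.trans h2
    · exact h2.symm.trans h1
  have := pathNode_injOn k i (i + 1) (by omega) (by omega) h1
  omega

lemma vineNodeSet_pathTree [NeZero d] : ∀ k, k < d →
    vineNodeSet (pathTree d) k = Set.range fun i : Fin (d - k) => pathNode d k i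
  | 0, _ => by
    have h1 : ∀ i : Fin d, i ∈ Set.range fun i : Fin (d - 0) => (Fin.ofNat d i : Fin d) := fun i =>
      ⟨i, Fin.ext (Nat.mod_eq_of_lt i.2)⟩
    exact (Set.eq_univ_of_forall h1).symm
  | k + 1, h => by
    have h1 : ∀ e : Sym2 (VineNode d k), e ∈ (pathTree d k).edgeSet ↔
        ∃ i : Fin (d - (k + 1)), s(pathNode d k i, pathNode d k (i + 1)) = e := fun e => by
      induction e with | h a b
      rw [SimpleGraph.mem_edgeSet, pathTree_adj]
      constructor
      · rintro ⟨i, hi, h⟩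
        exact ⟨⟨i, by omega⟩, h.symm⟩
      · rintro ⟨i, h⟩
        exact ⟨i, by omega, h.symm⟩
    exact Set.ext h1

/-- The paths of the D-vine as embedded path graphs. -/
def pathEmbedding (d : ℕ) [NeZero d] (k : ℕ) : SimpleGraph.pathGraph (d - k) ↪g pathTree d k where
  toFun i := pathNode d k i
  inj' i j h := Fin.ext (pathNode_injOn k i j (by omega) (by omega) h)
  map_rel_iff' {i j} := by
    change (pathTree d k).Adj (pathNode d k i) (pathNode d k j) ↔ _
    rw [pathTree_adj, SimpleGraph.pathGraph_adj]
    constructor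
    · rintro ⟨l, hl, h⟩
      rcases Sym2.eq_iff.1 h with ⟨h1, h2⟩ | ⟨h1, h2⟩
      · have a1 := pathNode_injOn k i l (by omega) (by omega) h1
        have a2 := pathNode_injOn k j (l + 1) (by omega) (by omega) h2
        omega
      · have a1 := pathNode_injOn k i (l + 1) (by omega) (by omega) h1
        have a2 := pathNode_injOn k j l (by omega) (by omega) h2
        omega
    · rintro (h | h)
      · exact ⟨i, by omega, by rw [h]⟩
      · exact ⟨j, by omega, by rw [h]; exact Sym2.eq_swap⟩

/-- The D-vine, all of whose trees are paths. -/
def pathVine (d : ℕ) [NeZero d] : RegularVine d where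
  tree := pathTree d
  support_subset k hk a ha := by
    obtain ⟨b, hab⟩ := (pathTree d k).mem_support.1 ha
    rw [vineNodeSet_pathTree k (by omega)]
    obtain ⟨i, hi, h⟩ := pathTree_adj.1 hab
    rcases Sym2.eq_iff.1 h with ⟨h1, -⟩ | ⟨h1, -⟩
    · exact ⟨⟨i, by omega⟩, h1.symm⟩
    · exact ⟨⟨i + 1, by omega⟩, h1.symm⟩
  isTree k hk := by
    rw [vineNodeSet_pathTree k (by omega)]
    refine (SimpleGraph.Iso.isTree_iff (pathEmbedding d k).isoInduceRange).1 ?_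
    obtain ⟨n, hn⟩ : ∃ n, d - k = n + 1 := ⟨d - k - 1, by omega⟩
    rw [hn]
    exact isTree_pathGraph n
  proximity k hk e f hef := by
    obtain ⟨i, hi, h⟩ := pathTree_adj.1 hef
    have h1 : pathNode d k (i + 1) ∈ (pathNode d (k + 1) i : Sym2 (VineNode d k)) :=
      Sym2.mem_mk_right _ _
    have h2 : pathNode d k (i + 1) ∈ (pathNode d (k + 1) (i + 1) : Sym2 (VineNode d k)) :=
      Sym2.mem_mk_left _ _
    refine ⟨pathNode d k (i + 1), ?_⟩
    rcases Sym2.eq_iff.1 h with ⟨rfl, rfl⟩ | ⟨rfl, rfl⟩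
    · exact ⟨h1, h2⟩
    · exact ⟨h2, h1⟩

end Vines

/-! ### Simplified pair copula constructions -/

section Simplified

variable {d : ℕ}

/-- The correlation matrix all of whose correlations are `1 / 2`. -/
noncomputable def equicorrelation (d : ℕ) : Matrix (Fin d) (Fin d) ℝ :=
  (1 / 2 : ℝ) • (1 : Matrix (Fin d) (Fin d) ℝ) +
    (1 / 2 : ℝ) • Matrix.vecMulVec (1 : Fin d → ℝ) (star (1 : Fin d → ℝ))

lemma equicorrelation_apply (i j : Fin d) :
    equicorrelation d i j = if i = j then 1 else 1 / 2 := by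
  simp only [equicorrelation, Matrix.add_apply, Matrix.smul_apply, Matrix.vecMulVec_apply,
    Matrix.one_apply]
  split_ifs <;> norm_num

lemma isCorrelationMatrix_equicorrelation (d : ℕ) : IsCorrelationMatrix (equicorrelation d) :=
  ⟨(Matrix.PosDef.one.smul (by norm_num)).add_posSemidef
    ((Matrix.posSemidef_vecMulVec_self_star _).smul (by norm_num)),
    fun i => by rw [equicorrelation_apply, if_pos rfl]⟩

lemma mulVec_sub_half_single (S : Matrix (Fin d) (Fin d) ℝ) (i b l : Fin d) :
    S.mulVec (Pi.single i 1 - (1 / 2 : ℝ) • Pi.single b 1) l = S l i - 1 / 2 * S l b := by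
  simp [Matrix.mulVec_sub, Matrix.mulVec_smul]

lemma isResidualVector_equicorrelation {i b : Fin d} (h : i ≠ b) :
    IsResidualVector (equicorrelation d) {b} i
      (Pi.single i 1 - (1 / 2 : ℝ) • Pi.single b 1) where
  self := by simp [h]
  zero l hl hli := by
    have : l ≠ b := by simpa using hl
    simp [hli, this]
  orth k hk := by
    obtain rfl : k = b := by simpa using hk
    rw [mulVec_sub_half_single, equicorrelation_apply, equicorrelation_apply, if_neg h.symm,
      if_pos rfl]
    norm_num

/-- The partial covariance is `1/2 - 1/4`. Equal correlations make this independent of the edge,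
which is not known before the vine is. -/
lemma residualCov_equicorrelation_ne_zero {i j b : Fin d} (hij : i ≠ j) (hi : i ≠ b)
    (hj : j ≠ b) : residualCov (equicorrelation d) (Pi.single i 1 - (1 / 2 : ℝ) • Pi.single b 1)
      (Pi.single j 1 - (1 / 2 : ℝ) • Pi.single b 1) 0 1 ≠ 0 := by
  rw [residualCov_apply]
  simp only [Matrix.cons_val_zero, Matrix.cons_val_one, sub_dotProduct, smul_dotProduct,
    single_dotProduct, mulVec_sub_half_single, equicorrelation_apply, hij, hi, hj.symm, if_true,
    if_false, smul_eq_mul]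
  norm_num

/-- A simplified scale mixture of Normals in dimension at least four has a Gamma mixing
distribution. -/
theorem exists_gammaMeasure_of_isSimplifiedPCC (hd : 4 ≤ d) {S : Matrix (Fin d) (Fin d) ℝ}
    (hS : S.PosDef) {ν : Measure ℝ} [IsProbabilityMeasure ν] (hpos : ∀ᵐ w ∂ν, 0 < w)
    (hnd : ∀ c : ℝ, ν ≠ Measure.dirac c) (h : IsSimplifiedPCC (normalScaleMixture S ν)) :
    ∃ p b : ℝ, 0 < p ∧ 0 < b ∧ ν = gammaMeasure p b := by
  obtain ⟨V, hV⟩ := h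
  have key : ∀ k, k + 1 < d → ∀ e f : VineNode d k, (V.tree k).Adj e f →
      ∀ i ∈ VineNode.vars k e \ VineNode.vars k f, ∀ j ∈ VineNode.vars k f \ VineNode.vars k e,
      (VineNode.vars k e ∩ VineNode.vars k f).Nonempty →
        CentralRelation ν ((VineNode.vars k e ∩ VineNode.vars k f).card / 2) := by
    intro k hk e f hef i hi j hj hD
    have h := hV k hk e f hef i hi j hj
    rw [Finset.mem_sdiff] at hi hj
    have hiD : i ∉ VineNode.vars k e ∩ VineNode.vars k f := fun h =>
      hi.2 (Finset.mem_of_mem_inter_right h)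
    have hjD : j ∉ VineNode.vars k e ∩ VineNode.vars k f := fun h =>
      hj.2 (Finset.mem_of_mem_inter_left h)
    have hij : i ≠ j := by rintro rfl; exact hi.2 hj.1
    obtain ⟨u, hu⟩ := exists_isResidualVector hS hiD
    obtain ⟨v, hv⟩ := exists_isResidualVector hS hjD
    exact (relations_of_hasConstantConditionalCopula hS hpos hD hij hiD hjD hu hv h).1
  obtain ⟨e₁, f₁, h₁, i₁, j₁, b, hi₁, hj₁, hD₁⟩ := V.exists_edge_one (by omega)
  obtain ⟨e₂, f₂, h₂, i₂, j₂, hi₂, hj₂, hD₂⟩ := V.exists_edge_two hd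
  -- One and two conditioning variables give the exponents 1/2 and 1.
  have r₁ := key 1 (by omega) e₁ f₁ h₁ i₁ hi₁ j₁ hj₁ (by rw [hD₁]; exact Finset.singleton_nonempty b)
  have r₂ := key 2 (by omega) e₂ f₂ h₂ i₂ hi₂ j₂ hj₂ (Finset.card_pos.1 (by omega))
  rw [hD₁, Finset.card_singleton, Nat.cast_one] at r₁
  rw [hD₂, Nat.cast_ofNat, div_self two_ne_zero] at r₂
  exact exists_gammaMeasure_of_central_central hpos hnd r₁ r₂

/-- If the scale mixture of Normals with all correlations equal to `1 / 2` is simplified, then the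
mixing distribution is a Gamma distribution. -/
theorem exists_gammaMeasure_of_isSimplifiedPCC_equicorrelation (hd : 3 ≤ d) {ν : Measure ℝ}
    [IsProbabilityMeasure ν] (hpos : ∀ᵐ w ∂ν, 0 < w) (hnd : ∀ c : ℝ, ν ≠ Measure.dirac c)
    (h : IsSimplifiedPCC (normalScaleMixture (equicorrelation d) ν)) :
    ∃ p b : ℝ, 0 < p ∧ 0 < b ∧ ν = gammaMeasure p b := by
  obtain ⟨V, hV⟩ := h
  obtain ⟨e, f, hef, i, j, b, hi, hj, hD⟩ := V.exists_edge_one hd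
  have h := hV 1 (by omega) e f hef i hi j hj
  rw [hD] at h
  have hb : b ∈ VineNode.vars 1 e ∩ VineNode.vars 1 f := by rw [hD]; exact Finset.mem_singleton_self b
  rw [Finset.mem_inter] at hb
  rw [Finset.mem_sdiff] at hi hj
  have hij : i ≠ j := by rintro rfl; exact hi.2 hj.1
  have hib : i ≠ b := by rintro rfl; exact hi.2 hb.2
  have hjb : j ≠ b := by rintro rfl; exact hj.2 hb.1
  have hr := relations_of_hasConstantConditionalCopula (isCorrelationMatrix_equicorrelation d).1
    hpos (Finset.singleton_nonempty b) hij (by simpa using hib) (by simpa using hjb)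
    (isResidualVector_equicorrelation hib) (isResidualVector_equicorrelation hjb) h
  rw [Finset.card_singleton, Nat.cast_one] at hr
  exact exists_gammaMeasure_of_central_mixed hpos hnd hr.1
    (hr.2 (residualCov_equicorrelation_ne_zero hij hib hjb))

/-- In the Gamma case each pair has a constant conditional copula given any set of other variables,
so the shape of the vine is irrelevant. -/
theorem isSimplifiedAlong_normalScaleMixture_gammaMeasure {S : Matrix (Fin d) (Fin d) ℝ}
    (hS : S.PosDef) {p b : ℝ} (hp : 0 < p) (hb : 0 < b) [IsProbabilityMeasure (gammaMeasure p b)]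
    (V : RegularVine d) : IsSimplifiedAlong (normalScaleMixture S (gammaMeasure p b)) V := by
  intro k _ e f _ i hi j hj
  rw [Finset.mem_sdiff] at hi hj
  exact hasConstantConditionalCopula_gamma hS hp hb (by rintro rfl; exact hi.2 hj.1)
    (fun h => hi.2 (Finset.mem_of_mem_inter_right h))
    (fun h => hj.2 (Finset.mem_of_mem_inter_left h))

theorem isSimplifiedPCC_normalScaleMixture_gammaMeasure (hd : d ≠ 0) {S : Matrix (Fin d) (Fin d) ℝ}
    (hS : S.PosDef) {p b : ℝ} (hp : 0 < p) (hb : 0 < b) [IsProbabilityMeasure (gammaMeasure p b)] :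
    IsSimplifiedPCC (normalScaleMixture S (gammaMeasure p b)) :=
  have : NeZero d := ⟨hd⟩
  ⟨pathVine d, isSimplifiedAlong_normalScaleMixture_gammaMeasure hS hp hb _⟩

end Simplified
-- The main theorem
theorem mainTheorem4 {d : ℕ} (ν : Measure ℝ) [IsProbabilityMeasure ν]
    (hpos : ∀ᵐ w ∂ν, 0 < w) (hnd : ∀ c : ℝ, ν ≠ Measure.dirac c) :
    (4 ≤ d → ∀ S : Matrix (Fin d) (Fin d) ℝ, S.PosDef →
      (IsSimplifiedPCC (normalScaleMixture S ν) ↔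
        ∃ p b : ℝ, 0 < p ∧ 0 < b ∧ ν = gammaMeasure p b)) ∧
    (3 ≤ d →
      ((∀ S : Matrix (Fin d) (Fin d) ℝ, IsCorrelationMatrix S →
          IsSimplifiedPCC (normalScaleMixture S ν)) ↔
        ∃ p b : ℝ, 0 < p ∧ 0 < b ∧ ν = gammaMeasure p b)) ∧
    (∀ p b : ℝ, 0 < p → 0 < b → ν = gammaMeasure p b →
      ∀ S : Matrix (Fin d) (Fin d) ℝ, S.PosDef →
        normalScaleMixture S ν = multivariateStudentT (2 * p) ((b / p) • S) ∧
        ∀ V : RegularVine d, IsSimplifiedAlong (normalScaleMixture S ν) V) := by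
  -- For necessity in (b) the equicorrelation matrix alone is enough.
  refine ⟨fun hd S hS => ⟨exists_gammaMeasure_of_isSimplifiedPCC hd hS hpos hnd, ?_⟩,
    fun hd => ⟨fun h => exists_gammaMeasure_of_isSimplifiedPCC_equicorrelation hd hpos hnd
      (h _ (isCorrelationMatrix_equicorrelation d)), ?_⟩, ?_⟩
  · rintro ⟨p, b, hp, hb, rfl⟩
    exact isSimplifiedPCC_normalScaleMixture_gammaMeasure (by omega) hS hp hb
  · rintro ⟨p, b, hp, hb, rfl⟩ S hS
    exact isSimplifiedPCC_normalScaleMixture_gammaMeasure (by omega) hS.1 hp hb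
  · rintro p b hp hb rfl S hS
    exact ⟨normalScaleMixture_gammaMeasure hS hp hb,
      isSimplifiedAlong_normalScaleMixture_gammaMeasure hS hp hb⟩
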